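/- Let $F$ be a non-archimedean local field whose residue field has characteristic $p$ and cardinality $q$, let $\overline F$ be a separable closure of $F$, $G_F=\mathrm{Gal}(\overline F/F)$, $I_F$ the inertia group, and $W_F\subset G_F$ the Weil group (the elements inducing an integral power of the $q$-power Frobenius on the residue field of $\overline F$), with the topology for which $I_F$, with its topology from $G_F$, is an open subgroup. Let $\ell\ne p$ be a prime, $E$ a finite extension of $\mathbb Q_\ell$, and $\rho_\ell:W_F\to\mathrm{GL}_n(E)$ a continuous homomorphism ($\ell$-adic topology on $\mathrm{GL}_n(E)$), with space $V_\ell=E^n$. For a subgroup $H\subset G_F$ write $V_\ell^{H}$ for the vectors fixed by $H\cap W_F$, and let $\operatorname{codim}$ denote the codimension over $E$ in the ambient space. For a finite Galois extension $K/F$ with group $G$, let $\mathcal O_K$ be the ring of integers of $K$, let $v_K$ be the normalized valuation, and for an integer $i\ge-1$ let $G_i$ be the group of $\sigma\in G$ with $v_K(\sigma x-x)\ge i+1$ for all $x\in\mathcal O_K$; for real $r\ge-1$ put $G_r=G_{\lceil r\rceil}$. Let $\varphi:[-1,\infty)\to[-1,\infty)$ be the continuous piecewise linear function with $\varphi(-1)=-1$,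 slope $1$ on $(-1,0)$ and slope $1/[G_0:G_i]$ on $(i-1,i)$ for $i\ge1$, and put $G^s=G_{\varphi^{-1}(s)}$. Let $G_F^s$ be the group of all $\sigma\in G_F$ with $\sigma|_K\in\mathrm{Gal}(K/F)^s$ for every finite Galois $K/F$ inside $\overline F$. If $\rho$ is a representation of $W_F$ on a finite dimensional space $V$ such that $\rho|_{I_F}$ factors through the inertia subgroup $G_0$ of $G=\mathrm{Gal}(K/F)$ for some finite Galois $K/F$, put $$a(\rho)=\sum_{i\ge0}\frac{\operatorname{codim}V^{G_i}}{[G_0:G_i]},\qquad \delta(\rho)=\sum_{i\ge1}\frac{\operatorname{codim}V^{G_i}}{[G_0:G_i]};$$ these do not depend on $K$. *Serre's conductor.* Let $\rho_{ss}$ be the semisimplification of $\rho_\ell$ (the direct sum of its Jordan–Hölder factors). Then $\rho_{ss}|_{I_F}$ factors as above, and $$a(\rho_\ell):=\operatorname{codim}V_\ell^{I_F}+\delta(\rho_{ss}).$$ *Deligne's conductor.* Let $\|\cdot\|:W_F\to\mathbb Q$ be the homomorphism that is trivial on $I_F$ and equal to $q^{-1}$ on geometric Frobenius elements. Choose a geometric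 Frobenius element $\Phi\in W_F$ and a nonzero continuous homomorphism $t_\ell:I_F\to\mathbb Q_\ell$. There is a corresponding Weil–Deligne representation $(\rho,N)$ on $V=E^n$, that is, a representation $\rho$ of $W_F$ with open kernel and an endomorphism $N$ (necessarily nilpotent) such that $\rho(w)N\rho(w)^{-1}=\|w\|N$ for all $w\in W_F$ and $$\rho_\ell(\Phi^m\sigma)=\rho(\Phi^m\sigma)\exp(t_\ell(\sigma)N)\qquad(m\in\mathbb Z,\ \sigma\in I_F).$$ With $V_N=\ker N$, put $$a_D(\rho_\ell):=a(\rho)+\dim V^{I_F}-\dim V_N^{I_F},$$ which does not depend on the choices. **Theorem.** The function $s\mapsto\operatorname{codim}V_\ell^{G_F^s}$ is integrable on $(-1,\infty)$, the conductors $a(\rho_\ell)$ and $a_D(\rho_\ell)$ are well defined, and $$\int_{-1}^\infty\operatorname{codim}V_\ell^{G_F^s}\,ds=a(\rho_\ell)=a_D(\rho_\ell).$$ -/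

import Mathlib

open scoped ValuativeRel DirectSum
open MeasureTheory

noncomputable section

namespace LocalConductor

/-! ### Rings of integers and ramification groups -/

section Ramification

variable (F : Type*) [Field F] [ValuativeRel F]

/-- The ring of integers of an algebraic extension `K` of the local field `F`. -/
abbrev integers (K : Type*) [Field K] [Algebra F K] : Subalgebra 𝒪[F] K :=
  integralClosure 𝒪[F] K

/-- The maximal ideal of the ring of integers of `K`. As `F` is complete, this ring is local, and so
its Jacobson radical (the intersection of all its maximal ideals) is its unique maximal ideal. -/
abbrev maxIdeal (K : Type*) [Field K] [Algebra F K] : Ideal (integers F K) :=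
  Ring.jacobson (integers F K)

/-- The cardinality `q` of the residue field of `F`. -/
def residueCard : ℕ := Nat.card 𝓀[F]

/-- The lower ramification group `G_r` of `Gal(K/F)` for real `r ≥ -1`: with `i` the smallest
integer `≥ r`, it consists of all `σ` with `σ x - x ∈ 𝔪 ^ (i + 1)` for all integers `x` of `K`,
that is, `v_K (σ x - x) ≥ i + 1` for the normalized valuation `v_K`. -/
def lowerGroup (K : Type*) [Field K] [Algebra F K] (r : ℝ) : Subgroup (K ≃ₐ[F] K) :=
  (maxIdeal F K ^ (⌈r⌉ + 1).toNat).inertia (K ≃ₐ[F] K)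

/-- The index `[G_0 : G_r]`. It is `1` for `-1 ≤ r ≤ 0`. -/
def lowerIndex (K : Type*) [Field K] [Algebra F K] (r : ℝ) : ℕ :=
  (lowerGroup F K r).relIndex (lowerGroup F K 0)

/-- The Herbrand function `φ`: it is continuous with `φ (-1) = -1`, it has slope `1` on `(-1, 0)`
and slope `1 / [G_0 : G_i]` on `(i - 1, i)`. -/
def herbrandPhi (K : Type*) [Field K] [Algebra F K] (r : ℝ) : ℝ :=
  -1 + ∫ t in (-1 : ℝ)..r, (1 : ℝ) / lowerIndex F K t

/-- The inverse function `ψ : [-1, ∞) → [-1, ∞)` of `φ`. -/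
def herbrandPsi (K : Type*) [Field K] [Algebra F K] : ℝ → ℝ :=
  Function.invFunOn (herbrandPhi F K) (Set.Ici (-1))

/-- The upper ramification group `G^s = G_{ψ (s)}` of a finite Galois extension `K / F`. -/
def upperGroup (K : Type*) [Field K] [Algebra F K] (s : ℝ) : Subgroup (K ≃ₐ[F] K) :=
  lowerGroup F K (herbrandPsi F K s)

end Ramification

/-! ### The absolute Galois group, the inertia group and the Weil group -/

section Weil

variable (F : Type*) [Field F] [ValuativeRel F] (Ω : Type*) [Field Ω] [Algebra F Ω]

/-- The upper numbering ramification group `G_F^s` of the absolute Galois group `Gal(Ω/F)`: all `σ`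
whose restriction to every finite Galois subextension `K` lies in `Gal(K/F)^s`. -/
def absUpperGroup (s : ℝ) : Subgroup (Ω ≃ₐ[F] Ω) :=
  ⨅ K : FiniteGaloisIntermediateField F Ω,
    (upperGroup F K s).comap (AlgEquiv.restrictNormalHom (F := F) (K₁ := Ω) K)

/-- The inertia group in `Gal(Ω/F)`: it acts as the identity on the residue field of `Ω`. -/
def absInertia : Subgroup (Ω ≃ₐ[F] Ω) :=
  (maxIdeal F Ω).inertia (Ω ≃ₐ[F] Ω)

variable {F Ω} in
/-- `σ` induces the `(b - a)`-th power of the `q`-power Frobenius automorphism of the residue field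
of `Ω`, i.e. `(σ x) ^ (q ^ a) = x ^ (q ^ b)` there for all `x`. -/
def ActsAsFrobenius (σ : Ω ≃ₐ[F] Ω) (a b : ℕ) : Prop :=
  ∀ x : integers F Ω,
    (σ • x) ^ (residueCard F ^ a) - x ^ (residueCard F ^ b) ∈ maxIdeal F Ω

/-- The Weil group as a subgroup of `Gal(Ω/F)`: the elements inducing an integral power of the
`q`-power Frobenius on the residue field. -/
def weilSubgroup : Subgroup (Ω ≃ₐ[F] Ω) where
  carrier := {σ | ∃ a b : ℕ, ActsAsFrobenius σ a b}
  one_mem' := ⟨0, 0, fun x => by simp⟩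
  mul_mem' := by
    rintro σ τ ⟨a, b, h⟩ ⟨a', b', h'⟩
    refine ⟨a + a', b + b', fun x => ?_⟩
    rw [← Ideal.Quotient.eq]
    have h1 := Ideal.Quotient.eq.2 (h (τ • x))
    have h2 := Ideal.Quotient.eq.2 (h' x)
    simp only [map_pow] at h1 h2 ⊢
    rw [mul_smul, pow_add, pow_mul, h1, ← pow_mul, mul_comm, pow_mul, h2, ← pow_mul, ← pow_add,
      add_comm]
  inv_mem' := by
    rintro σ ⟨a, b, h⟩
    refine ⟨b, a, fun x => ?_⟩
    have h1 := h (σ⁻¹ • x)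
    rw [smul_inv_smul] at h1
    simpa using neg_mem h1

/-- The Weil group `W_F`. This is a type of its own since its topology is not the one induced from
`Gal(Ω/F)`. -/
def WeilGroup : Type _ := weilSubgroup F Ω

instance : Group (WeilGroup F Ω) := inferInstanceAs (Group (weilSubgroup F Ω))

/-- The inclusion of the Weil group into the absolute Galois group. -/
def WeilGroup.incl : WeilGroup F Ω →* (Ω ≃ₐ[F] Ω) := (weilSubgroup F Ω).subtype

/-- The inertia group `I_F`, as a subgroup of the Weil group. -/
def inertia : Subgroup (WeilGroup F Ω) := (absInertia F Ω).comap (WeilGroup.incl F Ω)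

/-- The topology of `W_F`: the coarsest one for which the inclusion into `Gal(Ω/F)` (with its Krull
topology) is continuous and the cosets of `I_F` are open. So `I_F` is open in `W_F` and carries the
topology induced from `Gal(Ω/F)`. -/
instance : TopologicalSpace (WeilGroup F Ω) :=
  TopologicalSpace.induced (WeilGroup.incl F Ω) inferInstance ⊓
    TopologicalSpace.induced (QuotientGroup.mk : WeilGroup F Ω → WeilGroup F Ω ⧸ inertia F Ω) ⊥

variable {F Ω}

/-- `Φ ∈ W_F` is a geometric Frobenius element: it induces the inverse of the `q`-power Frobenius
automorphism of the residue field of `Ω`. -/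
def IsGeomFrobenius (Φ : WeilGroup F Ω) : Prop := ActsAsFrobenius (WeilGroup.incl F Ω Φ) 1 0

/-- The homomorphism `‖·‖ : W_F → ℚ`, trivial on inertia and equal to `q⁻¹` on geometric Frobenius
elements: `‖w‖ = q ^ d` if `w` induces the `d`-th power of the `q`-power Frobenius. (The residue
field of `Ω` is infinite, so that `d` is determined by `w`.) -/
def weilNorm (w : WeilGroup F Ω) : ℚ :=
  (residueCard F : ℚ) ^ ((w.2.choose_spec.choose : ℤ) - (w.2.choose : ℤ))

/-- The elements of `W_F` that lie in the subgroup `G_F^s`. -/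
def upperSet (F : Type*) [Field F] [ValuativeRel F] (Ω : Type*) [Field Ω] [Algebra F Ω] (s : ℝ) :
    Set (WeilGroup F Ω) :=
  {w | WeilGroup.incl F Ω w ∈ absUpperGroup F Ω s}

/-- Restriction `W_F → Gal(K/F)`. -/
def restrictTo (K : FiniteGaloisIntermediateField F Ω) : WeilGroup F Ω →* (K ≃ₐ[F] K) :=
  (AlgEquiv.restrictNormalHom (F := F) (K₁ := Ω) K).comp (WeilGroup.incl F Ω)

/-- The elements of `I_F` whose restriction to `K` lies in the lower ramification group `G_i`
of `Gal(K/F)`. -/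
def lowerSet (K : FiniteGaloisIntermediateField F Ω) (i : ℕ) : Set (WeilGroup F Ω) :=
  {w | w ∈ inertia F Ω ∧ restrictTo K w ∈ lowerGroup F K i}

end Weil

/-! ### Artin and Swan conductors of representations with finite image of inertia -/

section Conductor

variable {F : Type*} [Field F] [ValuativeRel F] {Ω : Type*} [Field Ω] [Algebra F Ω]
  {E : Type*} [Field E] {V : Type*} [AddCommGroup V] [Module E V]

/-- The subspace of vectors fixed by all elements of `S`. -/
def fixedBy {G : Type*} [Group G] (ρ : Representation E G V) (S : Set G) : Submodule E V where
  carrier := {v | ∀ g ∈ S, ρ g v = v}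
  add_mem' := fun ha hb g hg => by rw [map_add, ha g hg, hb g hg]
  zero_mem' := fun g _ => map_zero _
  smul_mem' := fun c v hv g hg => by rw [map_smul, hv g hg]

/-- The codimension of the subspace of vectors fixed by `S`. -/
def codimFixed {G : Type*} [Group G] (ρ : Representation E G V) (S : Set G) : ℕ :=
  Module.finrank E (V ⧸ fixedBy ρ S)

/-- The restriction of `ρ` to `I_F` factors through the inertia subgroup `G_0` of `Gal(K/F)`, i.e.
`ρ` is trivial on the elements of `I_F` that act trivially on `K`. -/
def FactorsThrough (ρ : Representation E (WeilGroup F Ω) V)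
    (K : FiniteGaloisIntermediateField F Ω) : Prop :=
  ∀ w ∈ inertia F Ω, restrictTo K w = 1 → ρ w = 1

/-- The sum `∑_{i ≥ 0} codim V^{G_i} / [G_0 : G_i]` for `G = Gal(K/F)`. -/
def artinSum (ρ : Representation E (WeilGroup F Ω) V) (K : FiniteGaloisIntermediateField F Ω) : ℝ :=
  ∑ᶠ i : ℕ, (codimFixed ρ (lowerSet K i) : ℝ) / lowerIndex F K i

/-- The sum `∑_{i ≥ 1} codim V^{G_i} / [G_0 : G_i]` for `G = Gal(K/F)`. -/
def swanSum (ρ : Representation E (WeilGroup F Ω) V) (K : FiniteGaloisIntermediateField F Ω) : ℝ :=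
  ∑ᶠ i : ℕ, (codimFixed ρ (lowerSet K (i + 1)) : ℝ) / lowerIndex F K (i + 1 : ℕ)

/-- The Artin conductor `a(ρ)` of `ρ` is well defined and equal to `a`: the restriction of `ρ` to
`I_F` factors through a finite Galois extension, and all of these compute the value `a`. -/
def HasArtinConductor (ρ : Representation E (WeilGroup F Ω) V) (a : ℝ) : Prop :=
  (∃ K, FactorsThrough ρ K) ∧ ∀ K, FactorsThrough ρ K → artinSum ρ K = a

/-- The wild (Swan) conductor `δ(ρ)` of `ρ` is well defined and equal to `d`. -/
def HasSwanConductor (ρ : Representation E (WeilGroup F Ω) V) (d : ℝ) : Prop :=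
  (∃ K, FactorsThrough ρ K) ∧ ∀ K, FactorsThrough ρ K → swanSum ρ K = d

end Conductor

/-! ### Semisimplification -/

section Semisimplification

variable {E : Type*} [Field E] {V : Type*} [AddCommGroup V] [Module E V] {G : Type*} [Group G]

/-- A composition series `0 = V_0 ⊂ V_1 ⊂ ... ⊂ V_k = V` of the representation `ρ`: a chain of
subrepresentations, each maximal among the proper subrepresentations of the next one. -/
structure CompSeries (ρ : Representation E G V) where
  /-- The chain of subrepresentations. -/
  chain : RelSeries {p : Subrepresentation ρ × Subrepresentation ρ | p.1 ⋖ p.2}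
  head_eq : chain.head = ⊥
  last_eq : chain.last = ⊤

namespace CompSeries

variable {ρ : Representation E G V} (S : CompSeries ρ)

/-- The space of the Jordan–Hölder factor `V_{i+1} / V_i`. -/
abbrev Factor (i : Fin S.chain.length) : Type _ :=
  (S.chain i.succ).toSubmodule ⧸
    (S.chain i.castSucc).toSubmodule.submoduleOf (S.chain i.succ).toSubmodule

/-- The action on the Jordan–Hölder factor `V_{i+1} / V_i`. -/
def factorRep (i : Fin S.chain.length) : Representation E G (S.Factor i) :=
  (S.chain i.succ).toRepresentation.quotient
    ((S.chain i.castSucc).toSubmodule.submoduleOf (S.chain i.succ).toSubmodule)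
    (fun g _ hv => (S.chain i.castSucc).apply_mem_toSubmodule g hv)

/-- The semisimplification: the direct sum of the Jordan–Hölder factors. -/
def semisimplification : Representation E G (⨁ i, S.Factor i) :=
  Representation.directSum S.factorRep

end CompSeries

end Semisimplification

/-! ### Weil–Deligne representations -/

section WeilDeligne

variable {F : Type*} [Field F] [ValuativeRel F] {Ω : Type*} [Field Ω] [Algebra F Ω]
  {E : Type*} [Field E] {V : Type*} [AddCommGroup V] [Module E V]

/-- `(ρ, N)` is a Weil–Deligne representation on the finite dimensional space `V`: `ρ` is continuous
for the discrete topology (its kernel is open) and `ρ(w) N ρ(w)⁻¹ = ‖w‖ N` for all `w`. -/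
structure IsWeilDeligne (ρ : Representation E (WeilGroup F Ω) V) (N : Module.End E V) : Prop where
  isOpen_ker : IsOpen {w | ρ w = 1}
  conj : ∀ w, ρ w * N * ρ w⁻¹ = (weilNorm w : E) • N

/-- The exponential `1 + X + X² / 2! + ...` of a nilpotent endomorphism, a finite sum. -/
def nilpotentExp (X : Module.End E V) : Module.End E V :=
  ∑ k ∈ Finset.range (nilpotencyClass X), ((k.factorial : E)⁻¹) • X ^ k

/-- `(ρ, N)` is the Weil–Deligne representation that corresponds to `ρℓ`, with respect to the
geometric Frobenius element `Φ` and the nonzero homomorphism `t : I_F → ℚ_ℓ`: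
`ρℓ (Φ ^ m σ) = ρ (Φ ^ m σ) exp (t(σ) N)` for all integers `m` and all `σ ∈ I_F`. -/
structure Corresponds {ℓ : ℕ} [Fact ℓ.Prime] [Algebra ℚ_[ℓ] E]
    (ρℓ : Representation E (WeilGroup F Ω) V) (Φ : WeilGroup F Ω)
    (t : inertia F Ω →* Multiplicative ℚ_[ℓ])
    (ρ : Representation E (WeilGroup F Ω) V) (N : Module.End E V) : Prop where
  frobenius : IsGeomFrobenius Φ
  t_continuous : Continuous t
  t_ne_one : t ≠ 1
  weilDeligne : IsWeilDeligne ρ N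
  formula : ∀ (m : ℤ) (σ : inertia F Ω),
    ρℓ (Φ ^ m * σ) =
      ρ (Φ ^ m * σ) * nilpotentExp (algebraMap ℚ_[ℓ] E (t σ).toAdd • N)

/-- The Artin conductor `a(ρ, N) = a(ρ) + dim V^{I_F} - dim V_N^{I_F}`, with `V_N = ker N`, of the
Weil–Deligne representation `(ρ, N)` is well defined and equal to `a`. -/
def HasWeilDeligneConductor (ρ : Representation E (WeilGroup F Ω) V) (N : Module.End E V)
    (a : ℝ) : Prop :=
  ∃ a₀ : ℝ, HasArtinConductor ρ a₀ ∧
    a = a₀ + (Module.finrank E (fixedBy ρ (inertia F Ω)) : ℝ)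
      - (Module.finrank E (fixedBy ρ (inertia F Ω) ⊓ LinearMap.ker N : Submodule E V) : ℝ)

end WeilDeligne

/-! ### `ℓ`-adic representations -/

section Ladic

variable {F : Type*} [Field F] [ValuativeRel F] {Ω : Type*} [Field Ω] [Algebra F Ω]
  {E : Type*} [Field E]

/-- The representation on `E ^ n` given by a homomorphism to `GL_n (E)`. -/
def toRep {G : Type*} [Group G] {n : ℕ} (ρ : G →* Matrix.GeneralLinearGroup (Fin n) E) :
    Representation E G (Fin n → E) where
  toFun g := Matrix.toLin' (ρ g : Matrix (Fin n) (Fin n) E)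
  map_one' := by simp [Module.End.one_eq_id]
  map_mul' g h := by simp [Matrix.toLin'_mul, Module.End.mul_eq_comp]

variable {V : Type*} [AddCommGroup V] [Module E V]

/-- Serre's conductor `ε(ρℓ) + δ(ρ_ss)` is well defined and equal to `a`, where
`ε(ρℓ) = codim V^{I_F}` and `ρ_ss` is the semisimplification of `ρℓ`. -/
def HasSerreConductor (ρℓ : Representation E (WeilGroup F Ω) V) (a : ℝ) : Prop :=
  Nonempty (CompSeries ρℓ) ∧
    ∀ S : CompSeries ρℓ, ∃ d : ℝ, HasSwanConductor (V := ⨁ i, S.Factor i) S.semisimplification d ∧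
      a = (codimFixed ρℓ (inertia F Ω) : ℝ) + d

/-- Deligne's conductor `a_D(ρℓ)` is well defined and equal to `a`: there is a Weil–Deligne
representation that corresponds to `ρℓ`, and every such, for all choices of the Frobenius element
and of the homomorphism `t`, has conductor `a`. -/
def HasDeligneConductor (ℓ : ℕ) [Fact ℓ.Prime] [Algebra ℚ_[ℓ] E]
    (ρℓ : Representation E (WeilGroup F Ω) V) (a : ℝ) : Prop :=
  (∃ (Φ : WeilGroup F Ω) (t : inertia F Ω →* Multiplicative ℚ_[ℓ])
      (ρ : Representation E (WeilGroup F Ω) V) (N : Module.End E V), Corresponds ρℓ Φ t ρ N) ∧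
    ∀ (Φ : WeilGroup F Ω) (t : inertia F Ω →* Multiplicative ℚ_[ℓ])
      (ρ : Representation E (WeilGroup F Ω) V) (N : Module.End E V),
      Corresponds ρℓ Φ t ρ N → HasWeilDeligneConductor ρ N a

end Ladic

end LocalConductor

end

/-!
For a representation `ρ` of the Weil group that is trivial on an open subgroup of inertia, the
integral of `codim V^{G_F^s}` over `s > 0` is a rewriting of the Swan conductor: for a finite Galois
extension `K` through which `ρ` factors on inertia, `G_F^s` acts on `V` through `Gal(K/F)^s`, which
is `G_i` for `φ(i - 1) < s ≤ φ(i)`, an interval of length `1 / [G_0 : G_i]` (`integral_codimFixed`).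
In particular the Swan sum does not depend on `K`. That `G_F^s` maps onto `Gal(K/F)^s` is a
compactness argument (`exists_mem_absUpperGroup`) based on the compatibility of the upper numbering
with quotients (`mem_upperGroup_iff_exists`), i.e. Herbrand's theorem. The latter is proved for
discrete valuation rings with finite residue fields, in the form that the ramification number of an
element of a quotient is, up to the ramification index, the sum of those of its preimages
(`card_mul_ramNumber`).

Let `(ρ, N)` be a Weil–Deligne pair that corresponds to the continuous `ℓ`-adic representation `ρℓ`.
Since wild inertia is pro-`p`, every continuous homomorphism `t : I_F → ℚ_ℓ` is trivial on it. Thus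
`ρℓ` and `ρ` agree on `G_F^s` for `s > 0` (`Corresponds.apply_eq_of_mem_upperSet`). For
`-1 < s ≤ 0` the group `G_F^s` is inertia. So the whole integral is `codim V_ℓ^{I_F}` plus the Swan conductor of `ρ`.

* Deligne's conductor: some `σ ∈ I_F` with `t(σ) ≠ 0` acts trivially under `ρ`, and this forces
  `V_ℓ^{I_F} = V^{I_F} ∩ ker N` (`Corresponds.fixedBy_inertia`). Hence
  `a(ρ) + dim V^{I_F} - dim V_N^{I_F}` is `codim V_ℓ^{I_F}` plus the Swan conductor of `ρ`.
* Serre's conductor: the part of inertia on which `ρ` is trivial acts unipotently under `ρℓ`, and so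
  trivially on the Jordan–Hölder factors (`CompSeries.factorRep_eq_one`). As `G_F^s` acts through a
  finite group for `s > 0`, the dimension of its fixed vectors does not change under
  semisimplification (`CompSeries.finrank_fixedBy_semisimplification`).

The pair `(ρ, N)` exists by Grothendieck's monodromy theorem (`exists_monodromy`). The homomorphism
`t` is the Kummer character of a uniformizer of `F`, on which the Weil group acts through the norm
(`exists_tame_char`). A subgroup of inertia with pro-`ℓ` image under `ρℓ` acts through its tame
quotient, which is topologically generated by one element `σ₁`. As a Frobenius element conjugates
`ρℓ(σ₁)` to its `q`-th power, its eigenvalues are roots of unity, and `N` is the logarithm of a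
unipotent power of `ρℓ(σ₁)`.
-/

noncomputable section

namespace LocalConductor

set_option linter.unusedSectionVars false

/-! ### Group actions on a discrete valuation ring -/

section DVR

open IsLocalRing Polynomial

variable {B : Type*} [CommRing B] [IsDomain B] [IsDiscreteValuationRing B]
  {G : Type*} [Group G] [MulSemiringAction G B]

/-- Ideals of a discrete valuation ring are closed (Krull's intersection theorem). -/
lemma mem_of_forall_mem_sup_pow (J : Ideal B) {x : B}
    (h : ∀ k : ℕ, x ∈ J ⊔ maximalIdeal B ^ k) : x ∈ J := by
  by_cases hJ : J = ⊥
  · subst hJ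
    have h2 := Ideal.iInf_pow_eq_bot_of_isLocalRing (maximalIdeal B) (Ideal.IsPrime.ne_top')
    rw [← h2, Ideal.mem_iInf]
    intro k
    simpa using h k
  · obtain ⟨n, hn⟩ := exists_maximalIdeal_pow_eq_of_principal B
      (IsPrincipalIdealRing.principal _) J hJ
    have := h n
    rwa [hn, sup_idem, ← hn] at this

/-- If every element of `S` is, modulo `ϖ S`, fixed by `g`, then `g c - c` is divisible by
`g ϖ - ϖ` for all `c ∈ S`. -/
lemma smul_sub_mem_span (g : G) (S : Set B) {ϖ : B} (hϖ : ϖ ∈ maximalIdeal B)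
    (hS : ∀ c ∈ S, ∃ r, g • r = r ∧ ∃ c' ∈ S, c = r + ϖ * c') {c : B} (hc : c ∈ S) :
    g • c - c ∈ Ideal.span {g • ϖ - ϖ} := by
  apply mem_of_forall_mem_sup_pow
  intro k
  induction k generalizing c with
  | zero => simp
  | succ k ih =>
    obtain ⟨r, hr, c', hc', rfl⟩ := hS c hc
    have e : g • (r + ϖ * c') - (r + ϖ * c') =
        (g • c') * (g • ϖ - ϖ) + ϖ * (g • c' - c') := by
      rw [smul_add, smul_mul', hr]; ring
    rw [e]
    refine add_mem (Ideal.mem_sup_left (Ideal.mul_mem_left _ _ (Ideal.mem_span_singleton_self _))) ?_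
    obtain ⟨a, ha, b, hb, hab⟩ := Submodule.mem_sup.1 (ih hc')
    rw [← hab, mul_add]
    refine add_mem (Ideal.mem_sup_left (Ideal.mul_mem_left _ _ ha)) (Ideal.mem_sup_right ?_)
    rw [pow_succ']
    exact Ideal.mul_mem_mul hϖ hb

/-- Every residue class of `B` contains an element fixed by the inertia group: the residue field
of the fixed ring is all of the residue field of `B`, because the decomposition group surjects
onto the automorphism group of the residue extension, and this group is trivial. -/
lemma exists_fixed_rep [Finite G] [Finite (ResidueField B)] {Γ : Subgroup G}
    (hΓ : Γ ≤ (maximalIdeal B).inertia G) (b : B) :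
    ∃ r : B, (∀ γ ∈ Γ, γ • r = r) ∧ b - r ∈ maximalIdeal B := by
  let A := FixedPoints.subring B Γ
  have hinv : Algebra.IsInvariant A B Γ := ⟨fun b hb => ⟨⟨b, hb⟩, rfl⟩⟩
  have hsc : SMulCommClass Γ A B := inferInstance
  let Q := maximalIdeal B
  let P := Q.under A
  have hsurj := Ideal.Quotient.stabilizerHom_surjective Γ P Q
  have hint := Algebra.IsInvariant.isIntegral A B Γ
  have hPmax : P.IsMaximal := Ideal.isMaximal_comap_of_isIntegral_of_isMaximal Q
  let _ := Ideal.Quotient.field P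
  let _ : Field (B ⧸ Q) := Ideal.Quotient.field Q
  have : Finite (B ⧸ Q) := ‹Finite (ResidueField B)›
  have : Finite (A ⧸ P) := Finite.of_injective (algebraMap (A ⧸ P) (B ⧸ Q))
    (algebraMap (A ⧸ P) (B ⧸ Q)).injective
  have hcard := IsGalois.card_aut_eq_finrank (A ⧸ P) (B ⧸ Q)
  have hsub : Subsingleton ((B ⧸ Q) ≃ₐ[A ⧸ P] B ⧸ Q) := by
    refine ⟨fun σ τ => ?_⟩
    suffices ∀ σ : (B ⧸ Q) ≃ₐ[A ⧸ P] B ⧸ Q, σ = 1 by rw [this σ, this τ]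
    intro σ
    obtain ⟨s, rfl⟩ := hsurj σ
    ext x
    obtain ⟨x, rfl⟩ := Ideal.Quotient.mk_surjective x
    exact Ideal.Quotient.eq.2 (hΓ s.1.2 x)
  rw [Nat.card_unique] at hcard
  have hbij := (Algebra.finrank_eq_one_iff_bijective_algebraMap (F := A ⧸ P) (E := B ⧸ Q)).1 hcard.symm
  obtain ⟨r, hr⟩ := hbij.2 (Ideal.Quotient.mk Q b)
  obtain ⟨r, rfl⟩ := Ideal.Quotient.mk_surjective r
  refine ⟨r.1, fun γ hγ => r.2 ⟨γ, hγ⟩, ?_⟩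
  exact Ideal.Quotient.eq.1 hr.symm

lemma mem_maximalIdeal_iff_dvd {π : B} (hπ : Irreducible π) {b : B} :
    b ∈ maximalIdeal B ↔ ∃ c, b = π * c := by
  rw [hπ.maximalIdeal_eq, Ideal.mem_span_singleton]; rfl

/-- On the inertia group, the action on a uniformizer `π` bounds the action on all of `B`, as every
element of `B` is, modulo each power of the maximal ideal, a polynomial in `π` with coefficients
fixed by inertia. -/
lemma smul_sub_mem_span_uniformizer [Finite G] [Finite (ResidueField B)] {π : B}
    (hπ : Irreducible π) {g : G} (hg : g ∈ (maximalIdeal B).inertia G) (b : B) :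
    g • b - b ∈ Ideal.span {g • π - π} := by
  refine smul_sub_mem_span g Set.univ ?_ (fun c _ => ?_) (Set.mem_univ b)
  · rw [hπ.maximalIdeal_eq]; exact Ideal.mem_span_singleton_self _
  · obtain ⟨r, hr, hcr⟩ := exists_fixed_rep (G := G) le_rfl c
    obtain ⟨c', hc'⟩ := (mem_maximalIdeal_iff_dvd hπ).1 hcr
    exact ⟨r, hr g hg, c', trivial, by rw [← hc']; ring⟩

/-- The ramification groups can be read off from the action on a uniformizer. -/
lemma mem_inertia_pow_iff [Finite G] [Finite (ResidueField B)] {π : B}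
    (hπ : Irreducible π) {g : G} (hg : g ∈ (maximalIdeal B).inertia G) (i : ℕ) :
    g ∈ (maximalIdeal B ^ i).inertia G ↔ g • π - π ∈ maximalIdeal B ^ i := by
  refine ⟨fun h => h π, fun h b => ?_⟩
  exact (Ideal.span_singleton_le_iff_mem (I := maximalIdeal B ^ i)).2 h
    (smul_sub_mem_span_uniformizer hπ hg b)

lemma eq_one_of_smul_uniformizer_eq [Finite G] [Finite (ResidueField B)] [FaithfulSMul G B] {π : B}
    (hπ : Irreducible π) {g : G} (hg : g ∈ (maximalIdeal B).inertia G) (h : g • π = π) :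
    g = 1 := by
  refine FaithfulSMul.eq_of_smul_eq_smul (α := B) fun b => ?_
  have := smul_sub_mem_span_uniformizer hπ hg b
  rw [h, sub_self, Ideal.span_singleton_eq_bot.2 rfl, Ideal.mem_bot, sub_eq_zero] at this
  rw [this, one_smul]

/-- A form of Nakayama's lemma: a dense `A`-submodule of `B` is all of `B`. -/
lemma eq_top_of_forall_exists_sub_mem {A : Type*} [CommRing A] [IsLocalRing A] [Algebra A B]
    [Module.Finite A B] (hA : ∃ a ∈ maximalIdeal A, algebraMap A B a ≠ 0)
    (N : Submodule A B) (h : ∀ (k : ℕ) (b : B), ∃ n ∈ N, b - n ∈ maximalIdeal B ^ k) : N = ⊤ := by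
  obtain ⟨a, ha, ha0⟩ := hA
  obtain ⟨k, hk⟩ := exists_maximalIdeal_pow_eq_of_principal B
    (IsPrincipalIdealRing.principal _) (Ideal.span {algebraMap A B a}) (by simpa using ha0)
  rw [eq_top_iff]
  refine Submodule.le_of_le_smul_of_le_jacobson_bot (I := maximalIdeal A) Module.Finite.fg_top
    (IsLocalRing.maximalIdeal_le_jacobson _) ?_
  intro b _
  obtain ⟨n, hn, hbn⟩ := h k b
  rw [← hk, Ideal.mem_span_singleton'] at hbn
  obtain ⟨c, hc⟩ := hbn
  rw [show b = n + (b - n) by ring]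
  refine Submodule.add_mem_sup hn ?_
  rw [← hc, mul_comm, ← Algebra.smul_def]
  exact Submodule.smul_mem_smul ha trivial

/-- The polynomials with coefficients fixed by `Γ`. -/
def fixedPolys (B : Type*) [CommRing B] {G : Type*} [Group G] [MulSemiringAction G B]
    (Γ : Subgroup G) : Subring B[X] := FixedPoints.subring B[X] Γ

lemma mem_fixedPolys {Γ : Subgroup G} {f : B[X]} :
    f ∈ fixedPolys B Γ ↔ ∀ γ ∈ Γ, γ • f = f :=
  ⟨fun h γ hγ => h ⟨γ, hγ⟩, fun h γ => h γ.1 γ.2⟩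

lemma degree_C_mul_lt (a : B) {f : B[X]} {v : ℕ} (h : f.degree < v) : (C a * f).degree < v :=
  ((degree_mul_le _ _).trans (add_le_add_left degree_C_le _)).trans_lt (by simpa using h)

lemma C_mem_fixedPolys {Γ : Subgroup G} {r : B} (h : ∀ γ ∈ Γ, γ • r = r) :
    C r ∈ fixedPolys B Γ := by
  rw [mem_fixedPolys]
  intro γ hγ
  rw [smul_C, h γ hγ]

lemma X_mem_fixedPolys {Γ : Subgroup G} : (X : B[X]) ∈ fixedPolys B Γ := by
  rw [mem_fixedPolys]
  intro γ _
  exact smul_X γ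

/-- An element in the maximal ideal that is fixed by a group `Γ` of inertia has valuation at least
`|Γ|`: the uniformizer `π` is a root of a monic polynomial over the fixed ring, of degree this
valuation, and it has `|Γ|` conjugates. -/
lemma mem_pow_card_of_fixed [Finite G] [Finite (ResidueField B)] [FaithfulSMul G B]
    {A : Type*} [CommRing A] [IsLocalRing A] [Algebra A B] [SMulCommClass G A B]
    [Module.Finite A B] (hA : ∃ a ∈ maximalIdeal A, algebraMap A B a ≠ 0)
    {Γ : Subgroup G} (hΓ : Γ ≤ (maximalIdeal B).inertia G) {d : B}
    (hd : ∀ γ ∈ Γ, γ • d = d) (hdm : d ∈ maximalIdeal B) :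
    d ∈ maximalIdeal B ^ Nat.card Γ := by
  by_cases hd0 : d = 0
  · rw [hd0]; exact zero_mem _
  obtain ⟨π, hπ⟩ := IsDiscreteValuationRing.exists_irreducible B
  obtain ⟨v, hv⟩ := exists_maximalIdeal_pow_eq_of_principal B
    (IsPrincipalIdealRing.principal _) (Ideal.span {d}) (by simpa using hd0)
  suffices Nat.card Γ ≤ v from Ideal.pow_le_pow_right this (hv ▸ Ideal.mem_span_singleton_self d)
  -- the values at `π` of polynomials of degree `< v` over the fixed ring; they exhaust `B`
  let N : Submodule A B :=
    { carrier := {b | ∃ f ∈ fixedPolys B Γ, f.degree < v ∧ f.eval π = b}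
      add_mem' := by
        rintro _ _ ⟨f, hf, hf', rfl⟩ ⟨g, hg, hg', rfl⟩
        exact ⟨f + g, add_mem hf hg, (degree_add_le _ _).trans_lt (max_lt hf' hg'), eval_add⟩
      zero_mem' := ⟨0, zero_mem _, by simp, by simp⟩
      smul_mem' := by
        rintro a _ ⟨f, hf, hf', rfl⟩
        refine ⟨C (algebraMap A B a) * f, mul_mem (C_mem_fixedPolys fun γ _ => ?_) hf, ?_, ?_⟩
        · rw [smul_algebraMap]
        · exact degree_C_mul_lt _ hf'
        · simp [Algebra.smul_def] }
  -- division of `b` by `π ^ j`, with remainder a polynomial in `π` of degree `< j`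
  have hblock : ∀ j ≤ v, ∀ b : B, ∃ f ∈ fixedPolys B Γ, f.degree < j ∧ ∃ c, b = f.eval π + π ^ j * c := by
    intro j
    induction j with
    | zero => intro _ b; exact ⟨0, zero_mem _, by simp, b, by simp⟩
    | succ j ih =>
      intro hj b
      obtain ⟨f, hf, hf', c, hc⟩ := ih (by omega) b
      obtain ⟨r, hr, hcr⟩ := exists_fixed_rep hΓ c
      obtain ⟨c', hc'⟩ := (mem_maximalIdeal_iff_dvd hπ).1 hcr
      refine ⟨f + C r * X ^ j, add_mem hf (mul_mem (C_mem_fixedPolys hr)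
        (pow_mem X_mem_fixedPolys _)), ?_, c', ?_⟩
      · refine (degree_add_le _ _).trans_lt (max_lt (hf'.trans ?_) ?_)
        · exact_mod_cast Nat.lt_succ_self j
        · refine (degree_C_mul_X_pow_le _ _).trans_lt ?_
          exact_mod_cast Nat.lt_succ_self j
      · have : c = r + π * c' := by rw [← hc']; ring
        rw [hc, this]
        simp only [eval_add, eval_mul, eval_C, eval_pow, eval_X]; ring
  have hpv : ∃ u, π ^ v = d * u := by
    have : π ^ v ∈ Ideal.span {d} := by
      rw [hv]; refine Ideal.pow_mem_pow ?_ _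
      rw [hπ.maximalIdeal_eq]; exact Ideal.mem_span_singleton_self _
    exact Ideal.mem_span_singleton.1 this
  obtain ⟨u, hu⟩ := hpv
  have hNd : ∀ n ∈ N, d * n ∈ N := by
    rintro _ ⟨f, hf, hf', rfl⟩
    exact ⟨C d * f, mul_mem (C_mem_fixedPolys hd) hf, degree_C_mul_lt _ hf', by simp⟩
  -- `N` is stable under `d`, and division by `π ^ v = d u` shows that it is dense
  have hN : N = ⊤ := by
    apply eq_top_of_forall_exists_sub_mem hA
    intro k
    suffices ∀ b, ∃ n ∈ N, ∃ c, b - n = d ^ k * c by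
      intro b
      obtain ⟨n, hn, c, hc⟩ := this b
      exact ⟨n, hn, hc ▸ Ideal.mul_mem_right _ _ (Ideal.pow_mem_pow hdm k)⟩
    induction k with
    | zero => intro b; exact ⟨0, zero_mem _, b, by simp⟩
    | succ k ih =>
      intro b
      obtain ⟨f, hf, hf', c, hc⟩ := hblock v le_rfl b
      obtain ⟨n, hn, c', hc'⟩ := ih (u * c)
      refine ⟨f.eval π + d * n, add_mem ⟨f, hf, hf', rfl⟩ (hNd n hn), c', ?_⟩
      have : u * c = n + d ^ k * c' := by rw [← hc']; ring
      rw [hc, hu, mul_assoc, this]; ring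
  -- writing `π ^ v` in this form gives a monic polynomial of degree `v` with root `π`, all of whose
  -- conjugates under `Γ` are also roots
  obtain ⟨f, hf, hf', hfe⟩ : π ^ v ∈ N := hN ▸ trivial
  have hmon : (X ^ v - f).Monic := monic_X_pow_sub hf'
  classical
  have : Fintype Γ := Fintype.ofFinite Γ
  have hinj : Function.Injective fun γ : Γ => γ • π := by
    intro γ δ h
    have h1 : (δ⁻¹ * γ).1 • π = π := by
      change (δ⁻¹ * γ) • π = π
      rw [mul_smul]; simp only at h; rw [h, inv_smul_smul]
    have := eq_one_of_smul_uniformizer_eq hπ (hΓ (δ⁻¹ * γ).2) h1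
    have h2 : δ⁻¹ * γ = 1 := Subtype.ext this
    exact (inv_mul_eq_one.1 h2).symm
  have hroot : ∀ γ : Γ, γ • π ∈ (X ^ v - f).roots := by
    intro γ
    rw [mem_roots hmon.ne_zero, IsRoot.def, eval_sub, eval_pow, eval_X]
    have h1 : f.eval (γ • π) = γ • f.eval π := by
      conv_lhs => rw [← mem_fixedPolys.1 hf γ.1 γ.2]
      exact smul_eval_smul B γ.1 f π
    rw [h1, hfe, smul_pow', sub_self]
  have hle : (Finset.univ.image fun γ : Γ => γ • π) ⊆ (X ^ v - f).roots.toFinset := by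
    intro x hx
    obtain ⟨γ, -, rfl⟩ := Finset.mem_image.1 hx
    exact Multiset.mem_toFinset.2 (hroot γ)
  have h1 := Finset.card_le_card hle
  rw [Finset.card_image_of_injective _ hinj, Finset.card_univ] at h1
  have h2 := (Multiset.toFinset_card_le _).trans (card_roots' (X ^ v - f))
  have h3 : (X ^ v - f).natDegree ≤ v := natDegree_le_of_degree_le <|
    (degree_sub_le _ _).trans (max_le (degree_X_pow_le v) hf'.le)
  rw [Nat.card_eq_fintype_card]
  omega

/-! ### The formula behind Herbrand's theorem -/

/-- `B` is generated by a uniformizer over the subring fixed by the inertia group. -/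
lemma exists_fixedPolys_eval_eq [Finite G] [Finite (ResidueField B)]
    {A : Type*} [CommRing A] [IsLocalRing A] [Algebra A B] [SMulCommClass G A B]
    [Module.Finite A B] (hA : ∃ a ∈ maximalIdeal A, algebraMap A B a ≠ 0)
    {Γ : Subgroup G} (hΓ : Γ ≤ (maximalIdeal B).inertia G) {π : B} (hπ : Irreducible π) (b : B) :
    ∃ f ∈ fixedPolys B Γ, f.eval π = b := by
  let N : Submodule A B :=
    { carrier := {b | ∃ f ∈ fixedPolys B Γ, f.eval π = b}
      add_mem' := by
        rintro _ _ ⟨f, hf, rfl⟩ ⟨g, hg, rfl⟩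
        exact ⟨f + g, add_mem hf hg, eval_add⟩
      zero_mem' := ⟨0, zero_mem _, by simp⟩
      smul_mem' := by
        rintro a _ ⟨f, hf, rfl⟩
        refine ⟨C (algebraMap A B a) * f, mul_mem (C_mem_fixedPolys fun γ _ => ?_) hf, ?_⟩
        · rw [smul_algebraMap]
        · simp [Algebra.smul_def] }
  have hN : N = ⊤ := by
    apply eq_top_of_forall_exists_sub_mem hA
    intro k
    suffices ∀ b, ∃ n ∈ N, ∃ c, b - n = π ^ k * c by
      intro b
      obtain ⟨n, hn, c, hc⟩ := this b
      refine ⟨n, hn, hc ▸ Ideal.mul_mem_right _ _ (Ideal.pow_mem_pow ?_ k)⟩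
      exact (mem_maximalIdeal_iff_dvd hπ).2 ⟨1, (mul_one _).symm⟩
    induction k with
    | zero => intro b; exact ⟨0, zero_mem _, b, by simp⟩
    | succ k ih =>
      intro b
      obtain ⟨_, ⟨f, hf, rfl⟩, c, hc⟩ := ih b
      obtain ⟨r, hr, hcr⟩ := exists_fixed_rep hΓ c
      obtain ⟨c', hc'⟩ := (mem_maximalIdeal_iff_dvd hπ).1 hcr
      refine ⟨_, ⟨f + X ^ k * C r, add_mem hf (mul_mem (pow_mem X_mem_fixedPolys _)
        (C_mem_fixedPolys hr)), rfl⟩, c', ?_⟩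
      simp only [eval_add, eval_mul, eval_C, eval_pow, eval_X]
      rw [← sub_sub, hc, ← mul_sub, hc']; ring
  exact (hN ▸ trivial : b ∈ N)

/-- The main step towards Herbrand's theorem. Let `ϖ` be fixed by the group `Γ` of inertia, of
valuation `|Γ|`. Then `g ϖ - ϖ` and `∏ (g γ π - π)`, the product over `γ ∈ Γ`, divide each other:
with `F = ∏ (X - γ π)`, the product is `± (g F - F) (π)`, and the coefficients of `F` are fixed by
`Γ`; conversely `ϖ = P (π)` with a polynomial `P` fixed by inertia, so `F` divides `P - ϖ`. -/
lemma span_smul_sub_eq_span_prod [Finite G] [Finite (ResidueField B)] [FaithfulSMul G B]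
    {A : Type*} [CommRing A] [IsLocalRing A] [Algebra A B] [SMulCommClass G A B]
    [Module.Finite A B] (hA : ∃ a ∈ maximalIdeal A, algebraMap A B a ≠ 0)
    {Γ : Subgroup G} [Fintype Γ] (hΓ : Γ ≤ (maximalIdeal B).inertia G) {π ϖ : B}
    (hπ : Irreducible π) (hϖ : ∀ γ ∈ Γ, γ • ϖ = ϖ)
    (hϖΓ : Ideal.span {ϖ} = maximalIdeal B ^ Nat.card Γ) {g : G}
    (hg : g ∈ (maximalIdeal B).inertia G) :
    Ideal.span {g • ϖ - ϖ} = Ideal.span {∏ γ : Γ, (g • γ • π - π)} := by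
  have hϖm : ϖ ∈ maximalIdeal B := by
    have : ϖ ∈ maximalIdeal B ^ Nat.card Γ := hϖΓ ▸ Ideal.mem_span_singleton_self ϖ
    exact Ideal.pow_le_self Nat.card_pos.ne' this
  have hinj : Function.Injective fun γ : Γ => γ • π := by
    intro γ δ h
    have h1 : (δ⁻¹ * γ).1 • π = π := by
      change (δ⁻¹ * γ) • π = π
      rw [mul_smul]; simp only at h; rw [h, inv_smul_smul]
    have := eq_one_of_smul_uniformizer_eq hπ (hΓ (δ⁻¹ * γ).2) h1
    have h2 : δ⁻¹ * γ = 1 := Subtype.ext this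
    exact (inv_mul_eq_one.1 h2).symm
  let F : B[X] := ∏ γ : Γ, (X - C (γ • π))
  have hF0 : F.eval π = 0 := by
    simp only [F, eval_prod]
    exact Finset.prod_eq_zero (Finset.mem_univ 1) (by simp)
  have hgF : (g • F).eval π = ∏ γ : Γ, (π - g • γ • π) := by
    simp only [F, Finset.smul_prod', eval_prod, smul_sub, smul_X, smul_C, eval_sub, eval_X, eval_C]
  have hspan : Ideal.span {∏ γ : Γ, (g • γ • π - π)} = Ideal.span {(g • F).eval π} := by
    rw [hgF, Ideal.span_singleton_eq_span_singleton]
    refine ⟨(-1) ^ Fintype.card Γ, ?_⟩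
    have : ∏ γ : Γ, (π - g • γ • π) = ∏ γ : Γ, ((g • γ • π - π) * (-1)) :=
      Finset.prod_congr rfl fun γ _ => by ring
    rw [this, Finset.prod_mul_distrib, Finset.prod_const, Finset.card_univ]
    simp
  rw [hspan]
  apply le_antisymm
  · rw [Ideal.span_singleton_le_iff_mem]
    obtain ⟨P, hP, hPe⟩ := exists_fixedPolys_eval_eq hA (le_refl ((maximalIdeal B).inertia G)) hπ ϖ
    rw [mem_fixedPolys] at hP
    -- all conjugates `γ π` are roots of `P - ϖ`
    have hdvd : F ∣ P - C ϖ := by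
      by_cases h0 : P - C ϖ = 0
      · rw [h0]; exact dvd_zero _
      have hF : F = ((Finset.univ.val.map fun γ : Γ => γ • π).map fun a => X - C a).prod := by
        rw [Multiset.map_map]; rfl
      rw [hF, Multiset.prod_X_sub_C_dvd_iff_le_roots h0,
        Multiset.le_iff_subset (Finset.univ.nodup.map hinj)]
      intro x hx
      obtain ⟨γ, -, rfl⟩ := Multiset.mem_map.1 hx
      rw [mem_roots h0, IsRoot.def, eval_sub, eval_C, sub_eq_zero]
      conv_lhs => rw [← hP γ.1 (hΓ γ.2)]
      have := smul_eval_smul B γ.1 P π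
      rw [hPe, hϖ γ.1 γ.2] at this
      exact this
    obtain ⟨h, hh⟩ := hdvd
    have h1 : g • (P - C ϖ) = (g • F) * (g • h) := by rw [hh, smul_mul']
    have h2 := congrArg (Polynomial.eval π) h1
    rw [smul_sub, hP g hg, smul_C, eval_sub, eval_mul, eval_C, hPe] at h2
    rw [← neg_sub, h2]
    exact neg_mem (Ideal.mul_mem_right _ _ (Ideal.mem_span_singleton_self _))
  · rw [Ideal.span_singleton_le_iff_mem]
    -- an element fixed by `Γ` is, modulo each power of the maximal ideal, a polynomial in `ϖ` with
    -- coefficients fixed by inertia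
    have hcoef : ∀ c : B, (∀ γ ∈ Γ, γ • c = c) → g • c - c ∈ Ideal.span {g • ϖ - ϖ} := by
      intro c hc
      refine smul_sub_mem_span g {c | ∀ γ ∈ Γ, γ • c = c} hϖm (fun c hc => ?_) hc
      obtain ⟨r, hr, hcr⟩ := exists_fixed_rep (le_refl ((maximalIdeal B).inertia G)) c
      have h1 : ∀ γ ∈ Γ, γ • (c - r) = c - r := fun γ hγ => by
        rw [smul_sub, hc γ hγ, hr γ (hΓ hγ)]
      have h2 := mem_pow_card_of_fixed hA hΓ h1 hcr
      rw [← hϖΓ, Ideal.mem_span_singleton] at h2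
      obtain ⟨c', hc'⟩ := h2
      refine ⟨r, hr g hg, c', fun γ hγ => ?_, by rw [← hc']; ring⟩
      by_cases hϖ0 : ϖ = 0
      · exfalso
        rw [hϖ0, Ideal.span_singleton_eq_bot.2 rfl, eq_comm] at hϖΓ
        exact IsDiscreteValuationRing.not_a_field B (pow_eq_zero_iff Nat.card_pos.ne' |>.1 hϖΓ)
      · have := h1 γ hγ
        rw [hc', smul_mul', hϖ γ hγ] at this
        exact mul_left_cancel₀ hϖ0 this
    have hFfix : ∀ γ ∈ Γ, γ • F = F := by
      intro γ hγ
      simp only [F, Finset.smul_prod', smul_sub, smul_X, smul_C]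
      refine Fintype.prod_equiv (Equiv.mulLeft (⟨γ, hγ⟩ : Γ)) _ _ fun δ => ?_
      simp only [Equiv.coe_mulLeft, mul_smul]
      rfl
    have h3 : (g • F).eval π = (g • F - F).eval π := by rw [eval_sub, hF0, sub_zero]
    rw [h3, eval_eq_sum_range]
    refine Ideal.sum_mem _ fun i _ => Ideal.mul_mem_right _ _ ?_
    rw [coeff_sub, coeff_smul]
    refine hcoef _ fun γ hγ => ?_
    rw [← coeff_smul, hFfix γ hγ]

/-! ### Wild and tame inertia -/

/-- Elements of the wild inertia group act trivially on the graded pieces `𝔪 ^ j / 𝔪 ^ (j + 1)`. -/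
lemma smul_sub_mem_pow_succ {g : G} (hg : g ∈ (maximalIdeal B ^ 2).inertia G) (j : ℕ) {y : B}
    (hy : y ∈ maximalIdeal B ^ j) : g • y - y ∈ maximalIdeal B ^ (j + 1) := by
  induction j generalizing y with
  | zero => exact Ideal.pow_le_pow_right (by norm_num) (hg y)
  | succ j ih =>
    rw [pow_succ'] at hy
    induction hy using Submodule.mul_induction_on' with
    | mem_mul_mem a ha b hb =>
      have e : g • (a * b) - a * b = (g • a - a) * (g • b) + a * (g • b - b) := by
        rw [smul_mul']; ring
      rw [e]
      have hgb : g • b ∈ maximalIdeal B ^ j := by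
        have := add_mem (Ideal.pow_le_pow_right (Nat.le_succ j) (ih hb)) hb
        rwa [sub_add_cancel] at this
      refine add_mem ?_ ?_
      · rw [show j + 1 + 1 = 2 + j by ring, pow_add]
        exact Ideal.mul_mem_mul (hg a) hgb
      · rw [pow_succ' (maximalIdeal B) (j + 1)]
        exact Ideal.mul_mem_mul ha (ih hb)
    | add x _ y _ hx hy =>
      rw [smul_add, add_sub_add_comm]
      exact add_mem hx hy

lemma pow_smul_sub (g : G) (b : B) (n : ℕ) :
    g ^ n • b - b = ∑ k ∈ Finset.range n, g ^ k • (g • b - b) := by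
  induction n with
  | zero => simp
  | succ n ih => rw [Finset.sum_range_succ, ← ih, smul_sub, pow_succ, mul_smul]; ring

/-- As `g ^ p - 1 = ∑_{k < p} g ^ k (g - 1)`, which is `p (g - 1)` modulo `𝔪 ^ (i + 1)`, the `p`-th
power of an element of a higher ramification group lies in the next one. -/
lemma pow_prime_mem_inertia {p : ℕ} (hp : (p : B) ∈ maximalIdeal B) {i : ℕ} (hi : 2 ≤ i) {g : G}
    (hg : g ∈ (maximalIdeal B ^ i).inertia G) : g ^ p ∈ (maximalIdeal B ^ (i + 1)).inertia G := by
  intro b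
  have hg2 : g ∈ (maximalIdeal B ^ 2).inertia G := fun b => Ideal.pow_le_pow_right hi (hg b)
  have hk : ∀ k : ℕ, g ^ k • (g • b - b) - (g • b - b) ∈ maximalIdeal B ^ (i + 1) := fun k =>
    smul_sub_mem_pow_succ (pow_mem hg2 k) i (hg b)
  rw [pow_smul_sub]
  have e : ∑ k ∈ Finset.range p, g ^ k • (g • b - b) =
      ∑ k ∈ Finset.range p, (g ^ k • (g • b - b) - (g • b - b)) + (p : B) * (g • b - b) := by
    rw [Finset.sum_sub_distrib, Finset.sum_const, Finset.card_range, nsmul_eq_mul]; ring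
  rw [e]
  refine add_mem (Ideal.sum_mem _ fun k _ => hk k) ?_
  rw [pow_succ']
  exact Ideal.mul_mem_mul hp (hg b)

lemma exists_inertia_pow_eq_bot [Finite G] [FaithfulSMul G B] :
    ∃ N : ℕ, ∀ g : G, g ∈ (maximalIdeal B ^ N).inertia G → g = 1 := by
  have h : ∀ g : G, ∃ N : ℕ, g ∈ (maximalIdeal B ^ N).inertia G → g = 1 := by
    intro g
    by_contra! h
    refine (h 0).2 (FaithfulSMul.eq_of_smul_eq_smul (α := B) fun b => ?_)
    have h2 : g • b - b ∈ (⊥ : Ideal B) := by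
      apply mem_of_forall_mem_sup_pow
      intro k
      rw [bot_sup_eq]
      exact (h k).1 b
    rw [one_smul, ← sub_eq_zero]
    exact h2
  choose N hN using h
  have := Fintype.ofFinite G
  refine ⟨∑ g, N g, fun g hg => hN g fun b => ?_⟩
  exact Ideal.pow_le_pow_right (Finset.single_le_sum (f := N) (fun _ _ => Nat.zero_le _)
    (Finset.mem_univ g)) (hg b)

/-- The wild inertia group is a `p`-group. -/
lemma exists_pow_prime_pow_eq_one [Finite G] [FaithfulSMul G B] {p : ℕ}
    (hp : (p : B) ∈ maximalIdeal B) {g : G} (hg : g ∈ (maximalIdeal B ^ 2).inertia G) :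
    ∃ N : ℕ, g ^ p ^ N = 1 := by
  obtain ⟨N, hN⟩ := exists_inertia_pow_eq_bot (G := G) (B := B)
  have h : ∀ k : ℕ, g ^ p ^ k ∈ (maximalIdeal B ^ (2 + k)).inertia G := by
    intro k
    induction k with
    | zero => simpa using hg
    | succ k ih =>
      rw [pow_succ, pow_mul]
      exact pow_prime_mem_inertia (i := 2 + k) hp (by omega) ih
  exact ⟨N, hN _ fun b => Ideal.pow_le_pow_right (Nat.le_add_left N 2) (h N b)⟩

/-- The tame quotient of the inertia group is cyclic and the kernel is a `p`-group: a subgroup of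
inertia is generated by one element up to elements of `p`-power order. The tame character
sends `g` to the residue class of `g π / π`. -/
lemma exists_generator_mod_wild [Finite G] [Finite (ResidueField B)] [FaithfulSMul G B] {p : ℕ}
    (hp : (p : B) ∈ maximalIdeal B) {Γ : Subgroup G} (hΓ : Γ ≤ (maximalIdeal B).inertia G) :
    ∃ γ₀ ∈ Γ, ∀ γ ∈ Γ, ∃ (n : ℤ) (N : ℕ), (γ₀ ^ n * γ⁻¹) ^ p ^ N = 1 := by
  obtain ⟨π, hπ⟩ := IsDiscreteValuationRing.exists_irreducible B
  have hc : ∀ γ : Γ, ∃ c, γ • π = π * c := by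
    intro γ
    refine (mem_maximalIdeal_iff_dvd hπ).1 ?_
    have h1 : π ∈ maximalIdeal B := (mem_maximalIdeal_iff_dvd hπ).2 ⟨1, (mul_one _).symm⟩
    have := add_mem (hΓ γ.2 π) h1
    rwa [sub_add_cancel] at this
  choose c hc using hc
  have hπ0 := hπ.ne_zero
  let θ : Γ →* ResidueField B :=
    { toFun := fun γ => residue B (c γ)
      map_one' := by
        have : c 1 = 1 := mul_left_cancel₀ hπ0 (by rw [← hc, one_smul, mul_one])
        rw [this, map_one]
      -- the cocycle relation becomes multiplicative since inertia acts trivially on residues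
      map_mul' := by
        intro γ δ
        have h1 : c (γ * δ) = c γ * (γ • c δ) := mul_left_cancel₀ hπ0 (by
          rw [← hc, mul_smul, hc δ, smul_mul', hc γ, mul_assoc])
        have h2 : residue B (γ • c δ) = residue B (c δ) := Ideal.Quotient.eq.2 (hΓ γ.2 (c δ))
        rw [h1, map_mul, h2] }
  let θ' := θ.toHomUnits
  obtain ⟨⟨x, γ₀, hγ₀⟩, hx⟩ := IsCyclic.exists_generator (α := θ'.range)
  refine ⟨γ₀, γ₀.2, fun γ hγ => ?_⟩
  obtain ⟨n, hn⟩ := hx ⟨θ' ⟨γ, hγ⟩, ⟨γ, hγ⟩, rfl⟩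
  have hn' : θ' γ₀ ^ n = θ' ⟨γ, hγ⟩ := by
    rw [hγ₀]; exact congrArg Subtype.val hn
  let δ : Γ := γ₀ ^ n * ⟨γ, hγ⟩⁻¹
  have hδ : θ' δ = 1 := by rw [map_mul, map_zpow, map_inv, hn', mul_inv_cancel]
  have hδ' : residue B (c δ) = residue B 1 := by
    rw [map_one]; exact congrArg Units.val hδ
  refine ⟨n, ?_⟩
  have hwild : δ.1 ∈ (maximalIdeal B ^ 2).inertia G := by
    rw [mem_inertia_pow_iff hπ (hΓ δ.2)]
    change δ • π - π ∈ _
    rw [hc, pow_two, show π * c δ - π = π * (c δ - 1) by ring]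
    exact Ideal.mul_mem_mul ((mem_maximalIdeal_iff_dvd hπ).2 ⟨1, (mul_one _).symm⟩)
      (Ideal.Quotient.eq.1 hδ')
  exact exists_pow_prime_pow_eq_one hp hwild

end DVR

section Extension

open IsLocalRing

variable {A B : Type*} [CommRing A] [IsDomain A] [IsDiscreteValuationRing A]
  [CommRing B] [IsDomain B] [IsDiscreteValuationRing B] [Algebra A B] [Module.Finite A B]
  [FaithfulSMul A B]

lemma exists_algebraMap_ne_zero : ∃ a ∈ maximalIdeal A, algebraMap A B a ≠ 0 := by
  obtain ⟨a, ha⟩ := IsDiscreteValuationRing.exists_irreducible A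
  refine ⟨a, (mem_maximalIdeal_iff_dvd ha).2 ⟨1, (mul_one _).symm⟩, ?_⟩
  rw [Ne, map_eq_zero_iff _ (FaithfulSMul.algebraMap_injective A B)]
  exact ha.ne_zero

lemma under_maximalIdeal : (maximalIdeal B).under A = maximalIdeal A := by
  have : Algebra.IsIntegral A B := inferInstance
  have : ((maximalIdeal B).under A).IsMaximal :=
    Ideal.isMaximal_comap_of_isIntegral_of_isMaximal (maximalIdeal B)
  exact IsLocalRing.eq_maximalIdeal this

/-- The ramification index is the order of the inertia group. -/
lemma map_maximalIdeal_eq_pow_card [Finite (ResidueField A)] {H : Type*} [Group H] [Finite H]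
    [MulSemiringAction H B] [IsGaloisGroup H A B] :
    (maximalIdeal A).map (algebraMap A B) =
      maximalIdeal B ^ Nat.card ((maximalIdeal B).inertia H) := by
  have hover : (maximalIdeal B).LiesOver (maximalIdeal A) := ⟨under_maximalIdeal.symm⟩
  have : Finite (A ⧸ maximalIdeal A) := ‹Finite (ResidueField A)›
  have : Finite (maximalIdeal A).ResidueField :=
    Finite.of_surjective _ (Ideal.bijective_algebraMap_quotient_residueField (maximalIdeal A)).2
  have : Module.IsTorsionFree A B := inferInstance
  have h := Ideal.card_inertia_eq_ramificationIdxIn (G := H) (maximalIdeal A) (maximalIdeal B)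
  rw [Ideal.ramificationIdxIn_eq_ramificationIdx (maximalIdeal A) (maximalIdeal B) H] at h
  have h0 : (maximalIdeal A).map (algebraMap A B) ≠ ⊥ := by
    obtain ⟨a, ha, ha0⟩ := exists_algebraMap_ne_zero (A := A) (B := B)
    intro hbot
    have := Ideal.mem_map_of_mem (algebraMap A B) ha
    rw [hbot] at this
    exact ha0 this
  obtain ⟨n, hn⟩ := exists_maximalIdeal_pow_eq_of_principal B
    (IsPrincipalIdealRing.principal _) _ h0
  have h2 := Ideal.IsDedekindDomain.ramificationIdx_eq_multiplicity (maximalIdeal A) (maximalIdeal B) h0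
  rw [h, h2, hn]
  rw [multiplicity_pow_self (IsDiscreteValuationRing.not_a_field B)]
  exact fun hu => Ideal.IsPrime.ne_top' (Ideal.isUnit_iff.1 hu)

end Extension

/-! ### Ramification numbers -/

section RamNumber

open IsLocalRing
open IsDiscreteValuationRing hiding maximalIdeal

variable {B : Type*} [CommRing B] [IsDomain B] [IsDiscreteValuationRing B]
  {G : Type*} [Group G] [MulSemiringAction G B]

lemma le_addVal_iff {b : B} {n : ℕ} : (n : ℕ∞) ≤ addVal B b ↔ b ∈ maximalIdeal B ^ n := by
  obtain ⟨π, hπ⟩ := exists_irreducible B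
  rw [← hπ.addVal_pow n, addVal_le_iff_dvd, hπ.maximalIdeal_eq, Ideal.span_singleton_pow,
    Ideal.mem_span_singleton]

lemma smul_mem_maximalIdeal (g : G) {b : B} (hb : b ∈ maximalIdeal B) :
    g • b ∈ maximalIdeal B := by
  rw [mem_maximalIdeal, mem_nonunits_iff] at hb ⊢
  intro h
  refine hb ?_
  have := h.map (MulSemiringAction.toRingHom G B g⁻¹)
  simpa using this

variable (B) in
/-- The ramification number of an element `g` of the inertia group, the largest `i` for which `g`
is trivial modulo the `i`-th power of the maximal ideal. It is defined as the valuation of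
`g π - π` for a chosen uniformizer `π`, which is this number on the inertia group. -/
def ramNumber (g : G) : ℕ∞ := addVal B (g • (exists_irreducible B).choose -
  (exists_irreducible B).choose)

variable [Finite G] [Finite (ResidueField B)]

lemma le_ramNumber_iff {g : G} (hg : g ∈ (maximalIdeal B).inertia G) {n : ℕ} :
    (n : ℕ∞) ≤ ramNumber B g ↔ g ∈ (maximalIdeal B ^ n).inertia G := by
  rw [ramNumber, le_addVal_iff, mem_inertia_pow_iff (exists_irreducible B).choose_spec hg]

lemma ramNumber_one : ramNumber B (1 : G) = ⊤ := by simp [ramNumber]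

lemma ramNumber_eq_top_iff [FaithfulSMul G B] {g : G} (hg : g ∈ (maximalIdeal B).inertia G) :
    ramNumber B g = ⊤ ↔ g = 1 := by
  refine ⟨fun h => ?_, fun h => h ▸ ramNumber_one⟩
  rw [ramNumber, addVal_eq_top_iff, sub_eq_zero] at h
  exact eq_one_of_smul_uniformizer_eq (exists_irreducible B).choose_spec hg h

lemma min_ramNumber_le_mul {g h : G} (hg : g ∈ (maximalIdeal B).inertia G)
    (hh : h ∈ (maximalIdeal B).inertia G) :
    min (ramNumber B g) (ramNumber B h) ≤ ramNumber B (g * h) := by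
  refine ENat.forall_natCast_le_iff_le.1 fun n hn => ?_
  rw [le_ramNumber_iff (mul_mem hg hh)]
  exact mul_mem ((le_ramNumber_iff hg).1 (hn.trans (min_le_left _ _)))
    ((le_ramNumber_iff hh).1 (hn.trans (min_le_right _ _)))

lemma ramNumber_inv {g : G} (hg : g ∈ (maximalIdeal B).inertia G) :
    ramNumber B g⁻¹ = ramNumber B g := by
  refine ENat.eq_of_forall_natCast_le_iff fun n => ?_
  rw [le_ramNumber_iff hg, le_ramNumber_iff (inv_mem hg), inv_mem_iff]

end RamNumber

section Quotient

open IsLocalRing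
open IsDiscreteValuationRing hiding maximalIdeal

variable {A B : Type*} [CommRing A] [IsDomain A] [IsDiscreteValuationRing A]
  [CommRing B] [IsDomain B] [IsDiscreteValuationRing B] [Algebra A B] [Module.Finite A B]
  [FaithfulSMul A B] [Finite (ResidueField A)] [Finite (ResidueField B)]
  {G Q : Type*} [Group G] [Group Q] [Finite G] [Finite Q] [MulSemiringAction G B]
  [MulSemiringAction Q A] [FaithfulSMul G B] [FaithfulSMul Q A]
  {φ : G →* Q} (hφ : ∀ (g : G) (a : A), algebraMap A B (φ g • a) = g • algebraMap A B a)

include hφ in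
lemma map_mem_inertia {g : G} (hg : g ∈ (maximalIdeal B).inertia G) :
    φ g ∈ (maximalIdeal A).inertia Q := by
  intro a
  have : φ g • a - a ∈ (maximalIdeal B).under A := by
    rw [Ideal.under_def, Ideal.mem_comap, map_sub, hφ]
    exact hg _
  rwa [under_maximalIdeal] at this

include hφ in
/-- Restriction maps the inertia group onto the inertia group. -/
lemma exists_mem_inertia [IsGaloisGroup φ.ker A B] (hsurj : Function.Surjective φ) {q : Q}
    (hq : q ∈ (maximalIdeal A).inertia Q) : ∃ g ∈ (maximalIdeal B).inertia G, φ g = q := by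
  obtain ⟨g, rfl⟩ := hsurj q
  have hover : (maximalIdeal B).LiesOver (maximalIdeal A) := ⟨under_maximalIdeal.symm⟩
  let e : (B ⧸ maximalIdeal B) ≃+* (B ⧸ maximalIdeal B) :=
    Ideal.quotientEquiv _ _ (MulSemiringAction.toRingEquiv G B g) <| by
      ext b
      have hcoe : ((MulSemiringAction.toRingEquiv G B g : B ≃+* B) : B →+* B) =
        MulSemiringAction.toRingHom G B g := rfl
      rw [hcoe]
      refine ⟨fun hb => ?_, fun hb => ?_⟩
      · rw [← smul_inv_smul g b]
        exact Ideal.mem_map_of_mem (MulSemiringAction.toRingHom G B g)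
          (smul_mem_maximalIdeal g⁻¹ hb)
      · have hle : Ideal.map (MulSemiringAction.toRingHom G B g) (maximalIdeal B) ≤
            maximalIdeal B := Ideal.map_le_iff_le_comap.2 fun x hx => smul_mem_maximalIdeal g hx
        exact hle hb
  have he : ∀ b, e (Ideal.Quotient.mk _ b) = Ideal.Quotient.mk _ (g • b) := fun b => rfl
  let e' : (B ⧸ maximalIdeal B) ≃ₐ[A ⧸ maximalIdeal A] (B ⧸ maximalIdeal B) :=
    AlgEquiv.ofRingEquiv (f := e) <| by
      intro x
      obtain ⟨a, rfl⟩ := Ideal.Quotient.mk_surjective x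
      rw [Ideal.Quotient.algebraMap_mk_of_liesOver, he, Ideal.Quotient.eq, ← hφ, ← map_sub]
      have := hq a
      rw [← under_maximalIdeal (A := A) (B := B)] at this
      exact this
  have : Algebra.IsInvariant A B φ.ker := IsGaloisGroup.isInvariant
  have : SMulCommClass φ.ker A B := IsGaloisGroup.commutes
  -- correct `g` by an element of the kernel that has the same effect on the residue field
  obtain ⟨t, ht⟩ := Ideal.Quotient.stabilizerHom_surjective φ.ker (maximalIdeal A)
    (maximalIdeal B) e'
  refine ⟨g * t.1.1⁻¹, fun b => ?_, ?_⟩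
  · have h1 := congrArg (fun f => f (Ideal.Quotient.mk _ (t.1.1⁻¹ • b))) ht
    have h2 : Ideal.Quotient.mk (maximalIdeal B) (t.1.1 • t.1.1⁻¹ • b) =
      Ideal.Quotient.mk (maximalIdeal B) (g • t.1.1⁻¹ • b) := h1
    rw [smul_inv_smul] at h2
    rw [mul_smul]
    exact Ideal.Quotient.eq.1 h2.symm
  · have : φ t.1.1 = 1 := t.1.2
    rw [map_mul, map_inv, this, inv_one, mul_one]

/-- The valuations of `A` and `B` are related by the ramification index. -/
lemma addVal_algebraMap [IsGaloisGroup φ.ker A B] (a : A) : addVal B (algebraMap A B a) =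
    Nat.card ((maximalIdeal B).inertia φ.ker) * addVal A a := by
  obtain ⟨ϖ, hϖ⟩ := exists_irreducible A
  by_cases ha : a = 0
  · rw [ha, map_zero, AddValuation.map_zero, AddValuation.map_zero, ENat.mul_top]
    exact_mod_cast Nat.card_pos.ne'
  obtain ⟨n, u, hu⟩ := eq_unit_mul_pow_irreducible ha hϖ
  obtain ⟨π, hπ⟩ := exists_irreducible B
  have h1 := map_maximalIdeal_eq_pow_card (A := A) (B := B) (H := φ.ker)
  rw [hϖ.maximalIdeal_eq, Ideal.map_span, Set.image_singleton, hπ.maximalIdeal_eq,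
    Ideal.span_singleton_pow, Ideal.span_singleton_eq_span_singleton,
    ← addVal_eq_iff_associated, hπ.addVal_pow] at h1
  rw [hu, addVal_def' u hϖ, map_mul, map_pow, addVal_mul, addVal_pow, h1, addVal_eq_zero_iff.2
    (u.isUnit.map _), zero_add, hπ.maximalIdeal_eq, nsmul_eq_mul, mul_comm]

include hφ in
/-- The ramification number of a restriction is, up to the ramification index, the sum of the
ramification numbers of all extensions in the inertia group. -/
lemma card_mul_ramNumber [IsGaloisGroup φ.ker A B] {A₀ : Type*} [CommRing A₀] [IsLocalRing A₀]
    [Algebra A₀ B] [SMulCommClass G A₀ B] [Module.Finite A₀ B]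
    (hA₀ : ∃ a ∈ maximalIdeal A₀, algebraMap A₀ B a ≠ 0)
    [Fintype ((maximalIdeal B).inertia G ⊓ φ.ker : Subgroup G)]
    {g : G} (hg : g ∈ (maximalIdeal B).inertia G) :
    Nat.card ((maximalIdeal B).inertia G ⊓ φ.ker : Subgroup G) * ramNumber A (φ g) =
      ∑ t : ((maximalIdeal B).inertia G ⊓ φ.ker : Subgroup G), ramNumber B (g * t.1) := by
  have hcard : Nat.card ((maximalIdeal B).inertia φ.ker) =
      Nat.card ((maximalIdeal B).inertia G ⊓ φ.ker : Subgroup G) := by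
    have h1 := AddSubgroup.inertia_map_subtype (I := (maximalIdeal B).toAddSubgroup) φ.ker
    rw [← h1]
    exact (Nat.card_congr (Subgroup.equivMapOfInjective _ _ φ.ker.subtype_injective).toEquiv)
  set Γ : Subgroup G := (maximalIdeal B).inertia G ⊓ φ.ker
  rw [← hcard]
  conv_lhs => rw [ramNumber]
  rw [← addVal_algebraMap (φ := φ) (B := B), map_sub, hφ]
  set ϖ := (exists_irreducible A).choose with hϖdef
  have hϖ : Irreducible ϖ := (exists_irreducible A).choose_spec
  set π := (exists_irreducible B).choose with hπdef
  have hπ : Irreducible π := (exists_irreducible B).choose_spec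
  have hspan := map_maximalIdeal_eq_pow_card (A := A) (B := B) (H := φ.ker)
  rw [hϖ.maximalIdeal_eq, Ideal.map_span, Set.image_singleton, hcard] at hspan
  have h := span_smul_sub_eq_span_prod hA₀ (Γ := Γ) inf_le_left hπ
    (ϖ := algebraMap A B ϖ) (fun γ hγ => by
      have : φ γ = 1 := hγ.2
      rw [← hφ, this, one_smul]) hspan hg
  rw [Ideal.span_singleton_eq_span_singleton, ← addVal_eq_iff_associated] at h
  rw [h]
  have hprod : ∀ s : Finset Γ, addVal B (∏ t ∈ s, (g • t • π - π)) =
      ∑ t ∈ s, addVal B (g • t • π - π) := by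
    classical
    intro s
    induction s using Finset.induction_on with
    | empty => simp
    | insert a s ha ih => rw [Finset.prod_insert ha, Finset.sum_insert ha, addVal_mul, ih]
  rw [hprod]
  refine Finset.sum_congr (by ext; simp) fun t _ => ?_
  rw [ramNumber, mul_smul]
  rfl

end Quotient

/-! ### Herbrand functions of finite groups with a ramification filtration -/

section Herbrand

/-- The function `x ↦ (1 / |G|) ∑ min (i g) x`. If `i` is the ramification number on the inertia
group, it is the Herbrand function, shifted by one in both variables. -/
def herbrandSum {G : Type*} [Fintype G] (i : G → ℝ) (x : ℝ) : ℝ :=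
  (∑ g, min (i g) x) / Fintype.card G

variable {G Q : Type*} [Group G] [Group Q] [Fintype G]

lemma herbrandSum_mono (i : G → ℝ) : Monotone (herbrandSum i) := by
  intro x y h
  unfold herbrandSum
  gcongr

lemma herbrandSum_lt {i : G → ℝ} {x y M : ℝ} (hM : i 1 = M) (hxy : x < y) (hy : y ≤ M) :
    herbrandSum i x < herbrandSum i y := by
  unfold herbrandSum
  have : (0 : ℝ) < Fintype.card G := by exact_mod_cast Fintype.card_pos
  refine div_lt_div_of_pos_right (Finset.sum_lt_sum (fun g _ => by gcongr) ⟨1, Finset.mem_univ _, ?_⟩)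
    this
  rw [hM, min_eq_right (hxy.le.trans hy), min_eq_right hy]
  exact hxy

lemma herbrandSum_le_iff {i : G → ℝ} {x y M : ℝ} (hM : i 1 = M) (hx : x ≤ M) :
    herbrandSum i x ≤ herbrandSum i y ↔ x ≤ y := by
  refine ⟨fun h => ?_, fun h => herbrandSum_mono i h⟩
  by_contra! hlt
  exact absurd h (not_le.2 (herbrandSum_lt hM hlt hx))

variable {i : G → ℝ} {j : Q → ℝ} {M : ℝ} {φ : G →* Q} [Fintype φ.ker]

/-- The ramification number of `φ s` is computed from a preimage `s` of maximal ramification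
number. -/
lemma eq_herbrandSum_of_isMax (hmul : ∀ g h, min (i g) (i h) ≤ i (g * h))
    (hinv : ∀ g, i g⁻¹ = i g)
    (hj : ∀ g, Fintype.card φ.ker * j (φ g) = ∑ t : φ.ker, i (g * t.1)) {s : G}
    (hs : ∀ t : φ.ker, i (s * t.1) ≤ i s) :
    (∀ t : φ.ker, i (s * t.1) = min (i t.1) (i s)) ∧
      j (φ s) = herbrandSum (fun t : φ.ker => i t.1) (i s) := by
  have h1 : ∀ t : φ.ker, i (s * t.1) = min (i t.1) (i s) := by
    intro t
    apply le_antisymm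
    · refine le_min ?_ (hs t)
      have := hmul s⁻¹ (s * t.1)
      rw [inv_mul_cancel_left, hinv, min_eq_right (hs t)] at this
      exact this
    · rw [min_comm]; exact hmul _ _
  refine ⟨h1, ?_⟩
  have hc : (Fintype.card φ.ker : ℝ) ≠ 0 := by exact_mod_cast Fintype.card_ne_zero
  rw [herbrandSum, eq_div_iff hc, mul_comm, hj]
  exact Finset.sum_congr rfl fun t _ => h1 t

lemma exists_isMax_preimage (φ : G →* Q) [Fintype φ.ker] (hsurj : Function.Surjective φ)
    (i : G → ℝ) (q : Q) :
    ∃ s, φ s = q ∧ ∀ t : φ.ker, i (s * t.1) ≤ i s := by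
  obtain ⟨g, rfl⟩ := hsurj q
  obtain ⟨t, ht⟩ := Finite.exists_max fun t : φ.ker => i (g * t.1)
  refine ⟨g * t.1, ?_, fun t' => ?_⟩
  · rw [map_mul, show φ t.1 = 1 from t.2, mul_one]
  · have := ht (t * t')
    rwa [Subgroup.coe_mul, ← mul_assoc] at this

/-- Herbrand's theorem: the image of a ramification group in a quotient is a ramification group. -/
lemma exists_preimage_le_iff (hsurj : Function.Surjective φ)
    (hmul : ∀ g h, min (i g) (i h) ≤ i (g * h)) (hinv : ∀ g, i g⁻¹ = i g)
    (hj : ∀ g, Fintype.card φ.ker * j (φ g) = ∑ t : φ.ker, i (g * t.1))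
    (hM : i 1 = M) {x : ℝ} (hx : x ≤ M) (q : Q) :
    (∃ g, φ g = q ∧ x ≤ i g) ↔ herbrandSum (fun t : φ.ker => i t.1) x ≤ j q := by
  obtain ⟨s, rfl, hs⟩ := exists_isMax_preimage φ hsurj i q
  obtain ⟨h1, h2⟩ := eq_herbrandSum_of_isMax hmul hinv hj hs
  rw [h2, herbrandSum_le_iff (M := M) (by simpa using hM) hx]
  refine ⟨?_, fun h => ⟨s, rfl, h⟩⟩
  rintro ⟨g, hg, hxg⟩
  have := hs ⟨s⁻¹ * g, by rw [MonoidHom.mem_ker, map_mul, map_inv, hg, inv_mul_cancel]⟩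
  rw [mul_inv_cancel_left] at this
  exact hxg.trans this

/-- Transitivity of the Herbrand function. -/
lemma herbrandSum_comp [Fintype Q] (hsurj : Function.Surjective φ)
    (hmul : ∀ g h, min (i g) (i h) ≤ i (g * h)) (hinv : ∀ g, i g⁻¹ = i g)
    (hj : ∀ g, Fintype.card φ.ker * j (φ g) = ∑ t : φ.ker, i (g * t.1)) (x : ℝ) :
    herbrandSum j (herbrandSum (fun t : φ.ker => i t.1) x) = herbrandSum i x := by
  classical
  have hfib : ∀ q, min (j q) (herbrandSum (fun t : φ.ker => i t.1) x) =
      (∑ g with φ g = q, min (i g) x) / Fintype.card φ.ker := by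
    intro q
    obtain ⟨s, rfl, hs⟩ := exists_isMax_preimage φ hsurj i q
    obtain ⟨h1, h2⟩ := eq_herbrandSum_of_isMax hmul hinv hj hs
    rw [h2, ← (herbrandSum_mono _).map_min, herbrandSum]
    congr 1
    symm
    refine Finset.sum_bij' (i := fun g hg => ⟨s⁻¹ * g, ?_⟩) (j := fun t _ => s * t.1) ?_ ?_ ?_ ?_ ?_
    · rw [MonoidHom.mem_ker, map_mul, map_inv, (Finset.mem_filter.1 hg).2, inv_mul_cancel]
    · intros; exact Finset.mem_univ _
    · intro t _
      rw [Finset.mem_filter, map_mul, show φ t.1 = 1 from t.2, mul_one]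
      exact ⟨Finset.mem_univ _, rfl⟩
    · intros; simp
    · intros; simp
    · intro g hg
      have := h1 ⟨s⁻¹ * g, by
        rw [MonoidHom.mem_ker, map_mul, map_inv, (Finset.mem_filter.1 hg).2, inv_mul_cancel]⟩
      simp only [mul_inv_cancel_left] at this
      rw [this, min_assoc]
  have hcard : (Fintype.card G : ℝ) = Fintype.card φ.ker * Fintype.card Q := by
    have h1 := Subgroup.card_mul_index φ.ker
    rw [Subgroup.index_ker, MonoidHom.range_eq_top.2 hsurj, Subgroup.card_top,
      Nat.card_eq_fintype_card, Nat.card_eq_fintype_card, Nat.card_eq_fintype_card] at h1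
    exact_mod_cast h1.symm
  conv_lhs => rw [herbrandSum]
  simp_rw [hfib]
  have hsum : ∑ q, ∑ g with φ g = q, min (i g) x = ∑ g, min (i g) x :=
    Finset.sum_fiberwise Finset.univ φ fun g => min (i g) x
  rw [← Finset.sum_div, hsum, div_div, ← hcard, herbrandSum]

end Herbrand

/-! ### The ring of integers of a finite extension -/

section FiniteOverComplete

open IsLocalRing

/-- Some power of an element of a finite monoid is idempotent. -/
lemma exists_pow_idempotent {R : Type*} [Monoid R] [Finite R] (x : R) :
    ∃ N : ℕ, N ≠ 0 ∧ IsIdempotentElem (x ^ N) := by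
  obtain ⟨m, n, hmn, h⟩ : ∃ m n : ℕ, m < n ∧ x ^ m = x ^ n := by
    obtain ⟨a, b, hab, h⟩ := Finite.exists_ne_map_eq_of_infinite fun k : ℕ => x ^ k
    rcases lt_or_gt_of_ne hab with h' | h'
    · exact ⟨a, b, h', h⟩
    · exact ⟨b, a, h', h.symm⟩
  obtain ⟨k, rfl⟩ := Nat.exists_eq_add_of_lt hmn
  have h1 : ∀ j c : ℕ, x ^ (m + c) = x ^ (m + c + j * (k + 1)) := by
    intro j c
    induction j with
    | zero => simp
    | succ j ih =>
      rw [ih, show m + c + (j + 1) * (k + 1) = (m + k + 1) + (c + j * (k + 1)) by ring, pow_add _ (m + k + 1),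
        ← h, ← pow_add, add_assoc]
  refine ⟨(m + 1) * (k + 1), by positivity, ?_⟩
  rw [IsIdempotentElem, ← pow_add]
  have := h1 (m + 1) ((m + 1) * (k + 1) - m)
  rw [Nat.add_sub_cancel' (by nlinarith)] at this
  exact this.symm

variable {A B : Type*} [CommRing A] [IsDomain A] [IsDiscreteValuationRing A]
  [IsAdicComplete (maximalIdeal A) A]
  [CommRing B] [IsDomain B] [Algebra A B] [Module.Finite A B] [Module.Free A B]

/-- A finite free algebra over a complete discrete valuation ring is complete, coordinate by
coordinate with respect to a basis. -/
lemma isAdicComplete_of_finite [Module.IsTorsionFree A B] :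
    IsAdicComplete ((maximalIdeal A).map (algebraMap A B)) B := by
  set I := (maximalIdeal A).map (algebraMap A B)
  have hint : Algebra.IsIntegral A B := inferInstance
  have hItop : I ≠ ⊤ := by
    have hinj := FaithfulSMul.algebraMap_injective A B
    obtain ⟨M, hM, hMA⟩ := Ideal.exists_ideal_over_maximal_of_isIntegral (S := B)
      (maximalIdeal A) (by rw [(RingHom.injective_iff_ker_eq_bot _).1 hinj]; exact bot_le)
    intro h
    have h1 : I ≤ M := Ideal.map_le_iff_le_comap.2 hMA.ge
    exact hM.ne_top (top_le_iff.1 (h ▸ h1))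
  have hnoeth : IsNoetherianRing B := IsNoetherianRing.of_finite A B
  have hH : IsHausdorff I B := by
    refine ⟨fun x hx => ?_⟩
    have : x ∈ ⨅ i : ℕ, I ^ i := by
      rw [Ideal.mem_iInf]
      intro i
      have := hx i
      rw [SModEq.zero, smul_eq_mul, Ideal.mul_top] at this
      exact this
    rwa [Ideal.iInf_pow_eq_bot_of_isDomain I hItop] at this
  have hP : IsPrecomplete I B := by
    refine ⟨fun f hf => ?_⟩
    let b := Module.Free.chooseBasis A B
    have hfwd : ∀ (n : ℕ) (x : B), x ∈ I ^ n → ∀ i, b.repr x i ∈ maximalIdeal A ^ n := by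
      intro n x hx i
      rw [← Ideal.map_pow] at hx
      have hx' : x ∈ (maximalIdeal A ^ n) • (⊤ : Submodule A B) := by
        rw [Ideal.smul_top_eq_map]; exact hx
      refine Submodule.smul_induction_on hx' (fun r hr y _ => ?_) fun y z hy hz => ?_
      · rw [map_smul, Finsupp.smul_apply, smul_eq_mul]
        exact Ideal.mul_mem_right _ _ hr
      · rw [map_add, Finsupp.add_apply]
        exact add_mem hy hz
    have hbwd : ∀ (n : ℕ) (x : B), (∀ i, b.repr x i ∈ maximalIdeal A ^ n) → x ∈ I ^ n := by
      intro n x hx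
      rw [← b.sum_repr x]
      refine Ideal.sum_mem _ fun i _ => ?_
      rw [Algebra.smul_def, ← Ideal.map_pow]
      exact Ideal.mul_mem_right _ _ (Ideal.mem_map_of_mem _ (hx i))
    have hcoord : ∀ i, ∃ L : A, ∀ n, b.repr (f n) i ≡ L [SMOD (maximalIdeal A ^ n • ⊤ : Submodule A A)] := by
      intro i
      refine IsPrecomplete.prec inferInstance fun {m n} hmn => ?_
      have := hf hmn
      rw [SModEq.sub_mem, smul_eq_mul, Ideal.mul_top] at this ⊢
      have := hfwd m _ this i
      rwa [map_sub, Finsupp.sub_apply] at this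
    choose L hL using hcoord
    refine ⟨∑ i, L i • b i, fun n => ?_⟩
    rw [SModEq.sub_mem, smul_eq_mul, Ideal.mul_top]
    refine hbwd n _ fun i => ?_
    have := hL i n
    rw [SModEq.sub_mem, smul_eq_mul, Ideal.mul_top] at this
    rw [map_sub, Finsupp.sub_apply, b.repr_sum_self]
    exact this
  exact { hH with prec' := hP.prec' }

/-- A domain that is finite and free over a complete discrete valuation ring with finite residue
field is local: an idempotent modulo the maximal ideal of the base lifts to an idempotent, so it
is `0` or `1`. -/
lemma isLocalRing_of_finite [Module.IsTorsionFree A B] [Finite (ResidueField A)] :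
    IsLocalRing B := by
  have hcompl := isAdicComplete_of_finite (A := A) (B := B)
  set I := (maximalIdeal A).map (algebraMap A B) with hI
  have hens := IsAdicComplete.henselianRing B I
  have hint : Algebra.IsIntegral A B := inferInstance
  have hjac : ∀ x ∈ I, IsUnit (1 - x) := by
    intro x hx
    by_contra hu
    obtain ⟨M, hM, hxM⟩ := exists_max_ideal_of_mem_nonunits hu
    have hMA : (M.under A).IsMaximal := Ideal.isMaximal_comap_of_isIntegral_of_isMaximal M
    have hle : I ≤ M := Ideal.map_le_iff_le_comap.2 (IsLocalRing.eq_maximalIdeal hMA).ge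
    refine hM.ne_top ((Ideal.eq_top_iff_one M).2 ?_)
    have := add_mem hxM (hle hx)
    rwa [sub_add_cancel] at this
  have hfin : Finite (B ⧸ I) := by
    have : Finite (A ⧸ maximalIdeal A) := ‹Finite (ResidueField A)›
    have : Module.Finite (A ⧸ maximalIdeal A)
      (B ⧸ (maximalIdeal A).map (algebraMap A B)) := inferInstance
    exact Module.finite_of_finite (A ⧸ maximalIdeal A)
  refine IsLocalRing.of_isUnit_or_isUnit_one_sub_self fun x => ?_
  -- the power `x ^ N` is idempotent modulo `I`; it is lifted by Hensel's lemma for `X ^ 2 - X`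
  obtain ⟨N, hN0, hN⟩ := exists_pow_idempotent (Ideal.Quotient.mk I x)
  rw [IsIdempotentElem, ← map_pow, ← map_mul, Ideal.Quotient.eq] at hN
  set e := x ^ N with he
  obtain ⟨a, ha, hae⟩ := hens.is_henselian (Polynomial.X ^ 2 - Polynomial.X)
    (Polynomial.monic_X_pow_sub (by simp)) e (by simpa [pow_two] using hN) (by
      have h4 : (2 * e - 1) * (2 * e - 1) = 1 + 4 * (e * e - e) := by ring
      refine IsUnit.of_mul_eq_one (Ideal.Quotient.mk I (2 * e - 1)) ?_
      have hder : Polynomial.eval e (Polynomial.derivative (Polynomial.X ^ 2 - Polynomial.X : Polynomial B))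
        = 2 * e - 1 := by simp [one_add_one_eq_two]
      rw [hder, ← map_mul, h4, ← map_one (Ideal.Quotient.mk I), Ideal.Quotient.eq, add_sub_cancel_left]
      exact Ideal.mul_mem_left _ _ hN)
  have ha' : a * (a - 1) = 0 := by
    have : a ^ 2 - a = 0 := by simpa using ha
    linear_combination this
  rcases mul_eq_zero.1 ha' with h0 | h1
  · right
    rw [h0, zero_sub, neg_mem_iff] at hae
    have h2 := hjac _ hae
    exact isUnit_of_dvd_unit (by simpa using sub_dvd_pow_sub_pow 1 x N) h2
  · left
    have h3 := hjac _ hae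
    rw [sub_eq_zero.1 h1, sub_sub_cancel] at h3
    exact (isUnit_pow_iff hN0).1 h3

end FiniteOverComplete

lemma finite_residueField {A B : Type*} [CommRing A] [IsDomain A] [IsDiscreteValuationRing A]
    [CommRing B] [IsDomain B] [IsDiscreteValuationRing B] [Algebra A B] [Module.Finite A B]
    [FaithfulSMul A B] [Finite (IsLocalRing.ResidueField A)] :
    Finite (IsLocalRing.ResidueField B) := by
  have hover : (IsLocalRing.maximalIdeal B).LiesOver (IsLocalRing.maximalIdeal A) :=
    ⟨under_maximalIdeal.symm⟩
  have : Finite (A ⧸ IsLocalRing.maximalIdeal A) := ‹Finite (IsLocalRing.ResidueField A)›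
  have h : Finite (B ⧸ IsLocalRing.maximalIdeal B) :=
    Module.finite_of_finite (A ⧸ IsLocalRing.maximalIdeal A)
  exact h

section Integers

open IsLocalRing

variable {F : Type*} [Field F] [ValuativeRel F] [TopologicalSpace F] [IsNonarchimedeanLocalField F]
  {K : Type*} [Field K] [Algebra F K]

instance : FaithfulSMul 𝒪[F] (integers F K) := by
  rw [faithfulSMul_iff_algebraMap_injective]
  intro x y h
  have h1 : algebraMap F K x.1 = algebraMap F K y.1 := congrArg Subtype.val h
  exact Subtype.ext ((algebraMap F K).injective h1)

variable [FiniteDimensional F K] [Algebra.IsSeparable F K]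

instance : Module.Finite 𝒪[F] (integers F K) := IsIntegralClosure.finite 𝒪[F] F K _

instance : IsDedekindDomain (integers F K) := IsIntegralClosure.isDedekindDomain 𝒪[F] F K _

instance : IsFractionRing (integers F K) K :=
  IsIntegralClosure.isFractionRing_of_finite_extension 𝒪[F] F K _

instance : Module.IsTorsionFree 𝒪[F] (integers F K) := inferInstance

instance : IsLocalRing (integers F K) := by
  let _ := IsTopologicalAddGroup.rightUniformSpace F
  have := isUniformAddGroup_of_addCommGroup (G := F)
  have : Module.Free 𝒪[F] (integers F K) := inferInstance
  have : IsAdicComplete (maximalIdeal 𝒪[F]) 𝒪[F] :=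
    inferInstanceAs (IsAdicComplete 𝓂[F] 𝒪[F])
  have : Finite (ResidueField 𝒪[F]) := inferInstanceAs (Finite 𝓀[F])
  exact isLocalRing_of_finite (A := 𝒪[F])

lemma exists_integers_algebraMap_ne_zero :
    ∃ a ∈ maximalIdeal 𝒪[F], algebraMap 𝒪[F] (integers F K) a ≠ 0 := by
  obtain ⟨a, ha⟩ := IsDiscreteValuationRing.exists_irreducible 𝒪[F]
  refine ⟨a, (mem_maximalIdeal_iff_dvd ha).2 ⟨1, (mul_one _).symm⟩, ?_⟩
  rw [Ne, map_eq_zero_iff _ (FaithfulSMul.algebraMap_injective 𝒪[F] (integers F K))]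
  exact ha.ne_zero

instance : IsDiscreteValuationRing (integers F K) := by
  have hnf : ¬ IsField (integers F K) := by
    intro hf
    have h1 := isField_of_isIntegral_of_isField (R := 𝒪[F]) (S := integers F K)
      (FaithfulSMul.algebraMap_injective _ _) hf
    exact IsDiscreteValuationRing.not_isField 𝒪[F] h1
  have hd : IsDedekindDomain (integers F K) := inferInstance
  exact ((IsDiscreteValuationRing.TFAE (integers F K) hnf).out 0 2).2 hd

instance : Finite (ResidueField (integers F K)) := by
  have : Finite (ResidueField 𝒪[F]) := inferInstanceAs (Finite 𝓀[F])
  exact finite_residueField (A := 𝒪[F])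

lemma maxIdeal_eq : maxIdeal F K = maximalIdeal (integers F K) :=
  IsLocalRing.ringJacobson_eq_maximalIdeal _

instance : FaithfulSMul (K ≃ₐ[F] K) (integers F K) := by
  refine ⟨fun {g h} hgh => AlgEquiv.ext fun x => ?_⟩
  have hb : ∀ b : integers F K, g (b : K) = h b := fun b => congrArg Subtype.val (hgh b)
  obtain ⟨a, b, -, rfl⟩ := IsFractionRing.div_surjective (A := integers F K) x
  rw [map_div₀, map_div₀]
  exact congrArg₂ (· / ·) (hb a) (hb b)

lemma residueChar_mem : ((ringChar 𝓀[F] : ℕ) : integers F K) ∈ maximalIdeal (integers F K) := by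
  have h1 : ((ringChar 𝓀[F] : ℕ) : 𝒪[F]) ∈ maximalIdeal 𝒪[F] := by
    rw [← IsLocalRing.residue_eq_zero_iff, map_natCast]
    exact ringChar.Nat.cast_ringChar
  rw [← under_maximalIdeal (A := 𝒪[F]) (B := integers F K)] at h1
  have h2 : algebraMap 𝒪[F] (integers F K) ((ringChar 𝓀[F] : ℕ) : 𝒪[F]) ∈
    maximalIdeal (integers F K) := h1
  rwa [map_natCast] at h2

lemma ringChar_residue_prime (F : Type*) [Field F] [ValuativeRel F] [TopologicalSpace F]
    [IsNonarchimedeanLocalField F] : (ringChar 𝓀[F]).Prime := by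
  rcases CharP.char_is_prime_or_zero 𝓀[F] (ringChar 𝓀[F]) with h | h
  · exact h
  · exact absurd h (CharP.char_ne_zero_of_finite 𝓀[F] _)

end Integers

/-! ### Herbrand's theorem for discrete valuation rings -/

section Abstract

open IsLocalRing

/-- The summand `min (i g) x` of the Herbrand function, where `i g` is the ramification number,
which is infinite for `g = 1`. -/
def ramMin (B : Type*) [CommRing B] [IsDomain B] [IsDiscreteValuationRing B]
  {G : Type*} [Group G] [MulSemiringAction G B] (g : G) (x : ℝ) : ℝ :=
  open Classical in if g = 1 then x else min ((ramNumber B g).toNat : ℝ) x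

/-- The Herbrand function, shifted by one in both variables. -/
def herbrandFun (B : Type*) [CommRing B] [IsDomain B] [IsDiscreteValuationRing B]
  (G : Type*) [Group G] [MulSemiringAction G B] [Finite G] (x : ℝ) : ℝ :=
  (∑ᶠ g : (maximalIdeal B).inertia G, ramMin B g.1 x) / Nat.card ((maximalIdeal B).inertia G)

/-- The condition `x ≤ i g` on the ramification number of `g`. -/
def RamGE (B : Type*) [CommRing B] [IsDomain B] [IsDiscreteValuationRing B]
  {G : Type*} [Group G] [MulSemiringAction G B] (x : ℝ) (g : G) : Prop :=
  g = 1 ∨ x ≤ (ramNumber B g).toNat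

variable {A B : Type*} [CommRing A] [IsDomain A] [IsDiscreteValuationRing A]
  [CommRing B] [IsDomain B] [IsDiscreteValuationRing B] [Algebra A B] [Module.Finite A B]
  [FaithfulSMul A B] [Finite (ResidueField A)] [Finite (ResidueField B)]
  {G Q : Type*} [Group G] [Group Q] [Finite G] [Finite Q] [MulSemiringAction G B]
  [MulSemiringAction Q A] [FaithfulSMul G B] [FaithfulSMul Q A]

lemma coe_toNat_ramNumber {g : G} (hg : g ∈ (maximalIdeal B).inertia G) (h1 : g ≠ 1) :
    ((ramNumber B g).toNat : ℕ∞) = ramNumber B g :=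
  ENat.natCast_toNat fun h => h1 ((ramNumber_eq_top_iff hg).1 h)

/-- The ramification number as a real number, with the value `M` in place of `∞`. -/
def realRamNumber (B : Type*) [CommRing B] [IsDomain B] [IsDiscreteValuationRing B]
    {G : Type*} [Group G] [MulSemiringAction G B] (M : ℝ) (g : G) : ℝ :=
  open Classical in if g = 1 then M else (ramNumber B g).toNat

lemma min_realRamNumber {x M : ℝ} (hx : x ≤ M) (g : G) :
    min (realRamNumber B M g) x = ramMin B g x := by
  unfold realRamNumber ramMin
  split_ifs <;> simp [hx]

lemma le_realRamNumber_iff {x M : ℝ} (hx : x ≤ M) (g : G) :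
    x ≤ realRamNumber B M g ↔ RamGE B x g := by
  unfold realRamNumber RamGE
  split_ifs with h <;> simp [hx, h]

lemma herbrandFun_eq [Fintype ((maximalIdeal B).inertia G)] {x M : ℝ} (hx : x ≤ M) :
    herbrandFun B G x =
      herbrandSum (fun g : (maximalIdeal B).inertia G => realRamNumber B M g.1) x := by
  rw [herbrandFun, herbrandSum, finsum_eq_sum_of_fintype, Nat.card_eq_fintype_card]
  simp_rw [min_realRamNumber hx]

variable (B G) in
lemma herbrandFun_strictMono : StrictMono (herbrandFun B G) := by
  intro x y hxy
  have := Fintype.ofFinite ((maximalIdeal B).inertia G)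
  rw [herbrandFun_eq (hxy.le), herbrandFun_eq le_rfl]
  exact herbrandSum_lt (M := y) (by simp [realRamNumber]) hxy le_rfl

variable {φ : G →* Q} (hφ : ∀ (g : G) (a : A), algebraMap A B (φ g • a) = g • algebraMap A B a)

include hφ in
/-- Herbrand's theorem for the extension `B / A`, the image of the ramification group with index
`x` in the quotient `Q` of `G` being the one with index `y`. -/
lemma exists_herbrand [IsGaloisGroup φ.ker A B] (hsurj : Function.Surjective φ)
    {A₀ : Type*} [CommRing A₀] [IsLocalRing A₀]
    [Algebra A₀ B] [SMulCommClass G A₀ B] [Module.Finite A₀ B]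
    (hA₀ : ∃ a ∈ maximalIdeal A₀, algebraMap A₀ B a ≠ 0) (x : ℝ) :
    ∃ y, herbrandFun A Q y = herbrandFun B G x ∧ ∀ q ∈ (maximalIdeal A).inertia Q,
      (∃ g ∈ (maximalIdeal B).inertia G, φ g = q ∧ RamGE B x g) ↔ RamGE A y q := by
  classical
  let G₀ := (maximalIdeal B).inertia G
  let Q₀ := (maximalIdeal A).inertia Q
  let φ₀ : G₀ →* Q₀ := (φ.comp G₀.subtype).codRestrict Q₀ fun g => map_mem_inertia hφ g.2
  have hφ₀ : Function.Surjective φ₀ := fun q => by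
    obtain ⟨g, hg, hgq⟩ := exists_mem_inertia hφ hsurj q.2
    exact ⟨⟨g, hg⟩, Subtype.ext hgq⟩
  have := Fintype.ofFinite G₀
  have := Fintype.ofFinite Q₀
  have := Fintype.ofFinite φ₀.ker
  have := Fintype.ofFinite ((maximalIdeal B).inertia G ⊓ φ.ker : Subgroup G)
  let e : ((maximalIdeal B).inertia G ⊓ φ.ker : Subgroup G) ≃ φ₀.ker :=
    { toFun := fun t => ⟨⟨t.1, t.2.1⟩, Subtype.ext t.2.2⟩
      invFun := fun t => ⟨t.1.1, t.1.2, congrArg Subtype.val t.2⟩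
      left_inv := fun _ => rfl
      right_inv := fun _ => rfl }
  -- a cut-off above `x` and all finite ramification numbers
  let M : ℝ := max x (∑ g : G₀, ((ramNumber B g.1).toNat : ℝ))
  have hxM : x ≤ M := le_max_left _ _
  have hleM : ∀ g : G₀, ((ramNumber B g.1).toNat : ℝ) ≤ M := fun g =>
    (Finset.single_le_sum (f := fun g : G₀ => ((ramNumber B g.1).toNat : ℝ))
      (fun _ _ => Nat.cast_nonneg _) (Finset.mem_univ g)).trans (le_max_right _ _)
  -- the real-valued ramification numbers satisfy the hypotheses of the abstract theorem
  let i : G₀ → ℝ := fun g => realRamNumber B M g.1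
  have hi1 : i 1 = M := by simp [i, realRamNumber]
  have hine : ∀ g : G₀, g ≠ 1 → i g = (ramNumber B g.1).toNat := fun g hg => by
    simp [i, realRamNumber, hg]
  have hiM : ∀ g, i g ≤ M := fun g => by
    by_cases h : g = 1
    · rw [h, hi1]
    · rw [hine g h]; exact hleM g
  have hinv : ∀ g, i g⁻¹ = i g := fun g => by
    by_cases h : g = 1
    · rw [h, inv_one]
    · rw [hine g h, hine _ (inv_ne_one.2 h), Subgroup.coe_inv, ramNumber_inv g.2]
  have hmul : ∀ g h, min (i g) (i h) ≤ i (g * h) := by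
    intro g h
    by_cases h1 : g = 1
    · rw [h1, one_mul]; exact min_le_right _ _
    by_cases h2 : h = 1
    · rw [h2, mul_one]; exact min_le_left _ _
    by_cases h3 : g * h = 1
    · rw [h3, hi1]; exact (min_le_left _ _).trans (hiM g)
    rw [hine g h1, hine h h2, hine _ h3, ← Nat.cast_min, Nat.cast_le]
    have := min_ramNumber_le_mul g.2 h.2
    rw [← Subgroup.coe_mul, ← coe_toNat_ramNumber g.2 (by simpa using h1),
      ← coe_toNat_ramNumber h.2 (by simpa using h2),
      ← coe_toNat_ramNumber (g * h).2 (by rw [Ne, OneMemClass.coe_eq_one]; exact h3)] at this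
    rw [min_le_iff] at this ⊢
    exact_mod_cast this
  let i' : φ₀.ker → ℝ := fun t => i t.1
  -- the cut-off for `A` that keeps the sum formula valid on the kernel of `φ₀`
  let N : ℝ := herbrandSum i' M
  let j : Q₀ → ℝ := fun q => realRamNumber A N q.1
  have hj1 : j 1 = N := by simp [j, realRamNumber]
  have hcard0 : (Fintype.card φ₀.ker : ℝ) ≠ 0 := by exact_mod_cast Fintype.card_ne_zero
  have hj : ∀ g, Fintype.card φ₀.ker * j (φ₀ g) = ∑ t : φ₀.ker, i (g * t.1) := by
    intro g
    by_cases hg : φ₀ g = 1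
    · have h1 : ∑ t : φ₀.ker, i (g * t.1) = ∑ t : φ₀.ker, i t.1 :=
        Fintype.sum_equiv (Equiv.mulLeft (⟨g, hg⟩ : φ₀.ker)) _ _ fun t => rfl
      rw [hg, hj1, h1]
      simp only [N, i', herbrandSum]
      rw [mul_div_cancel₀ _ hcard0]
      exact Finset.sum_congr rfl fun t _ => min_eq_left (hiM _)
    · have h1 := card_mul_ramNumber hφ hA₀ g.2
      rw [Nat.card_congr e, Nat.card_eq_fintype_card,
        ← coe_toNat_ramNumber (map_mem_inertia hφ g.2) (fun h => hg (Subtype.ext h))] at h1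
      have hne : ∀ t : φ₀.ker, g * t.1 ≠ 1 := by
        intro t ht
        have h2 := congrArg φ₀ ht
        rw [map_mul, show φ₀ t.1 = 1 from t.2, mul_one, map_one] at h2
        exact hg h2
      have h2 : ∑ t : ((maximalIdeal B).inertia G ⊓ φ.ker : Subgroup G), ramNumber B (g * t.1) =
          ∑ t : φ₀.ker, ((ramNumber B (g * t.1).1).toNat : ℕ∞) :=
        Fintype.sum_equiv e _ _ fun t => by
          rw [coe_toNat_ramNumber (g * (e t).1).2
            (by rw [Ne, OneMemClass.coe_eq_one]; exact hne _)]
          rfl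
      rw [h2, ← Nat.cast_sum, ← Nat.cast_mul, Nat.cast_inj] at h1
      have h3 : j (φ₀ g) = ((ramNumber A (φ g.1)).toNat : ℝ) := by
        simp only [j, realRamNumber]
        rw [if_neg (by rw [OneMemClass.coe_eq_one]; exact hg)]
        rfl
      rw [h3]
      simp_rw [hine _ (hne _)]
      exact_mod_cast h1
  have hyN : herbrandSum i' x ≤ N := herbrandSum_mono _ hxM
  refine ⟨herbrandSum i' x, ?_, ?_⟩
  · rw [herbrandFun_eq hyN, herbrandFun_eq hxM]
    exact herbrandSum_comp hφ₀ hmul hinv hj x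
  · intro q hq
    have h1 := exists_preimage_le_iff hφ₀ hmul hinv hj hi1 hxM ⟨q, hq⟩
    rw [le_realRamNumber_iff hyN] at h1
    rw [← h1]
    constructor
    · rintro ⟨g, hg, hgq, hgx⟩
      exact ⟨⟨g, hg⟩, Subtype.ext hgq, (le_realRamNumber_iff hxM g).2 hgx⟩
    · rintro ⟨g, hgq, hgx⟩
      exact ⟨g.1, g.2, congrArg Subtype.val hgq, (le_realRamNumber_iff hxM g.1).1 hgx⟩

end Abstract

/-! ### The ramification groups and the Herbrand function of a finite Galois extension -/

section LowerNumbering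

open IsLocalRing

variable {F : Type*} [Field F] [ValuativeRel F] [TopologicalSpace F] [IsNonarchimedeanLocalField F]
  {K : Type*} [Field K] [Algebra F K] [FiniteDimensional F K] [IsGalois F K]

lemma lowerGroup_antitone : Antitone (lowerGroup F K) := by
  intro r s h σ hσ x
  refine Ideal.pow_le_pow_right ?_ (hσ x)
  have := Int.ceil_le_ceil h
  omega

lemma lowerGroup_natCast (i : ℕ) :
    lowerGroup F K i = (maximalIdeal (integers F K) ^ (i + 1)).inertia (K ≃ₐ[F] K) := by
  rw [lowerGroup, maxIdeal_eq, Int.ceil_natCast, show ((i : ℤ) + 1).toNat = i + 1 by omega]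

lemma lowerGroup_zero : lowerGroup F K 0 = (maximalIdeal (integers F K)).inertia (K ≃ₐ[F] K) := by
  have := lowerGroup_natCast (F := F) (K := K) 0
  simpa using this

/-- The lower numbering in terms of ramification numbers. The shift by one comes from the condition
`v_K (σ x - x) ≥ r + 1`. -/
lemma mem_lowerGroup_iff {r : ℝ} (hr : -1 < r) {σ : K ≃ₐ[F] K} :
    σ ∈ lowerGroup F K r ↔ σ ∈ lowerGroup F K 0 ∧ RamGE (integers F K) (r + 1) σ := by
  have hc : 0 ≤ ⌈r⌉ := by
    have : (-1 : ℤ) < ⌈r⌉ := Int.lt_ceil.2 (by simpa using hr)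
    omega
  obtain ⟨n, hn⟩ := Int.eq_ofNat_of_zero_le hc
  have h1 : lowerGroup F K r = lowerGroup F K n := by
    rw [lowerGroup, lowerGroup, hn, Int.ceil_natCast]
  have h2 : lowerGroup F K n ≤ lowerGroup F K 0 := lowerGroup_antitone (Nat.cast_nonneg n)
  have h3 : σ ∈ lowerGroup F K r ↔ σ ∈ lowerGroup F K 0 ∧ σ ∈ lowerGroup F K n := by
    rw [h1]; exact ⟨fun h => ⟨h2 h, h⟩, fun h => h.2⟩
  rw [h3]
  refine and_congr_right fun h0 => ?_
  rw [lowerGroup_zero] at h0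
  rw [lowerGroup_natCast, ← le_ramNumber_iff h0, RamGE]
  by_cases h : σ = 1
  · simp [h, ramNumber_one]
  · have h4 : r + 1 ≤ ((ramNumber (integers F K) σ).toNat : ℝ) ↔
        n + 1 ≤ (ramNumber (integers F K) σ).toNat := by
      rw [show r + 1 ≤ ((ramNumber (integers F K) σ).toNat : ℝ) ↔
        r ≤ (((ramNumber (integers F K) σ).toNat - 1 : ℤ) : ℝ) by
          push_cast; constructor <;> intro <;> linarith, ← Int.ceil_le, hn]
      omega
    simp only [h, false_or, h4]
    conv_lhs => rw [← coe_toNat_ramNumber h0 h]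
    exact Nat.cast_le

lemma exists_lowerGroup_eq_bot : ∃ N : ℕ, lowerGroup F K N = ⊥ := by
  obtain ⟨N, hN⟩ := exists_inertia_pow_eq_bot (G := K ≃ₐ[F] K) (B := integers F K)
  refine ⟨N, (Subgroup.eq_bot_iff_forall _).2 fun σ hσ => hN σ fun x => ?_⟩
  rw [lowerGroup_natCast] at hσ
  exact Ideal.pow_le_pow_right (Nat.le_succ N) (hσ x)

lemma lowerIndex_of_nonpos {r : ℝ} (hr : r ≤ 0) : lowerIndex F K r = 1 := by
  rw [lowerIndex, Subgroup.relIndex_eq_one]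
  exact lowerGroup_antitone hr

lemma lowerIndex_mul_card (r : ℝ) :
    Nat.card ((lowerGroup F K r).subgroupOf (lowerGroup F K 0)) * lowerIndex F K r =
      Nat.card (lowerGroup F K 0) :=
  Subgroup.card_mul_index _

lemma lowerIndex_pos (r : ℝ) : 0 < lowerIndex F K r := by
  have h := lowerIndex_mul_card (F := F) (K := K) r
  refine Nat.pos_of_ne_zero fun h0 => ?_
  rw [h0, mul_zero] at h
  exact Nat.card_pos.ne h

/-- The slope of the Herbrand function as the proportion of elements of `G_0` that lie in `G_t`. -/
lemma one_div_lowerIndex {t : ℝ} (ht : -1 < t) : (1 : ℝ) / lowerIndex F K t =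
    (∑ᶠ σ : (maximalIdeal (integers F K)).inertia (K ≃ₐ[F] K),
      Set.indicator {t | RamGE (integers F K) (t + 1) σ.1} (fun _ => (1 : ℝ)) t) /
      Nat.card ((maximalIdeal (integers F K)).inertia (K ≃ₐ[F] K)) := by
  classical
  have h := lowerIndex_mul_card (F := F) (K := K) t
  have h1 : Nat.card ((lowerGroup F K t).subgroupOf (lowerGroup F K 0)) =
      Nat.card {σ : lowerGroup F K 0 // RamGE (integers F K) (t + 1) σ.1} :=
    Nat.card_congr (Equiv.subtypeEquivRight fun σ => by
      rw [Subgroup.mem_subgroupOf, mem_lowerGroup_iff ht]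
      exact and_iff_right σ.2)
  rw [h1, lowerGroup_zero] at h
  have := Fintype.ofFinite ((maximalIdeal (integers F K)).inertia (K ≃ₐ[F] K))
  have h2 : (∑ᶠ σ : (maximalIdeal (integers F K)).inertia (K ≃ₐ[F] K),
      Set.indicator {t | RamGE (integers F K) (t + 1) σ.1} (fun _ => (1 : ℝ)) t) =
      Nat.card {σ : (maximalIdeal (integers F K)).inertia (K ≃ₐ[F] K) //
        RamGE (integers F K) (t + 1) σ.1} := by
    rw [finsum_eq_sum_of_fintype, Nat.card_eq_fintype_card, Fintype.card_subtype]
    simp [Set.indicator_apply]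
  rw [h2, div_eq_div_iff (by exact_mod_cast (lowerIndex_pos t).ne')
    (by exact_mod_cast Nat.card_pos.ne'), one_mul, ← h]
  push_cast
  rfl

lemma integral_indicator_ramGE {r : ℝ} (hr : -1 ≤ r) (σ : K ≃ₐ[F] K) :
    IntervalIntegrable (Set.indicator {t | RamGE (integers F K) (t + 1) σ} fun _ => (1 : ℝ))
      volume (-1) r ∧
    ∫ t in (-1 : ℝ)..r, Set.indicator {t | RamGE (integers F K) (t + 1) σ} (fun _ => (1 : ℝ)) t =
      ramMin (integers F K) σ (r + 1) := by
  classical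
  by_cases h : σ = 1
  · have : {t : ℝ | RamGE (integers F K) (t + 1) σ} = Set.univ := by
      ext; simp [RamGE, h]
    rw [this, Set.indicator_univ]
    refine ⟨intervalIntegrable_const, ?_⟩
    simp [ramMin, h]
  · set n : ℝ := ((ramNumber (integers F K) σ).toNat : ℝ)
    have hn : 0 ≤ n := Nat.cast_nonneg _
    have hset : {t : ℝ | RamGE (integers F K) (t + 1) σ} = {t | t ≤ n - 1} := by
      ext t
      simp only [RamGE, h, false_or, Set.mem_ofPred_eq]
      exact le_sub_iff_add_le.symm
    rw [hset]
    refine ⟨?_, ?_⟩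
    · rw [intervalIntegrable_iff_integrableOn_Ioc_of_le hr]
      exact (integrableOn_const (by simp)).indicator measurableSet_Iic
    · simp only [ramMin, h, if_false]
      change _ = min n (r + 1)
      rcases le_total (n - 1) r with h1 | h1
      · rw [intervalIntegral.integral_indicator ⟨by linarith, h1⟩, min_eq_left (by linarith)]
        simp
      · rw [min_eq_right (by linarith)]
        have : ∫ t in (-1 : ℝ)..r, Set.indicator {t | t ≤ n - 1} (fun _ => (1 : ℝ)) t =
            ∫ t in (-1 : ℝ)..r, (1 : ℝ) := by
          refine intervalIntegral.integral_congr fun t ht => ?_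
          rw [Set.uIcc_of_le hr] at ht
          exact Set.indicator_of_mem (s := {t : ℝ | t ≤ n - 1}) (ht.2.trans h1) (fun _ => (1 : ℝ))
        rw [this]
        simp

/-- Serre's formula `φ(r) = (1 / |G_0|) ∑ min (i(σ)) (r + 1) - 1` for the Herbrand function. -/
lemma herbrandPhi_eq {r : ℝ} (hr : -1 ≤ r) :
    herbrandPhi F K r = herbrandFun (integers F K) (K ≃ₐ[F] K) (r + 1) - 1 := by
  have := Fintype.ofFinite ((maximalIdeal (integers F K)).inertia (K ≃ₐ[F] K))
  have h1 : ∫ t in (-1 : ℝ)..r, (1 : ℝ) / lowerIndex F K t =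
      ∫ t in (-1 : ℝ)..r, (∑ σ : (maximalIdeal (integers F K)).inertia (K ≃ₐ[F] K),
      Set.indicator {t | RamGE (integers F K) (t + 1) σ.1} (fun _ => (1 : ℝ)) t) /
      Nat.card ((maximalIdeal (integers F K)).inertia (K ≃ₐ[F] K)) := by
    rw [intervalIntegral.integral_of_le hr, intervalIntegral.integral_of_le hr]
    refine setIntegral_congr_fun measurableSet_Ioc fun t ht => ?_
    rw [one_div_lowerIndex ht.1, finsum_eq_sum_of_fintype]
  rw [herbrandPhi, h1, intervalIntegral.integral_div, intervalIntegral.integral_finsetSum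
    fun σ _ => (integral_indicator_ramGE hr σ.1).1, herbrandFun, finsum_eq_sum_of_fintype]
  simp_rw [(integral_indicator_ramGE hr _).2]
  ring

lemma herbrandPhi_neg_one : herbrandPhi F K (-1) = -1 := by simp [herbrandPhi]

lemma herbrandPhi_strictMonoOn : StrictMonoOn (herbrandPhi F K) (Set.Ici (-1)) := by
  intro r hr s hs h
  rw [herbrandPhi_eq hr, herbrandPhi_eq hs]
  exact sub_lt_sub_right (herbrandFun_strictMono _ _ (by linarith)) 1

end LowerNumbering

/-! ### The upper numbering and its compatibility with quotients -/

section UpperNumbering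

open IsLocalRing

variable {F : Type*} [Field F] [ValuativeRel F] [TopologicalSpace F] [IsNonarchimedeanLocalField F]
  {K : Type*} [Field K] [Algebra F K] [FiniteDimensional F K] [IsGalois F K]

lemma continuous_herbrandFun :
    Continuous (herbrandFun (integers F K) (K ≃ₐ[F] K)) := by
  classical
  have := Fintype.ofFinite ((maximalIdeal (integers F K)).inertia (K ≃ₐ[F] K))
  unfold herbrandFun
  simp_rw [finsum_eq_sum_of_fintype]
  refine (continuous_finsetSum _ fun σ _ => ?_).div_const _
  unfold ramMin
  split_ifs <;> fun_prop

lemma le_herbrandFun {x : ℝ} (hx : 0 ≤ x) :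
    x / Nat.card ((maximalIdeal (integers F K)).inertia (K ≃ₐ[F] K)) ≤
      herbrandFun (integers F K) (K ≃ₐ[F] K) x := by
  classical
  have := Fintype.ofFinite ((maximalIdeal (integers F K)).inertia (K ≃ₐ[F] K))
  unfold herbrandFun
  refine div_le_div_of_nonneg_right ?_ (Nat.cast_nonneg _)
  rw [finsum_eq_sum_of_fintype]
  refine le_trans (le_of_eq ?_) (Finset.single_le_sum (fun σ _ => ?_) (Finset.mem_univ 1))
  · simp [ramMin]
  · unfold ramMin
    split_ifs
    · exact hx
    · exact le_min (Nat.cast_nonneg _) hx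

/-- Surjectivity of `φ`. It makes `herbrandPsi`, defined through `Function.invFunOn`, a true
inverse. -/
lemma exists_herbrandPhi_eq {s : ℝ} (hs : -1 ≤ s) :
    ∃ r ∈ Set.Ici (-1 : ℝ), herbrandPhi F K r = s := by
  set c : ℝ := ((Nat.card ((maximalIdeal (integers F K)).inertia (K ≃ₐ[F] K)) : ℕ) : ℝ)
  have hc : 0 < c := Nat.cast_pos.2 Nat.card_pos
  set x : ℝ := c * (s + 1)
  have hx : 0 ≤ x := mul_nonneg hc.le (by linarith)
  have h1 := le_herbrandFun (F := F) (K := K) hx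
  rw [show x / c = s + 1 from mul_div_cancel_left₀ _ hc.ne'] at h1
  have h0 : herbrandFun (integers F K) (K ≃ₐ[F] K) 0 = 0 := by
    have := herbrandPhi_eq (F := F) (K := K) (le_refl (-1))
    rw [herbrandPhi_neg_one] at this
    norm_num at this
    linarith
  obtain ⟨y, hy, hys⟩ := intermediate_value_Icc hx
    (continuous_herbrandFun (F := F) (K := K)).continuousOn
    (show s + 1 ∈ Set.Icc _ _ from ⟨by rw [h0]; linarith, h1⟩)
  refine ⟨y - 1, by simpa using hy.1, ?_⟩
  rw [herbrandPhi_eq (by linarith [hy.1]), sub_add_cancel, hys, add_sub_cancel_right]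

lemma herbrandPsi_mem {s : ℝ} (hs : -1 ≤ s) : -1 ≤ herbrandPsi F K s :=
  Function.invFunOn_mem (exists_herbrandPhi_eq hs)

lemma herbrandPhi_herbrandPsi {s : ℝ} (hs : -1 ≤ s) : herbrandPhi F K (herbrandPsi F K s) = s :=
  Function.invFunOn_eq (exists_herbrandPhi_eq hs)

lemma herbrandPsi_eq_iff {s r : ℝ} (hs : -1 ≤ s) (hr : -1 ≤ r) :
    herbrandPsi F K s = r ↔ herbrandPhi F K r = s := by
  constructor
  · rintro rfl; exact herbrandPhi_herbrandPsi hs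
  · rintro rfl
    exact herbrandPhi_strictMonoOn.injOn (herbrandPsi_mem hs) hr (herbrandPhi_herbrandPsi hs)

lemma lt_herbrandPsi_iff {s r : ℝ} (hs : -1 ≤ s) (hr : -1 ≤ r) :
    r < herbrandPsi F K s ↔ herbrandPhi F K r < s := by
  have h := (herbrandPhi_strictMonoOn (F := F) (K := K)).lt_iff_lt (a := r)
    (b := herbrandPsi F K s) hr (herbrandPsi_mem hs)
  rw [← h, herbrandPhi_herbrandPsi hs]

lemma neg_one_lt_herbrandPsi {s : ℝ} (hs : -1 < s) : -1 < herbrandPsi F K s := by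
  rw [lt_herbrandPsi_iff hs.le le_rfl, herbrandPhi_neg_one]
  exact hs

lemma lowerGroup_eq_of_ceil {r : ℝ} {i : ℕ} (h1 : (i : ℝ) - 1 < r) (h2 : r ≤ i) :
    lowerGroup F K r = lowerGroup F K i := by
  have : ⌈r⌉ = i := Int.ceil_eq_iff.2 ⟨by simpa using h1, by simpa using h2⟩
  rw [lowerGroup, lowerGroup, this, Int.ceil_natCast]

lemma intervalIntegrable_one_div_lowerIndex (a b : ℝ) :
    IntervalIntegrable (fun t => (1 : ℝ) / lowerIndex F K t) volume a b := by
  refine Antitone.intervalIntegrable fun s t h => ?_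
  refine one_div_le_one_div_of_le (by exact_mod_cast lowerIndex_pos s) (Nat.cast_le.2 ?_)
  refine Nat.le_of_dvd (lowerIndex_pos t) ?_
  exact Subgroup.relIndex_dvd_of_le_left _ (lowerGroup_antitone h)

lemma herbrandPhi_natCast_sub (i : ℕ) :
    herbrandPhi F K i - herbrandPhi F K ((i : ℝ) - 1) = 1 / lowerIndex F K i := by
  rw [herbrandPhi, herbrandPhi, add_sub_add_left_eq_sub,
    intervalIntegral.integral_interval_sub_left (intervalIntegrable_one_div_lowerIndex _ _)
      (intervalIntegrable_one_div_lowerIndex _ _)]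
  have : ∫ t in ((i : ℝ) - 1)..i, (1 : ℝ) / lowerIndex F K t =
      ∫ t in ((i : ℝ) - 1)..i, (1 : ℝ) / lowerIndex F K i := by
    rw [intervalIntegral.integral_of_le (by linarith), intervalIntegral.integral_of_le (by linarith)]
    refine setIntegral_congr_fun measurableSet_Ioc fun t ht => ?_
    change (1 : ℝ) / ((lowerGroup F K t).relIndex _ : ℕ) = _
    rw [lowerGroup_eq_of_ceil ht.1 ht.2]
    rfl
  rw [this]
  simp

lemma herbrandPhi_zero : herbrandPhi F K 0 = 0 := by
  have h := herbrandPhi_natCast_sub (F := F) (K := K) 0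
  rw [Nat.cast_zero, zero_sub, herbrandPhi_neg_one, lowerIndex_of_nonpos le_rfl] at h
  norm_num at h
  linarith

lemma upperGroup_eq_lowerGroup {i : ℕ} {s : ℝ} (h1 : herbrandPhi F K ((i : ℝ) - 1) < s)
    (h2 : s ≤ herbrandPhi F K i) : upperGroup F K s = lowerGroup F K i := by
  have hi : (-1 : ℝ) ≤ (i : ℝ) - 1 := by have : (0 : ℝ) ≤ i := Nat.cast_nonneg i; linarith
  have hs : -1 ≤ s := by
    rw [← herbrandPhi_neg_one (F := F) (K := K)]
    exact (herbrandPhi_strictMonoOn.monotoneOn Set.self_mem_Ici hi hi).trans h1.le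
  refine lowerGroup_eq_of_ceil ((lt_herbrandPsi_iff hs hi).2 h1) ?_
  rw [← not_lt, lt_herbrandPsi_iff hs (by linarith), not_lt]
  exact h2

lemma upperGroup_of_nonpos {s : ℝ} (h1 : -1 < s) (h2 : s ≤ 0) :
    upperGroup F K s = lowerGroup F K 0 := by
  have := upperGroup_eq_lowerGroup (F := F) (K := K) (i := 0) (s := s)
    (by rw [Nat.cast_zero, zero_sub, herbrandPhi_neg_one]; exact h1)
    (by rw [Nat.cast_zero, herbrandPhi_zero]; exact h2)
  rwa [Nat.cast_zero] at this

lemma upperGroup_antitoneOn : AntitoneOn (upperGroup F K) (Set.Ici (-1)) := by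
  intro s hs t ht h
  refine lowerGroup_antitone ?_
  rw [← not_lt, lt_herbrandPsi_iff hs (herbrandPsi_mem ht), herbrandPhi_herbrandPsi ht, not_lt]
  exact h

lemma upperGroup_le_lowerGroup_zero {s : ℝ} (hs : -1 < s) :
    upperGroup F K s ≤ lowerGroup F K 0 := by
  rcases le_total s 0 with h | h
  · exact (upperGroup_of_nonpos hs h).le
  · rw [← upperGroup_of_nonpos (F := F) (K := K) (s := 0) (by norm_num) le_rfl]
    exact upperGroup_antitoneOn (by norm_num) hs.le h

lemma mem_upperGroup_iff {s : ℝ} (hs : -1 < s) {σ : K ≃ₐ[F] K} :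
    σ ∈ upperGroup F K s ↔ σ ∈ lowerGroup F K 0 ∧
      RamGE (integers F K) (herbrandPsi F K s + 1) σ :=
  mem_lowerGroup_iff (neg_one_lt_herbrandPsi hs)

lemma upperGroup_le_lowerGroup_one {s : ℝ} (hs : 0 < s) :
    upperGroup F K s ≤ lowerGroup F K (1 : ℕ) := by
  have h1 : 0 < herbrandPsi F K s := by
    rw [lt_herbrandPsi_iff (by linarith) (by norm_num), herbrandPhi_zero]
    exact hs
  intro σ hσ x
  refine Ideal.pow_le_pow_right ?_ (hσ x)
  have : 0 < ⌈herbrandPsi F K s⌉ := Int.ceil_pos.2 h1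
  rw [Int.ceil_natCast]
  omega

end UpperNumbering

section Tower

open IsLocalRing

variable (F : Type*) [Field F] [ValuativeRel F] [TopologicalSpace F] [IsNonarchimedeanLocalField F]
  (K L : Type*) [Field K] [Algebra F K] [FiniteDimensional F K] [IsGalois F K]
  [Field L] [Algebra F L] [FiniteDimensional F L] [IsGalois F L] [Algebra K L] [IsScalarTower F K L]

instance isScalarTower_integer : IsScalarTower 𝒪[F] K L :=
  IsScalarTower.of_algebraMap_eq fun x => IsScalarTower.algebraMap_apply F K L x

/-- The inclusion of rings of integers for a tower `L / K / F`. -/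
@[reducible]
def integersAlgebra : Algebra (integers F K) (integers F L) :=
  ((IsScalarTower.toAlgHom 𝒪[F] K L).mapIntegralClosure : _ →+* _).toAlgebra

/-- Herbrand's theorem for a tower `L / K / F`: restriction maps the inertia group of `L` onto that
of `K`, and the image of the ramification group with index `x` is the one with index `y`, where
the (shifted) Herbrand functions satisfy `φ_K(y) = φ_L(x)`. -/
lemma herbrand_tower (x : ℝ) :
    (∀ g ∈ lowerGroup F L 0, AlgEquiv.restrictNormalHom K g ∈ lowerGroup F K 0) ∧
    (∀ q ∈ lowerGroup F K 0, ∃ g ∈ lowerGroup F L 0, AlgEquiv.restrictNormalHom K g = q) ∧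
    ∃ y, herbrandFun (integers F K) (K ≃ₐ[F] K) y = herbrandFun (integers F L) (L ≃ₐ[F] L) x ∧
      ∀ q ∈ lowerGroup F K 0,
      (∃ g ∈ lowerGroup F L 0, AlgEquiv.restrictNormalHom K g = q ∧ RamGE (integers F L) x g) ↔
        RamGE (integers F K) y q := by
  let _ := integersAlgebra F K L
  have hmap : ∀ a : integers F K, (algebraMap (integers F K) (integers F L) a : L) =
      algebraMap K L a := fun _ => rfl
  have : IsScalarTower 𝒪[F] (integers F K) (integers F L) :=
    IsScalarTower.of_algebraMap_eq fun x => Subtype.ext (IsScalarTower.algebraMap_apply 𝒪[F] K L x)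
  have : Module.Finite (integers F K) (integers F L) :=
    Module.Finite.of_restrictScalars_finite 𝒪[F] _ _
  have : FaithfulSMul (integers F K) (integers F L) := by
    rw [faithfulSMul_iff_algebraMap_injective]
    intro a b h
    exact Subtype.ext ((algebraMap K L).injective (congrArg Subtype.val h))
  let φ : (L ≃ₐ[F] L) →* (K ≃ₐ[F] K) := AlgEquiv.restrictNormalHom K
  have hφ : ∀ (g : L ≃ₐ[F] L) (a : integers F K), algebraMap (integers F K) (integers F L) (φ g • a)
      = g • algebraMap (integers F K) (integers F L) a := fun g a =>
    Subtype.ext (AlgEquiv.restrictNormal_commutes g K a.1)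
  have hsurj : Function.Surjective φ := AlgEquiv.restrictNormalHom_surjective L
  have hfd : FiniteDimensional K L := FiniteDimensional.right F K L
  have hgal : IsGalois K L := IsGalois.tower_top_of_isGalois F K L
  have : IsGaloisGroup φ.ker (integers F K) (integers F L) :=
    { faithful := ⟨fun {g h} hgh => Subtype.ext (eq_of_smul_eq_smul fun b => hgh b)⟩
      commutes := ⟨fun g a b => by
        rw [Algebra.smul_def, Algebra.smul_def, smul_mul']
        congr 1
        change g.1 • algebraMap (integers F K) (integers F L) a = _
        rw [← hφ, show φ g.1 = 1 from g.2, one_smul]⟩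
      isInvariant := ⟨fun b hb => by
        obtain ⟨k, hk⟩ := (IsGalois.mem_range_algebraMap_iff_fixed (F := K) b.1).2 fun τ => by
          have h1 : φ (τ.restrictScalars F) = 1 := AlgEquiv.ext fun k => by
            apply (algebraMap K L).injective
            have := AlgEquiv.restrictNormal_commutes (τ.restrictScalars F) K k
            refine this.trans ?_
            simp
          exact congrArg Subtype.val (hb ⟨τ.restrictScalars F, h1⟩)
        have hki : IsIntegral 𝒪[F] k := by
          have := b.2
          rw [← hk] at this
          exact (isIntegral_algebraMap_iff (algebraMap K L).injective).1 this
        exact ⟨⟨k, hki⟩, Subtype.ext hk⟩⟩ }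
  rw [lowerGroup_zero, lowerGroup_zero]
  refine ⟨fun g hg => map_mem_inertia hφ hg, fun q hq => exists_mem_inertia hφ hsurj hq, ?_⟩
  exact exists_herbrand hφ hsurj (A₀ := 𝒪[F]) exists_integers_algebraMap_ne_zero x

variable {F K L}

/-- The upper numbering is compatible with quotients. -/
lemma mem_upperGroup_iff_exists {s : ℝ} (hs : -1 < s) {q : K ≃ₐ[F] K} :
    q ∈ upperGroup F K s ↔ ∃ g ∈ upperGroup F L s, AlgEquiv.restrictNormalHom K g = q := by
  obtain ⟨h0, -, y, hy, h⟩ := herbrand_tower F K L (herbrandPsi F L s + 1)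
  have h1 := herbrandPhi_herbrandPsi (F := F) (K := L) hs.le
  rw [herbrandPhi_eq (herbrandPsi_mem hs.le), ← hy] at h1
  have hy0 : 0 ≤ y := by
    by_contra! hneg
    have h2 := herbrandFun_strictMono (integers F K) (K ≃ₐ[F] K) hneg
    have h3 := herbrandPhi_eq (F := F) (K := K) (le_refl (-1))
    rw [herbrandPhi_neg_one] at h3
    norm_num at h3
    linarith
  have h4 : herbrandPsi F K s = y - 1 := by
    rw [herbrandPsi_eq_iff hs.le (by linarith), herbrandPhi_eq (by linarith), sub_add_cancel, h1]
  rw [mem_upperGroup_iff hs, h4, sub_add_cancel]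
  constructor
  · rintro ⟨hq, hq'⟩
    obtain ⟨g, hg, hgq, hg'⟩ := (h q hq).2 hq'
    exact ⟨g, (mem_upperGroup_iff hs).2 ⟨hg, hg'⟩, hgq⟩
  · rintro ⟨g, hg, rfl⟩
    rw [mem_upperGroup_iff hs] at hg
    have hmem := h0 g hg.1
    exact ⟨hmem, (h _ hmem).1 ⟨g, hg.1, rfl, hg.2⟩⟩

end Tower

/-! ### Passage to the separable closure -/

section Absolute

open IsLocalRing

variable {F : Type*} [Field F] [ValuativeRel F] [TopologicalSpace F] [IsNonarchimedeanLocalField F]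
  {Ω : Type*} [Field Ω] [Algebra F Ω] [IsGalois F Ω]

/-- The inclusion of the ring of integers of a finite subextension into that of `Ω`. -/
def integersIncl (K : FiniteGaloisIntermediateField F Ω) : integers F K →+* integers F Ω :=
  ((IsScalarTower.toAlgHom 𝒪[F] K Ω).mapIntegralClosure : _ →+* _)

lemma integersIncl_injective (K : FiniteGaloisIntermediateField F Ω) :
    Function.Injective (integersIncl K) := fun x y h => by
  have := congrArg (Subtype.val : integers F Ω → Ω) h
  exact Subtype.ext (Subtype.ext this)

/-- Membership of an integer of `Ω` in a finite subextension. -/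
lemma exists_integersIncl_eq_of_mem {K : FiniteGaloisIntermediateField F Ω} {x : integers F Ω}
    (hx : (x : Ω) ∈ K.toIntermediateField) : ∃ y : integers F K, integersIncl K y = x :=
  ⟨⟨⟨x, hx⟩, (isIntegral_algebraMap_iff (algebraMap K Ω).injective).1 x.2⟩, rfl⟩

lemma exists_integersIncl_eq (x : integers F Ω) :
    ∃ (K : FiniteGaloisIntermediateField F Ω) (y : integers F K), integersIncl K y = x :=
  ⟨FiniteGaloisIntermediateField.adjoin F {(x : Ω)}, exists_integersIncl_eq_of_mem
    (FiniteGaloisIntermediateField.subset_adjoin F {(x : Ω)} rfl)⟩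

instance : IsLocalRing (integers F Ω) :=
  IsLocalRing.of_isUnit_or_isUnit_one_sub_self fun x => by
    obtain ⟨K, y, rfl⟩ := exists_integersIncl_eq x
    rcases IsLocalRing.isUnit_or_isUnit_one_sub_self y with h | h
    · exact Or.inl (h.map _)
    · right
      have := h.map (integersIncl K)
      rwa [map_sub, map_one] at this

lemma absMaxIdeal_eq : maxIdeal F Ω = maximalIdeal (integers F Ω) :=
  IsLocalRing.ringJacobson_eq_maximalIdeal _

lemma integersIncl_mem_iff {K : FiniteGaloisIntermediateField F Ω} {x : integers F K} :
    integersIncl K x ∈ maxIdeal F Ω ↔ x ∈ maxIdeal F K := by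
  rw [absMaxIdeal_eq, maxIdeal_eq, mem_maximalIdeal, mem_maximalIdeal, mem_nonunits_iff,
    mem_nonunits_iff, not_iff_not]
  refine ⟨fun h => ?_, fun h => h.map _⟩
  obtain ⟨y, hy⟩ := h.exists_right_inv
  have hyK : (y : Ω) ∈ K.toIntermediateField := by
    have h1 : ((x : K) : Ω) * y = 1 := congrArg Subtype.val hy
    rw [← inv_eq_of_mul_eq_one_right h1]
    exact inv_mem (x : K).2
  obtain ⟨z, rfl⟩ := exists_integersIncl_eq_of_mem hyK
  refine IsUnit.of_mul_eq_one z (integersIncl_injective K ?_)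
  rw [map_mul, hy, map_one]

lemma integersIncl_smul (K : FiniteGaloisIntermediateField F Ω) (σ : Ω ≃ₐ[F] Ω)
    (x : integers F K) : integersIncl K (AlgEquiv.restrictNormalHom K σ • x) =
      σ • integersIncl K x :=
  Subtype.ext (AlgEquiv.restrictNormal_commutes σ K x.1)

lemma coe_restrictNormalHom (K : FiniteGaloisIntermediateField F Ω) (σ : Ω ≃ₐ[F] Ω) (x : K) :
    ((AlgEquiv.restrictNormalHom K σ : K ≃ₐ[F] K) x : Ω) = σ x :=
  AlgEquiv.restrictNormal_commutes σ K x

lemma restrictNormalHom_eq_one_iff (K : FiniteGaloisIntermediateField F Ω) (σ : Ω ≃ₐ[F] Ω) :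
    (AlgEquiv.restrictNormalHom K σ : K ≃ₐ[F] K) = 1 ↔ ∀ x ∈ K.toIntermediateField, σ x = x := by
  constructor
  · intro h x hx
    have := coe_restrictNormalHom K σ ⟨x, hx⟩
    rw [h] at this
    exact this.symm
  · intro h
    ext x
    rw [coe_restrictNormalHom, h _ x.2]
    rfl

/-- An automorphism is in the absolute inertia group if and only if all of its finite restrictions
are in the inertia groups. -/
lemma mem_absInertia_iff {σ : Ω ≃ₐ[F] Ω} :
    σ ∈ absInertia F Ω ↔ ∀ K : FiniteGaloisIntermediateField F Ω,
      AlgEquiv.restrictNormalHom K σ ∈ lowerGroup F K 0 := by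
  constructor
  · intro h K x
    rw [Int.ceil_zero, zero_add, Int.toNat_one, pow_one]
    refine integersIncl_mem_iff.1 ?_
    rw [map_sub, integersIncl_smul]
    exact h _
  · intro h x
    obtain ⟨K, y, rfl⟩ := exists_integersIncl_eq x
    have h1 := h K y
    rw [Int.ceil_zero, zero_add, Int.toNat_one, pow_one] at h1
    have := integersIncl_mem_iff.2 h1
    rwa [map_sub, integersIncl_smul] at this

/-- Elements of a compatible family of subgroups of the finite Galois groups lift to the absolute
Galois group, by compactness. -/
lemma exists_lift_of_compatible (S : ∀ K : FiniteGaloisIntermediateField F Ω, Subgroup (K ≃ₐ[F] K))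
    (hS : ∀ (K L : FiniteGaloisIntermediateField F Ω) (h : K ≤ L) (q : K ≃ₐ[F] K),
      q ∈ S K ↔ ∃ g ∈ S L, ∀ x : K, ((g (IntermediateField.inclusion h x) : L) : Ω) = q x)
    (K : FiniteGaloisIntermediateField F Ω) {q : K ≃ₐ[F] K} (hq : q ∈ S K) :
    ∃ σ : Ω ≃ₐ[F] Ω, AlgEquiv.restrictNormalHom K σ = q ∧
      ∀ L : FiniteGaloisIntermediateField F Ω, AlgEquiv.restrictNormalHom L σ ∈ S L := by
  -- closed nonempty sets, directed under reverse inclusion; a point of the intersection is the lift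
  let C : FiniteGaloisIntermediateField F Ω → Set (Ω ≃ₐ[F] Ω) := fun L =>
    {σ | AlgEquiv.restrictNormalHom L σ ∈ S L ∧ AlgEquiv.restrictNormalHom K σ = q}
  have hmono : ∀ {L M : FiniteGaloisIntermediateField F Ω}, L ≤ M → C M ⊆ C L := by
    rintro L M h σ ⟨h1, h2⟩
    refine ⟨(hS L M h _).2 ⟨_, h1, fun x => ?_⟩, h2⟩
    rw [coe_restrictNormalHom, coe_restrictNormalHom]
    rfl
  have hclosed : ∀ L, IsClosed (C L) := by
    intro L
    have hdisc : ∀ M : FiniteGaloisIntermediateField F Ω, DiscreteTopology (M ≃ₐ[F] M) := fun M =>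
      krullTopology_discreteTopology_of_finiteDimensional F M
    have hc : ∀ M : FiniteGaloisIntermediateField F Ω,
      Continuous (AlgEquiv.restrictNormalHom (F := F) (K₁ := Ω) M) := fun M =>
        InfiniteGalois.restrictNormalHom_continuous M.toIntermediateField
    have h1 := hdisc L
    have h2 := hdisc K
    exact ((isClosed_discrete (S L : Set (L ≃ₐ[F] L))).preimage (hc L)).inter
      ((isClosed_discrete {q}).preimage (hc K))
  have hne : ∀ L, (C L).Nonempty := by
    intro L
    obtain ⟨g, hg, hgq⟩ := (hS K (L ⊔ K) le_sup_right q).1 hq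
    obtain ⟨σ, hσ⟩ := AlgEquiv.restrictNormalHom_surjective (F := F)
      (K₁ := ((L ⊔ K : FiniteGaloisIntermediateField F Ω) : Type _)) Ω g
    refine ⟨σ, hmono (M := L ⊔ K) le_sup_left ⟨by rw [hσ]; exact hg, ?_⟩ |>.1, ?_⟩
    all_goals
      ext x
      rw [coe_restrictNormalHom, ← hgq, ← hσ, coe_restrictNormalHom]
      rfl
  obtain ⟨σ, hσ⟩ := IsCompact.nonempty_iInter_of_directed_nonempty_isCompact_isClosed C
    (fun L M => ⟨L ⊔ M, hmono le_sup_left, hmono le_sup_right⟩) hne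
    (fun L => (hclosed L).isCompact) hclosed
  rw [Set.mem_iInter] at hσ
  exact ⟨σ, (hσ K).2, fun L => (hσ L).1⟩

lemma mem_absUpperGroup_iff {s : ℝ} {σ : Ω ≃ₐ[F] Ω} : σ ∈ absUpperGroup F Ω s ↔
    ∀ K : FiniteGaloisIntermediateField F Ω,
      AlgEquiv.restrictNormalHom K σ ∈ upperGroup F K s := by
  simp [absUpperGroup, Subgroup.mem_iInf]

/-- The groups `G_F^s` surject onto their finite counterparts. -/
lemma exists_mem_absUpperGroup {s : ℝ} (hs : -1 < s) (K : FiniteGaloisIntermediateField F Ω)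
    {q : K ≃ₐ[F] K} (hq : q ∈ upperGroup F K s) :
    ∃ σ ∈ absUpperGroup F Ω s, AlgEquiv.restrictNormalHom K σ = q := by
  obtain ⟨σ, h1, h2⟩ := exists_lift_of_compatible (fun K => upperGroup F K s) (fun K L h q => by
    let _ : Algebra K L := (IntermediateField.inclusion h).toAlgebra
    have : IsScalarTower F K L := IsScalarTower.of_algebraMap_eq fun x => rfl
    rw [mem_upperGroup_iff_exists (L := L) hs]
    refine exists_congr fun g => and_congr_right fun _ => ?_
    have hcomm : ∀ x : K, (((AlgEquiv.restrictNormalHom K g : K ≃ₐ[F] K) x : K) : Ω) =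
      (g (IntermediateField.inclusion h x) : L) := fun x =>
        congrArg (Subtype.val : L → Ω) (AlgEquiv.restrictNormal_commutes g K x)
    constructor
    · rintro rfl x
      exact (hcomm x).symm
    · intro hx
      ext x
      rw [hcomm, hx]) K hq
  exact ⟨σ, mem_absUpperGroup_iff.2 h2, h1⟩

lemma absUpperGroup_of_nonpos {s : ℝ} (h1 : -1 < s) (h2 : s ≤ 0) :
    absUpperGroup F Ω s = absInertia F Ω := by
  ext σ
  rw [mem_absUpperGroup_iff, mem_absInertia_iff]
  simp_rw [upperGroup_of_nonpos h1 h2]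

lemma absUpperGroup_le_absInertia {s : ℝ} (hs : -1 < s) :
    absUpperGroup F Ω s ≤ absInertia F Ω := fun σ hσ => by
  rw [mem_absInertia_iff]
  rw [mem_absUpperGroup_iff] at hσ
  exact fun K => upperGroup_le_lowerGroup_zero hs (hσ K)

/-- The inertia group surjects onto its finite counterparts. -/
lemma exists_mem_absInertia (K : FiniteGaloisIntermediateField F Ω)
    {q : K ≃ₐ[F] K} (hq : q ∈ lowerGroup F K 0) :
    ∃ σ ∈ absInertia F Ω, AlgEquiv.restrictNormalHom K σ = q := by
  rw [← upperGroup_of_nonpos (s := 0) (by norm_num) le_rfl] at hq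
  rw [← absUpperGroup_of_nonpos (s := 0) (by norm_num) le_rfl]
  exact exists_mem_absUpperGroup (by norm_num) K hq

/-! ### The integral of the codimension of the fixed spaces -/

lemma absInertia_le_weilSubgroup : absInertia F Ω ≤ weilSubgroup F Ω := fun σ hσ =>
  ⟨0, 0, fun x => by simpa using hσ x⟩

lemma exists_weil_eq {σ : Ω ≃ₐ[F] Ω} (hσ : σ ∈ absInertia F Ω) :
    ∃ w ∈ inertia F Ω, WeilGroup.incl F Ω w = σ :=
  ⟨⟨σ, absInertia_le_weilSubgroup hσ⟩, hσ, rfl⟩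

lemma upperSet_subset_inertia {s : ℝ} (hs : -1 < s) :
    upperSet F Ω s ⊆ inertia F Ω := fun _ hw => absUpperGroup_le_absInertia hs hw

lemma upperSet_of_nonpos {s : ℝ} (h1 : -1 < s) (h2 : s ≤ 0) :
    upperSet F Ω s = inertia F Ω := by
  ext w
  change WeilGroup.incl F Ω w ∈ absUpperGroup F Ω s ↔ _
  rw [absUpperGroup_of_nonpos h1 h2]
  rfl

lemma lowerSet_zero (K : FiniteGaloisIntermediateField F Ω) :
    lowerSet K 0 = (inertia F Ω : Set (WeilGroup F Ω)) := by
  ext w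
  refine ⟨fun h => h.1, fun h => ⟨h, ?_⟩⟩
  rw [Nat.cast_zero]
  exact mem_absInertia_iff.1 h K

variable {E : Type*} [Field E] {V : Type*} [AddCommGroup V] [Module E V]
  {ρ : Representation E (WeilGroup F Ω) V}

lemma codimFixed_congr {G : Type*} [Group G] {ρ ρ' : Representation E G V} {S T : Set G}
    (h : fixedBy ρ S = fixedBy ρ' T) : codimFixed ρ S = codimFixed ρ' T := by
  rw [codimFixed, codimFixed, h]

/-- The group `G_F^s` maps onto `Gal(K/F)^s`, which is `G_i` in this range of `s`. -/
lemma fixedBy_upperSet_eq {K : FiniteGaloisIntermediateField F Ω} (hρ : FactorsThrough ρ K)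
    {i : ℕ} {s : ℝ} (h1 : herbrandPhi F K ((i : ℝ) - 1) < s) (h2 : s ≤ herbrandPhi F K i) :
    fixedBy ρ (upperSet F Ω s) = fixedBy ρ (lowerSet K i) := by
  have hi : (-1 : ℝ) ≤ (i : ℝ) - 1 := by have : (0 : ℝ) ≤ i := Nat.cast_nonneg i; linarith
  have hs : -1 < s := by
    rw [← herbrandPhi_neg_one (F := F) (K := K)]
    exact (herbrandPhi_strictMonoOn.monotoneOn Set.self_mem_Ici hi hi).trans_lt h1
  have hupper := upperGroup_eq_lowerGroup h1 h2
  apply le_antisymm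
  · intro v hv w hw
    obtain ⟨σ, hσ, hσq⟩ := exists_mem_absUpperGroup hs K (q := restrictTo K w)
      (by rw [hupper]; exact hw.2)
    obtain ⟨w', hw', rfl⟩ := exists_weil_eq (absUpperGroup_le_absInertia hs hσ)
    have h3 : ρ (w'⁻¹ * w) = 1 := hρ _ (mul_mem (inv_mem hw') hw.1) (by
      rw [map_mul, map_inv, inv_mul_eq_one]
      exact hσq)
    have h4 : w = w' * (w'⁻¹ * w) := by group
    rw [h4, map_mul, h3, mul_one]
    exact hv w' hσ
  · intro v hv w hw
    refine hv w ⟨upperSet_subset_inertia hs hw, ?_⟩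
    rw [← hupper]
    exact mem_absUpperGroup_iff.1 hw K

lemma exists_herbrandPhi_lt_le (K : FiniteGaloisIntermediateField F Ω) {s : ℝ} (hs : -1 < s) :
    ∃ i : ℕ, herbrandPhi F K ((i : ℝ) - 1) < s ∧ s ≤ herbrandPhi F K i := by
  have h0 := neg_one_lt_herbrandPsi (F := F) (K := K) hs
  set r := herbrandPsi F K s with hr
  have hc : (0 : ℤ) ≤ ⌈r⌉ := by
    have : (-1 : ℤ) < ⌈r⌉ := Int.lt_ceil.2 (by simpa using h0)
    omega
  obtain ⟨i, hi⟩ := Int.eq_ofNat_of_zero_le hc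
  have h1 : (i : ℝ) - 1 < r ∧ r ≤ i := by
    have := Int.ceil_eq_iff.1 hi
    simpa using this
  have hi0 : (0 : ℝ) ≤ i := Nat.cast_nonneg i
  have h2 := herbrandPhi_herbrandPsi (F := F) (K := K) hs.le
  rw [← hr] at h2
  refine ⟨i, ?_, ?_⟩
  · rw [← h2]
    exact herbrandPhi_strictMonoOn (by simp) h0.le h1.1
  · rw [← h2]
    exact herbrandPhi_strictMonoOn.monotoneOn h0.le (by simp; linarith) h1.2

variable (ρ) in
lemma exists_codimFixed_lowerSet_eq_zero {K : FiniteGaloisIntermediateField F Ω}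
    (hρ : FactorsThrough ρ K) : ∃ N : ℕ, ∀ i, N ≤ i → codimFixed ρ (lowerSet K i) = 0 := by
  obtain ⟨N, hN⟩ := exists_lowerGroup_eq_bot (F := F) (K := K)
  refine ⟨N, fun i hi => ?_⟩
  have : fixedBy ρ (lowerSet K i) = ⊤ := by
    rw [eq_top_iff]
    intro v _ w hw
    have h1 : restrictTo K w = 1 := by
      have := lowerGroup_antitone (F := F) (K := K) (Nat.cast_le (α := ℝ).2 hi) hw.2
      rwa [hN, Subgroup.mem_bot] at this
    rw [hρ w hw.1 h1]
    rfl
  rw [codimFixed, this]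
  exact Module.finrank_zero_of_subsingleton

/-- The Swan conductor as an integral over the upper numbering filtration: the integrand is a step
function, with the value `codim V^{G_i}` on an interval of length `1 / [G_0 : G_i]` for each `i`. -/
lemma integral_codimFixed {K : FiniteGaloisIntermediateField F Ω} (hρ : FactorsThrough ρ K) :
    IntegrableOn (fun s : ℝ => (codimFixed ρ (upperSet F Ω s) : ℝ)) (Set.Ioi 0) ∧
      ∫ s in Set.Ioi (0 : ℝ), (codimFixed ρ (upperSet F Ω s) : ℝ) = swanSum ρ K ∧
      artinSum ρ K = codimFixed ρ (inertia F Ω) + swanSum ρ K := by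
  obtain ⟨N, hN⟩ := exists_codimFixed_lowerSet_eq_zero ρ hρ
  set c : ℕ → ℝ := fun i => codimFixed ρ (lowerSet K i) with hc
  set f : ℝ → ℝ := fun s => codimFixed ρ (upperSet F Ω s) with hf
  have hstep : ∀ (i : ℕ) (s : ℝ), herbrandPhi F K ((i : ℝ) - 1) < s → s ≤ herbrandPhi F K i →
      f s = c i := fun i s h1 h2 => by
    simp only [hf, hc]
    rw [codimFixed_congr (fixedBy_upperSet_eq hρ h1 h2)]
  let a : ℕ → ℝ := fun i => herbrandPhi F K i
  have hlt : ∀ i, a i ≤ a (i + 1) := fun i =>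
    herbrandPhi_strictMonoOn.monotoneOn (by simp; linarith [Nat.cast_nonneg (α := ℝ) i])
      (by simp; linarith [Nat.cast_nonneg (α := ℝ) i]) (by simp)
  have hcongr : ∀ i, Set.EqOn (fun _ => c (i + 1)) f (Set.Ioc (a i) (a (i + 1))) := fun i s hs =>
    (hstep (i + 1) s (by rw [Nat.cast_add_one, add_sub_cancel_right]; exact hs.1) hs.2).symm
  have hint : ∀ i, IntervalIntegrable f volume (a i) (a (i + 1)) := fun i => by
    rw [intervalIntegrable_iff_integrableOn_Ioc_of_le (hlt i)]
    exact (integrableOn_const (by simp)).congr_fun (hcongr i) measurableSet_Ioc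
  have hval : ∀ i, ∫ s in a i..a (i + 1), f s = c (i + 1) / lowerIndex F K (i + 1 : ℕ) := fun i => by
    rw [intervalIntegral.integral_of_le (hlt i), ← setIntegral_congr_fun measurableSet_Ioc (hcongr i),
      ← intervalIntegral.integral_of_le (hlt i), intervalIntegral.integral_const]
    have := herbrandPhi_natCast_sub (F := F) (K := K) (i + 1)
    rw [show (((i + 1 : ℕ) : ℝ) - 1) = i by push_cast; ring] at this
    rw [show a (i + 1) - a i = _ from this, smul_eq_mul]
    ring
  have ha0 : a 0 = 0 := by simp [a, herbrandPhi_zero]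
  have hmono : Monotone a := monotone_nat_of_le_succ hlt
  have hI : IntervalIntegrable f volume 0 (a N) := by
    rw [← ha0]
    exact IntervalIntegrable.trans_iterate fun k _ => hint k
  have h0N : 0 ≤ a N := by rw [← ha0]; exact hmono (Nat.zero_le N)
  have hzero : ∀ s ∈ Set.Ioi (a N), (0 : ℝ) = f s := by
    intro s hs
    obtain ⟨i, h1, h2⟩ := exists_herbrandPhi_lt_le K (s := s) (by
      have : a N < s := hs
      linarith)
    rw [hstep i s h1 h2]
    have hNi : N ≤ i := by
      by_contra! hlt'
      exact absurd (h2.trans (hmono hlt'.le)) (not_le.2 hs)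
    simp only [hc, hN i hNi, Nat.cast_zero]
  have hunion : Set.Ioi (0 : ℝ) = Set.Ioc 0 (a N) ∪ Set.Ioi (a N) :=
    (Set.Ioc_union_Ioi_eq_Ioi h0N).symm
  have hI1 : IntegrableOn f (Set.Ioc 0 (a N)) :=
    (intervalIntegrable_iff_integrableOn_Ioc_of_le h0N).1 hI
  have hI2 : IntegrableOn f (Set.Ioi (a N)) :=
    integrableOn_zero.congr_fun hzero measurableSet_Ioi
  have hswan : swanSum ρ K = ∑ i ∈ Finset.range N, c (i + 1) / lowerIndex F K (i + 1 : ℕ) := by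
    refine finsum_eq_sum_of_support_subset _ fun i hi => ?_
    by_contra h
    rw [Finset.coe_range, Set.mem_Iio, not_lt] at h
    exact hi (by simp [hN (i + 1) (h.trans (Nat.le_succ i))])
  refine ⟨by rw [hunion]; exact hI1.union hI2, ?_, ?_⟩
  · rw [hunion, setIntegral_union (Set.Ioc_disjoint_Ioi le_rfl) measurableSet_Ioi hI1 hI2,
      ← setIntegral_congr_fun measurableSet_Ioi hzero, integral_zero, add_zero,
      ← intervalIntegral.integral_of_le h0N, ← ha0,
      ← intervalIntegral.sum_integral_adjacent_intervals fun k _ => hint k, hswan]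
    exact Finset.sum_congr rfl fun i _ => hval i
  · have : artinSum ρ K = ∑ i ∈ Finset.range (N + 1), c i / lowerIndex F K i := by
      refine finsum_eq_sum_of_support_subset _ fun i hi => ?_
      by_contra h
      rw [Finset.coe_range, Set.mem_Iio, not_lt] at h
      exact hi (by simp [hN i ((Nat.le_succ N).trans h)])
    rw [this, hswan, Finset.sum_range_succ', add_comm, Nat.cast_zero, lowerIndex_of_nonpos le_rfl,
      Nat.cast_one, div_one]
    simp only [hc, lowerSet_zero]

end Absolute

/-! ### The Weil group -/

section WeilGroupFacts

open IsLocalRing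

variable {F : Type*} [Field F] [ValuativeRel F] [TopologicalSpace F] [IsNonarchimedeanLocalField F]

lemma exists_residueCard_eq (F : Type*) [Field F] [ValuativeRel F] [TopologicalSpace F]
    [IsNonarchimedeanLocalField F] : ∃ f : ℕ, f ≠ 0 ∧ residueCard F = ringChar 𝓀[F] ^ f := by
  have := Fintype.ofFinite 𝓀[F]
  obtain ⟨f, -, hf⟩ := FiniteField.card 𝓀[F] (ringChar 𝓀[F])
  exact ⟨f, f.ne_zero, by rw [residueCard, Nat.card_eq_fintype_card, hf]⟩

lemma one_lt_residueCard (F : Type*) [Field F] [ValuativeRel F] [TopologicalSpace F]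
    [IsNonarchimedeanLocalField F] : 1 < residueCard F := by
  have : Nontrivial 𝓀[F] := inferInstance
  exact Finite.one_lt_card

variable {Ω : Type*} [Field Ω] [Algebra F Ω] [IsGalois F Ω]

lemma residue_eq_iff {x y : integers F Ω} :
    residue (integers F Ω) x = residue (integers F Ω) y ↔ x - y ∈ maxIdeal F Ω := by
  rw [absMaxIdeal_eq, ← residue_eq_zero_iff, map_sub, sub_eq_zero]

lemma actsAsFrobenius_iff {σ : Ω ≃ₐ[F] Ω} {a b : ℕ} : ActsAsFrobenius σ a b ↔
    ∀ x : integers F Ω, residue (integers F Ω) (σ • x) ^ residueCard F ^ a =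
      residue (integers F Ω) x ^ residueCard F ^ b := by
  refine forall_congr' fun x => ?_
  rw [← map_pow, ← map_pow, residue_eq_iff]

instance charP_residueField : CharP (ResidueField (integers F Ω)) (ringChar 𝓀[F]) := by
  rw [CharP.charP_iff_prime_eq_zero (ringChar_residue_prime F)]
  have h := residueChar_mem (F := F) (K := (⊥ : FiniteGaloisIntermediateField F Ω))
  rw [← maxIdeal_eq] at h
  have h2 := integersIncl_mem_iff.2 h
  rw [map_natCast, absMaxIdeal_eq, ← residue_eq_zero_iff, map_natCast] at h2
  exact h2

lemma mem_absInertia_of_actsAsFrobenius {σ : Ω ≃ₐ[F] Ω} {a : ℕ} (h : ActsAsFrobenius σ a a) :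
    σ ∈ absInertia F Ω := by
  have := Fact.mk (ringChar_residue_prime F)
  obtain ⟨f, -, hf⟩ := exists_residueCard_eq F
  rw [actsAsFrobenius_iff, hf] at h
  intro x
  change σ • x - x ∈ maxIdeal F Ω
  rw [← residue_eq_iff, ← sub_eq_zero, ← pow_eq_zero_iff (n := (ringChar 𝓀[F] ^ f) ^ a)
    (pow_ne_zero _ (pow_ne_zero _ (ringChar_residue_prime F).ne_zero)), ← pow_mul, sub_pow_char_pow,
    pow_mul, h x, sub_self]

/-- Roots of unity of order prime to the residue characteristic are distinct in the residue
field. -/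
lemma eq_one_of_residue_eq_one {m : ℕ} (hm : m.Coprime (ringChar 𝓀[F])) {ζ : integers F Ω}
    (hζ : ζ ^ m = 1) (h : residue (integers F Ω) ζ = 1) : ζ = 1 := by
  have h1 : (ζ - 1) * ∑ i ∈ Finset.range m, ζ ^ i = 0 := by
    rw [mul_comm, geom_sum_mul, hζ, sub_self]
  rcases mul_eq_zero.1 h1 with h2 | h2
  · exact sub_eq_zero.1 h2
  · have h3 := congrArg (residue (integers F Ω)) h2
    rw [map_sum, map_zero] at h3
    simp only [map_pow, h, one_pow, Finset.sum_const, Finset.card_range, nsmul_eq_mul,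
      mul_one] at h3
    rw [CharP.cast_eq_zero_iff _ (ringChar 𝓀[F])] at h3
    have h4 := Nat.Coprime.eq_one_of_dvd (hm.symm) h3
    exact absurd h4 (ringChar_residue_prime F).ne_one

lemma eq_of_residue_eq {m : ℕ} (hm : m.Coprime (ringChar 𝓀[F])) {ζ ξ : Ω}
    (hζ : ζ ^ m = 1) (hξ : ξ ^ m = 1) (hζi : IsIntegral 𝒪[F] ζ) (hξi : IsIntegral 𝒪[F] ξ)
    (h : residue (integers F Ω) ⟨ζ, hζi⟩ = residue (integers F Ω) ⟨ξ, hξi⟩) : ζ = ξ := by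
  have hm0 : m ≠ 0 := by
    rintro rfl
    exact (ringChar_residue_prime F).ne_one (Nat.coprime_zero_left _ |>.1 hm)
  have hξ' : (⟨ξ, hξi⟩ : integers F Ω) ^ m = 1 := Subtype.ext hξ
  have hζ' : (⟨ζ, hζi⟩ : integers F Ω) ^ m = 1 := Subtype.ext hζ
  set z : integers F Ω := ⟨ζ, hζi⟩
  set x : integers F Ω := ⟨ξ, hξi⟩
  have hinv : x * x ^ (m - 1) = 1 := by
    rw [← pow_succ', Nat.sub_add_cancel (Nat.one_le_iff_ne_zero.2 hm0), hξ']
  have h1 := eq_one_of_residue_eq_one hm (ζ := z * x ^ (m - 1))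
    (by rw [mul_pow, hζ', one_mul, ← pow_mul, mul_comm, pow_mul, hξ', one_pow])
    (by rw [map_mul, h, ← map_mul, hinv, map_one])
  have h2 : z = x := by
    calc z = z * (x * x ^ (m - 1)) := by rw [hinv, mul_one]
      _ = (z * x ^ (m - 1)) * x := by ring
      _ = x := by rw [h1, one_mul]
  exact congrArg Subtype.val h2

lemma isIntegral_of_pow_eq_one {m : ℕ} (hm : m ≠ 0) {ζ : Ω} (hζ : ζ ^ m = 1) :
    IsIntegral 𝒪[F] ζ :=
  IsIntegral.of_pow (Nat.pos_of_ne_zero hm) (by rw [hζ]; exact isIntegral_one)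

/-- The action of the Weil group on roots of unity of order prime to the residue characteristic. -/
lemma ActsAsFrobenius.apply_rootOfUnity {σ : Ω ≃ₐ[F] Ω} {a b : ℕ} (h : ActsAsFrobenius σ a b)
    {m : ℕ} (hm : m.Coprime (ringChar 𝓀[F])) {ζ : Ω} (hζ : ζ ^ m = 1) :
    σ ζ ^ residueCard F ^ a = ζ ^ residueCard F ^ b := by
  have hm0 : m ≠ 0 := by
    rintro rfl
    exact (ringChar_residue_prime F).ne_one (Nat.coprime_zero_left _ |>.1 hm)
  have hσ : σ ζ ^ m = 1 := by rw [← map_pow, hζ, map_one]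
  have hi := isIntegral_of_pow_eq_one (F := F) hm0 hζ
  have hi' := isIntegral_of_pow_eq_one (F := F) hm0 hσ
  refine eq_of_residue_eq (F := F) hm ?_ ?_ (hi'.pow _) (hi.pow _) ?_
  · rw [← pow_mul, mul_comm, pow_mul, hσ, one_pow]
  · rw [← pow_mul, mul_comm, pow_mul, hζ, one_pow]
  · exact (map_pow (residue (integers F Ω)) (⟨σ ζ, hi'⟩ : integers F Ω) _).trans
      ((actsAsFrobenius_iff.1 h ⟨ζ, hi⟩).trans (map_pow _ _ _).symm)

variable [IsSepClosed Ω]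

omit [IsGalois F Ω] in
lemma natCast_ne_zero_of_coprime {m : ℕ} (hm : m.Coprime (ringChar 𝓀[F])) : (m : Ω) ≠ 0 := by
  intro h
  have hF : (m : F) = 0 := by
    apply (algebraMap F Ω).injective
    rw [map_natCast, h, map_zero]
  have hO : (m : 𝒪[F]) = 0 := Subtype.ext (by simpa using hF)
  have hk := congrArg (residue 𝒪[F]) hO
  rw [map_natCast, map_zero] at hk
  have h3 : ringChar 𝓀[F] ∣ m := (ringChar.spec 𝓀[F] m).1 hk
  exact (ringChar_residue_prime F).ne_one (Nat.Coprime.eq_one_of_dvd hm.symm h3)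

omit [IsGalois F Ω] in
lemma exists_isPrimitiveRoot {m : ℕ} (hm : m.Coprime (ringChar 𝓀[F])) :
    ∃ ζ : Ω, IsPrimitiveRoot ζ m := by
  have : NeZero (m : Ω) := ⟨natCast_ne_zero_of_coprime hm⟩
  exact HasEnoughRootsOfUnity.exists_primitiveRoot Ω m

/-- The power of Frobenius induced by an element of the Weil group is unique. -/
lemma ActsAsFrobenius.unique {σ : Ω ≃ₐ[F] Ω} {a b a' b' : ℕ} (h : ActsAsFrobenius σ a b)
    (h' : ActsAsFrobenius σ a' b') : b + a' = b' + a := by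
  have hp := ringChar_residue_prime F
  set q := residueCard F
  set m := (q ^ (b + a') + q ^ (b' + a)) * ringChar 𝓀[F] + 1
  have hm : m.Coprime (ringChar 𝓀[F]) := by
    simp only [m]
    rw [Nat.coprime_mul_right_add_left]
    exact Nat.coprime_one_left _
  obtain ⟨ζ, hζ⟩ := exists_isPrimitiveRoot (F := F) (Ω := Ω) hm
  have h1 : ζ ^ q ^ (b + a') = ζ ^ q ^ (b' + a) := by
    rw [pow_add, pow_mul, ← h.apply_rootOfUnity hm hζ.pow_eq_one, pow_add, pow_mul,
      ← h'.apply_rootOfUnity hm hζ.pow_eq_one, ← pow_mul, ← pow_mul, mul_comm]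
  have hlt : ∀ c d : ℕ, c ≤ d → c < d * ringChar 𝓀[F] + 1 := fun c d hcd => by
    have := Nat.le_mul_of_pos_right d hp.pos
    omega
  have h2 := hζ.pow_inj (hlt _ _ (Nat.le_add_right _ _)) (hlt _ _ (Nat.le_add_left _ _)) h1
  exact Nat.pow_right_injective (one_lt_residueCard F) h2

lemma weilNorm_eq {w : WeilGroup F Ω} {a b : ℕ} (h : ActsAsFrobenius (WeilGroup.incl F Ω w) a b) :
    weilNorm w = (residueCard F : ℚ) ^ ((b : ℤ) - a) := by
  have := h.unique w.2.choose_spec.choose_spec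
  rw [weilNorm]
  congr 1
  omega

lemma residueCard_ne_zero : (residueCard F : ℚ) ≠ 0 :=
  Nat.cast_ne_zero.2 (zero_lt_one.trans (one_lt_residueCard F)).ne'

lemma weilNorm_mul (v w : WeilGroup F Ω) : weilNorm (v * w) = weilNorm v * weilNorm w := by
  obtain ⟨a, b, h⟩ := v.2
  obtain ⟨a', b', h'⟩ := w.2
  have h2 : ActsAsFrobenius (WeilGroup.incl F Ω (v * w)) (a + a') (b + b') := by
    rw [actsAsFrobenius_iff] at *
    intro x
    rw [map_mul, mul_smul, pow_add, pow_mul]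
    have h3 := h (WeilGroup.incl F Ω w • x)
    have h4 := h' x
    rw [show WeilGroup.incl F Ω v = v.1 from rfl, h3, ← pow_mul, mul_comm, pow_mul,
      show WeilGroup.incl F Ω w = w.1 from rfl, h4, ← pow_mul, ← pow_add, add_comm]
  rw [weilNorm_eq h2, weilNorm_eq h, weilNorm_eq h', ← zpow_add₀ residueCard_ne_zero]
  congr 1
  push_cast
  ring

/-- The norm on the Weil group as a homomorphism. -/
def weilNormHom : WeilGroup F Ω →* ℚ where
  toFun := weilNorm
  map_one' := by
    rw [weilNorm_eq (a := 0) (b := 0) fun x => by simp]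
    simp
  map_mul' := weilNorm_mul

lemma weilNorm_one : weilNorm (1 : WeilGroup F Ω) = 1 := map_one weilNormHom

lemma weilNorm_inv (w : WeilGroup F Ω) : weilNorm w⁻¹ = (weilNorm w)⁻¹ :=
  eq_inv_of_mul_eq_one_left (by rw [← weilNorm_mul, inv_mul_cancel, weilNorm_one])

lemma weilNorm_zpow (w : WeilGroup F Ω) (m : ℤ) : weilNorm (w ^ m) = weilNorm w ^ m :=
  map_zpow' weilNormHom weilNorm_inv w m

lemma mem_inertia_iff {w : WeilGroup F Ω} : w ∈ inertia F Ω ↔ weilNorm w = 1 := by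
  constructor
  · intro h
    have h1 : ActsAsFrobenius (WeilGroup.incl F Ω w) 0 0 := fun x => by simpa using h x
    rw [weilNorm_eq h1]
    simp
  · intro h
    obtain ⟨a, b, hab⟩ := w.2
    rw [weilNorm_eq hab] at h
    have hq : (1 : ℚ) < residueCard F := by exact_mod_cast one_lt_residueCard F
    have h0 : (b : ℤ) - a = 0 := by
      rw [← zpow_zero (residueCard F : ℚ)] at h
      exact zpow_right_injective₀ (by linarith) hq.ne' h
    have hb : b = a := by omega
    rw [hb] at hab
    exact mem_absInertia_of_actsAsFrobenius hab

instance inertia_normal : (inertia F Ω).Normal := ⟨fun n hn g => by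
  rw [mem_inertia_iff] at *
  rw [weilNorm_mul, weilNorm_mul, hn, mul_one, ← weilNorm_mul, mul_inv_cancel, weilNorm_one]⟩

lemma IsGeomFrobenius.weilNorm_eq {Φ : WeilGroup F Ω} (hΦ : IsGeomFrobenius Φ) :
    weilNorm Φ = (residueCard F : ℚ)⁻¹ := by
  rw [LocalConductor.weilNorm_eq hΦ]
  simp

/-- Every element of the Weil group is the product of a power of a Frobenius element and an element
of inertia. -/
lemma IsGeomFrobenius.exists_eq_mul {Φ : WeilGroup F Ω} (hΦ : IsGeomFrobenius Φ)
    (w : WeilGroup F Ω) : ∃ (m : ℤ) (σ : inertia F Ω), w = Φ ^ m * σ := by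
  obtain ⟨a, b, h⟩ := w.2
  refine ⟨(a : ℤ) - b, ⟨(Φ ^ ((a : ℤ) - b))⁻¹ * w, ?_⟩, by simp⟩
  rw [mem_inertia_iff, weilNorm_mul, weilNorm_inv, weilNorm_zpow, hΦ.weilNorm_eq,
    LocalConductor.weilNorm_eq (w := w) h, inv_zpow, inv_inv, ← zpow_add₀ residueCard_ne_zero]
  simp

omit [IsSepClosed Ω]

instance isInvariant_integers : Algebra.IsInvariant 𝒪[F] (integers F Ω) (Ω ≃ₐ[F] Ω) := by
  refine ⟨fun b hb => ?_⟩
  have h1 : (b : Ω) ∈ Set.range (algebraMap F Ω) :=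
    (InfiniteGalois.mem_range_algebraMap_iff_fixed (b : Ω)).2
      fun σ => congrArg Subtype.val (hb σ)
  obtain ⟨x, hx⟩ := h1
  have h2 : IsIntegral 𝒪[F] x := by
    have := b.2
    rw [← hx] at this
    exact (isIntegral_algebraMap_iff (algebraMap F Ω).injective).1 this
  obtain ⟨y, hy⟩ := IsIntegrallyClosed.isIntegral_iff.1 h2
  refine ⟨y, Subtype.ext ?_⟩
  rw [← hx, ← hy]
  rfl

instance liesOver_absMaxIdeal : (maximalIdeal (integers F Ω)).LiesOver (maximalIdeal 𝒪[F]) := by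
  have : ((maximalIdeal (integers F Ω)).under 𝒪[F]).IsMaximal :=
    Ideal.isMaximal_comap_of_isIntegral_of_isMaximal _
  exact ⟨(IsLocalRing.eq_maximalIdeal this).symm⟩

variable (F Ω) in
/-- The absolute Galois group maps onto the automorphism group of the residue field of `Ω`; the
inverse of a preimage of the `q`-power map is a geometric Frobenius element. -/
lemma exists_isGeomFrobenius : ∃ Φ : WeilGroup F Ω, IsGeomFrobenius Φ := by
  let _ : TopologicalSpace (integers F Ω) := ⊥
  have : DiscreteTopology (integers F Ω) := ⟨rfl⟩
  have : ContinuousSMul (Ω ≃ₐ[F] Ω) (integers F Ω) := by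
    rw [continuousSMul_iff_stabilizer_isOpen]
    intro x
    convert! stabilizer_isOpen_of_isIntegral (K := F) (x : Ω) using 1
    ext σ
    exact Subtype.ext_iff
  let P := maximalIdeal 𝒪[F]
  let Q := maximalIdeal (integers F Ω)
  let _ : Field (𝒪[F] ⧸ P) := Ideal.Quotient.field P
  let _ : Field (integers F Ω ⧸ Q) := Ideal.Quotient.field Q
  have hfin : Finite (𝒪[F] ⧸ P) := inferInstanceAs (Finite 𝓀[F])
  let _ := Fintype.ofFinite (𝒪[F] ⧸ P)
  have hint : Algebra.IsIntegral (𝒪[F] ⧸ P) (integers F Ω ⧸ Q) := inferInstance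
  have halg : Algebra.IsAlgebraic (𝒪[F] ⧸ P) (integers F Ω ⧸ Q) := hint.isAlgebraic
  obtain ⟨σ, hσ⟩ := Ideal.Quotient.stabilizerHom_surjective_of_profinite (G := Ω ≃ₐ[F] Ω) P Q
    (FiniteField.frobeniusAlgEquivOfAlgebraic (𝒪[F] ⧸ P) (integers F Ω ⧸ Q))
  have hfrob : ActsAsFrobenius σ.1 0 1 := by
    intro x
    rw [absMaxIdeal_eq, pow_zero, pow_one, pow_one, ← Ideal.Quotient.eq]
    have := DFunLike.congr_fun hσ (Ideal.Quotient.mk Q x)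
    rw [FiniteField.coe_frobeniusAlgEquivOfAlgebraic] at this
    rw [map_pow, residueCard]
    have hc : Nat.card 𝓀[F] = Fintype.card (𝒪[F] ⧸ P) := Nat.card_eq_fintype_card (α := 𝒪[F] ⧸ P)
    rw [hc]
    exact this
  let w : WeilGroup F Ω := ⟨σ.1, 0, 1, hfrob⟩
  refine ⟨w⁻¹, fun x => ?_⟩
  have h1 := hfrob (σ.1⁻¹ • x)
  rw [smul_inv_smul, pow_zero, pow_one, pow_one] at h1
  rw [pow_zero, pow_one, pow_one, ← neg_sub]
  exact neg_mem h1

/-! ### The topology of the Weil group -/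

lemma continuous_incl : Continuous (WeilGroup.incl F Ω) :=
  continuous_iff_le_induced.2 inf_le_left

lemma isOpen_setOf_mk_eq (g : WeilGroup F Ω) : IsOpen {w : WeilGroup F Ω | g⁻¹ * w ∈ inertia F Ω} := by
  have h : @Continuous _ _ _ ⊥ (QuotientGroup.mk : WeilGroup F Ω → WeilGroup F Ω ⧸ inertia F Ω) :=
    continuous_iff_le_induced.2 inf_le_right
  have h1 := @IsOpen.preimage _ _ _ ⊥ _ h {(g : WeilGroup F Ω ⧸ inertia F Ω)} trivial
  convert! h1 using 1
  ext w
  exact (QuotientGroup.eq (s := inertia F Ω)).symm.trans eq_comm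

lemma isOpen_setOf_restrictTo_eq (K : FiniteGaloisIntermediateField F Ω) (q : K ≃ₐ[F] K) :
    IsOpen {w : WeilGroup F Ω | restrictTo K w = q} := by
  have h1 := krullTopology_discreteTopology_of_finiteDimensional F K
  exact (isOpen_discrete {q}).preimage ((InfiniteGalois.restrictNormalHom_continuous
    K.toIntermediateField).comp continuous_incl)

/-- A set stable under right multiplication by the open subgroup of inertia acting trivially on `K`
is open. -/
lemma isOpen_of_forall_mul_mem (K : FiniteGaloisIntermediateField F Ω) {U : Set (WeilGroup F Ω)}
    (h : ∀ g ∈ U, ∀ w ∈ inertia F Ω, restrictTo K w = 1 → g * w ∈ U) : IsOpen U := by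
  have : U = ⋃ g ∈ U, ({w | g⁻¹ * w ∈ inertia F Ω} ∩ {w | restrictTo K w = restrictTo K g}) := by
    ext w
    simp only [Set.mem_iUnion, exists_prop]
    constructor
    · intro hw
      exact ⟨w, hw, by simp [one_mem], rfl⟩
    · rintro ⟨g, hg, h1, h2⟩
      have h2' : restrictTo K w = restrictTo K g := h2
      have := h g hg (g⁻¹ * w) h1 (by rw [map_mul, map_inv, h2', inv_mul_cancel])
      rwa [mul_inv_cancel_left] at this
  rw [this]
  exact isOpen_biUnion fun g _ => (isOpen_setOf_mk_eq g).inter (isOpen_setOf_restrictTo_eq K _)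

/-- The kernels of restriction to `Gal(K/F)` on inertia are a basis of neighbourhoods of `1`. -/
lemma exists_forall_mem_of_mem_nhds_one {U : Set (WeilGroup F Ω)} (hU : U ∈ nhds 1) :
    ∃ K : FiniteGaloisIntermediateField F Ω,
      ∀ w ∈ inertia F Ω, restrictTo K w = 1 → w ∈ U := by
  have hinf : nhds (1 : WeilGroup F Ω) =
      @nhds _ (TopologicalSpace.induced (WeilGroup.incl F Ω) inferInstance) 1 ⊓
      @nhds _ (TopologicalSpace.induced
        (QuotientGroup.mk : WeilGroup F Ω → WeilGroup F Ω ⧸ inertia F Ω) ⊥) 1 :=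
    nhds_inf (t₁ := TopologicalSpace.induced (WeilGroup.incl F Ω) inferInstance)
      (t₂ := TopologicalSpace.induced
        (QuotientGroup.mk : WeilGroup F Ω → WeilGroup F Ω ⧸ inertia F Ω) ⊥) (a := 1)
  rw [hinf, Filter.mem_inf_iff] at hU
  obtain ⟨A, hA, B, hB, rfl⟩ := hU
  rw [mem_nhds_induced] at hA
  obtain ⟨u, hu, huA⟩ := hA
  have hu' : u ∈ nhds (1 : Ω ≃ₐ[F] Ω) := by rwa [map_one] at hu
  obtain ⟨K, hK⟩ := (InfiniteGalois.krullTopology_mem_nhds_one_iff_of_isGalois u).1 hu'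
  refine ⟨K, fun w hw h => ⟨huA (hK ?_), ?_⟩⟩
  · intro x
    exact (restrictNormalHom_eq_one_iff K _).1 h x x.2
  · rw [@mem_nhds_induced _ _ ⊥] at hB
    obtain ⟨v, hv, hvB⟩ := hB
    refine hvB ?_
    have h1 : ((1 : WeilGroup F Ω) : WeilGroup F Ω ⧸ inertia F Ω) ∈ v :=
      @mem_of_mem_nhds _ ⊥ _ _ hv
    have h2 : ((1 : WeilGroup F Ω) : WeilGroup F Ω ⧸ inertia F Ω) = w :=
      QuotientGroup.eq.2 (by simpa using hw)
    rw [h2] at h1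
    exact h1

end WeilGroupFacts

/-! ### Congruence subgroups of `GL_n` over an `ℓ`-adic field -/

section Congruence

variable {E : Type*} [NormedField E] [IsUltrametricDist E] {n : ℕ}

/-- All entries of the matrix have norm at most `r`. -/
def EntriesLE (r : ℝ) (x : Matrix (Fin n) (Fin n) E) : Prop := ∀ i j, ‖x i j‖ ≤ r

lemma EntriesLE.mono {r s : ℝ} (h : r ≤ s) {x : Matrix (Fin n) (Fin n) E} (hx : EntriesLE r x) :
    EntriesLE s x := fun i j => (hx i j).trans h

lemma EntriesLE.add {r : ℝ} {x y : Matrix (Fin n) (Fin n) E} (hx : EntriesLE r x)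
    (hy : EntriesLE r y) : EntriesLE r (x + y) := fun i j =>
  (IsUltrametricDist.norm_add_le_max _ _).trans (max_le (hx i j) (hy i j))

lemma EntriesLE.mul {r s : ℝ} (hr : 0 ≤ r) (hs : 0 ≤ s) {x y : Matrix (Fin n) (Fin n) E}
    (hx : EntriesLE r x) (hy : EntriesLE s y) : EntriesLE (r * s) (x * y) := fun i j => by
  rw [Matrix.mul_apply]
  refine IsUltrametricDist.norm_sum_le_of_forall_le_of_nonneg (mul_nonneg hr hs) fun k _ => ?_
  rw [norm_mul]
  exact mul_le_mul (hx i k) (hy k j) (norm_nonneg _) hr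

lemma entriesLE_one : EntriesLE 1 (1 : Matrix (Fin n) (Fin n) E) := fun i j => by
  rw [Matrix.one_apply]
  split_ifs <;> simp

lemma entriesLE_zero {r : ℝ} (hr : 0 ≤ r) : EntriesLE r (0 : Matrix (Fin n) (Fin n) E) :=
  fun i j => by simpa using hr

lemma EntriesLE.of_sub_one {r : ℝ} (hr : r ≤ 1) {x : Matrix (Fin n) (Fin n) E}
    (hx : EntriesLE r (x - 1)) : EntriesLE 1 x := by
  have := (hx.mono hr).add entriesLE_one
  rwa [sub_add_cancel] at this

lemma EntriesLE.mul_sub_one {r : ℝ} (hr0 : 0 ≤ r) (hr : r ≤ 1) {x y : Matrix (Fin n) (Fin n) E}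
    (hx : EntriesLE r (x - 1)) (hy : EntriesLE r (y - 1)) : EntriesLE r (x * y - 1) := by
  have h1 := EntriesLE.mul hr0 zero_le_one hx (hy.of_sub_one hr)
  rw [mul_one] at h1
  have h2 := h1.add hy
  convert h2 using 1
  noncomm_ring

lemma norm_natCast_pow_mem (ℓ m : ℕ) : 0 ≤ ‖(ℓ : E)‖ ^ m ∧ ‖(ℓ : E)‖ ^ m ≤ 1 :=
  ⟨pow_nonneg (norm_nonneg _) _,
    pow_le_one₀ (norm_nonneg _) (IsUltrametricDist.norm_natCast_le_one E ℓ)⟩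

variable (E n) in
/-- The subgroup of matrices congruent to the identity modulo `ℓ ^ m`. The same condition on the
inverse makes it a subgroup for trivial reasons. -/
def congruenceSubgroup (ℓ m : ℕ) : Subgroup (Matrix.GeneralLinearGroup (Fin n) E) where
  carrier := {g | EntriesLE (‖(ℓ : E)‖ ^ m) (g.1 - 1) ∧ EntriesLE (‖(ℓ : E)‖ ^ m) (g⁻¹.1 - 1)}
  one_mem' := by
    have h := entriesLE_zero (n := n) (E := E) (norm_natCast_pow_mem (E := E) ℓ m).1
    constructor <;> simpa using h
  mul_mem' := by
    rintro g h ⟨h1, h2⟩ ⟨h3, h4⟩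
    obtain ⟨h5, h6⟩ := norm_natCast_pow_mem (E := E) ℓ m
    refine ⟨EntriesLE.mul_sub_one h5 h6 h1 h3, ?_⟩
    have := EntriesLE.mul_sub_one h5 h6 h4 h2
    rw [mul_inv_rev]
    exact this
  inv_mem' := by
    rintro g ⟨h1, h2⟩
    exact ⟨h2, by rwa [inv_inv]⟩

variable {ℓ : ℕ}

lemma mem_congruenceSubgroup {m : ℕ} {g : Matrix.GeneralLinearGroup (Fin n) E} :
    g ∈ congruenceSubgroup E n ℓ m ↔
      EntriesLE (‖(ℓ : E)‖ ^ m) (g.1 - 1) ∧ EntriesLE (‖(ℓ : E)‖ ^ m) (g⁻¹.1 - 1) := Iff.rfl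

/-- As `x ^ ℓ - 1 = (1 + x + ... + x ^ (ℓ - 1)) (x - 1)` and the first factor is congruent to `ℓ`,
raising to the `ℓ`-th power goes one step down in the congruence filtration. -/
lemma entriesLE_pow_sub_one {r : ℝ} (hr0 : 0 ≤ r) (hr : r ≤ ‖(ℓ : E)‖)
    {x : Matrix (Fin n) (Fin n) E} (hx : EntriesLE r (x - 1)) :
    EntriesLE (‖(ℓ : E)‖ * r) (x ^ ℓ - 1) := by
  have hl1 := IsUltrametricDist.norm_natCast_le_one E ℓ
  have h1 : ∀ i : ℕ, EntriesLE r (x ^ i - 1) := by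
    intro i
    induction i with
    | zero => simpa using entriesLE_zero hr0
    | succ i ih =>
      rw [pow_succ]
      exact ih.mul_sub_one hr0 (hr.trans hl1) hx
  have h2 : ∀ k : ℕ, EntriesLE r (∑ i ∈ Finset.range k, (x ^ i - 1)) := by
    intro k
    induction k with
    | zero => simpa using entriesLE_zero hr0
    | succ k ih =>
      rw [Finset.sum_range_succ]
      exact ih.add (h1 k)
  have h3 : EntriesLE ‖(ℓ : E)‖ ((ℓ : Matrix (Fin n) (Fin n) E)) := by
    intro i j
    rw [Matrix.natCast_apply]
    split_ifs <;> simp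
  have h4 : EntriesLE ‖(ℓ : E)‖ (∑ i ∈ Finset.range ℓ, x ^ i) := by
    have := ((h2 ℓ).mono hr).add h3
    rw [Finset.sum_sub_distrib] at this
    simpa using this
  rw [← geom_sum_mul]
  exact EntriesLE.mul (norm_nonneg _) hr0 h4 hx

lemma pow_mem_congruenceSubgroup {m : ℕ} (hm : 1 ≤ m) {g : Matrix.GeneralLinearGroup (Fin n) E}
    (hg : g ∈ congruenceSubgroup E n ℓ m) : g ^ ℓ ∈ congruenceSubgroup E n ℓ (m + 1) := by
  obtain ⟨h5, -⟩ := norm_natCast_pow_mem (E := E) ℓ m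
  have h6 : ‖(ℓ : E)‖ ^ m ≤ ‖(ℓ : E)‖ :=
    pow_le_of_le_one (norm_nonneg _) (IsUltrametricDist.norm_natCast_le_one E ℓ) (by omega)
  rw [mem_congruenceSubgroup, pow_succ', ← inv_pow]
  exact ⟨entriesLE_pow_sub_one h5 h6 hg.1, entriesLE_pow_sub_one h5 h6 hg.2⟩

lemma pow_pow_mem_congruenceSubgroup {g : Matrix.GeneralLinearGroup (Fin n) E}
    (hg : g ∈ congruenceSubgroup E n ℓ 1) (k : ℕ) :
    g ^ ℓ ^ k ∈ congruenceSubgroup E n ℓ (k + 1) := by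
  induction k with
  | zero => simpa using hg
  | succ k ih =>
    rw [pow_succ, pow_mul]
    exact pow_mem_congruenceSubgroup (Nat.le_add_left 1 k) ih

lemma congruenceSubgroup_antitone : Antitone (congruenceSubgroup E n ℓ) := by
  intro m k h g hg
  have : ‖(ℓ : E)‖ ^ k ≤ ‖(ℓ : E)‖ ^ m :=
    pow_le_pow_of_le_one (norm_nonneg _) (IsUltrametricDist.norm_natCast_le_one E ℓ) h
  exact ⟨hg.1.mono this, hg.2.mono this⟩

lemma zpow_mem_congruenceSubgroup {g : Matrix.GeneralLinearGroup (Fin n) E}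
    (hg : g ∈ congruenceSubgroup E n ℓ 1) {k : ℕ} {a : ℤ} (ha : ((ℓ ^ k : ℕ) : ℤ) ∣ a) :
    g ^ a ∈ congruenceSubgroup E n ℓ k := by
  obtain ⟨b, rfl⟩ := ha
  rw [zpow_mul, zpow_natCast]
  exact zpow_mem (congruenceSubgroup_antitone (Nat.le_succ k)
    (pow_pow_mem_congruenceSubgroup hg k)) b

/-- The first congruence subgroup is pro-`ℓ`, so that powers prime to `ℓ` do not change the step of
the filtration. -/
lemma mem_congruenceSubgroup_of_pow_mem {g : Matrix.GeneralLinearGroup (Fin n) E}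
    (hg : g ∈ congruenceSubgroup E n ℓ 1) {k a : ℕ} (ha : a.Coprime ℓ)
    (h : g ^ a ∈ congruenceSubgroup E n ℓ k) : g ∈ congruenceSubgroup E n ℓ k := by
  have h1 := congruenceSubgroup_antitone (Nat.le_succ k) (pow_pow_mem_congruenceSubgroup hg k)
  have h2 : IsCoprime (a : ℤ) ((ℓ ^ k : ℕ) : ℤ) := Nat.isCoprime_iff_coprime.2 (ha.pow_right k)
  obtain ⟨u, v, huv⟩ := h2
  rw [← zpow_one g, ← huv, zpow_add, mul_comm u, mul_comm v, zpow_mul, zpow_mul, zpow_natCast,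
    zpow_natCast]
  exact mul_mem (zpow_mem h u) (zpow_mem h1 v)

lemma eq_one_of_forall_mem_congruenceSubgroup (hℓ : ‖(ℓ : E)‖ < 1)
    {g : Matrix.GeneralLinearGroup (Fin n) E} (hg : ∀ m, g ∈ congruenceSubgroup E n ℓ m) :
    g = 1 := by
  ext i j
  rw [← sub_eq_zero, ← norm_le_zero_iff]
  exact ge_of_tendsto' (tendsto_pow_atTop_nhds_zero_of_lt_one (norm_nonneg _) hℓ)
    fun m => (hg m).1 i j

lemma congruenceSubgroup_mem_nhds_one (hℓ : (ℓ : E) ≠ 0) (m : ℕ) :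
    (congruenceSubgroup E n ℓ m : Set (Matrix.GeneralLinearGroup (Fin n) E)) ∈ nhds 1 := by
  have hpos : 0 < ‖(ℓ : E)‖ ^ m := pow_pos (norm_pos_iff.2 hℓ) m
  have h1 : {x : Matrix (Fin n) (Fin n) E | EntriesLE (‖(ℓ : E)‖ ^ m) (x - 1)} ∈ nhds 1 := by
    have : {x : Matrix (Fin n) (Fin n) E | EntriesLE (‖(ℓ : E)‖ ^ m) (x - 1)} =
        ⋂ i, ⋂ j, {x | ‖(x - 1) i j‖ ≤ ‖(ℓ : E)‖ ^ m} := by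
      ext x
      simp [EntriesLE, Set.mem_iInter]
    rw [this, Filter.iInter_mem]
    intro i
    rw [Filter.iInter_mem]
    intro j
    have hc : Continuous fun x : Matrix (Fin n) (Fin n) E => ‖(x - 1) i j‖ := by
      refine continuous_norm.comp ?_
      exact ((continuous_id.sub continuous_const).matrix_elem i j)
    refine (hc.tendsto 1).eventually_le_const ?_
    simpa using hpos
  have h2 : Filter.Tendsto (fun g : Matrix.GeneralLinearGroup (Fin n) E => g.1) (nhds 1)
    (nhds 1) := Units.continuous_val.tendsto 1
  have h3 : Filter.Tendsto (fun g : Matrix.GeneralLinearGroup (Fin n) E => g⁻¹.1) (nhds 1)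
      (nhds 1) := by
    have := (Units.continuous_val.comp (continuous_inv (G := Matrix.GeneralLinearGroup (Fin n) E))).tendsto 1
    simp only [Function.comp_def, inv_one, Units.val_one] at this
    exact this
  exact Filter.inter_mem (h2 h1) (h3 h1)

end Congruence

/-! ### Wild ramification is invisible `ℓ`-adically -/

section Wild

open IsLocalRing

variable {F : Type*} [Field F] [ValuativeRel F] [TopologicalSpace F] [IsNonarchimedeanLocalField F]
  {Ω : Type*} [Field Ω] [Algebra F Ω] [IsGalois F Ω]

/-- The elements of `G_F^s` with `s > 0` have `p`-power order in all finite quotients. -/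
lemma exists_restrictTo_pow_eq_one {s : ℝ} (hs : 0 < s) {w : WeilGroup F Ω}
    (hw : w ∈ upperSet F Ω s) (K : FiniteGaloisIntermediateField F Ω) :
    ∃ N : ℕ, restrictTo K (w ^ ringChar 𝓀[F] ^ N) = 1 := by
  have h1 := upperGroup_le_lowerGroup_one hs (mem_absUpperGroup_iff.1 hw K)
  rw [lowerGroup_natCast] at h1
  obtain ⟨N, hN⟩ := exists_pow_prime_pow_eq_one residueChar_mem h1
  exact ⟨N, by rw [map_pow]; exact hN⟩

variable {E : Type*} [NormedField E] [IsUltrametricDist E] {n ℓ : ℕ}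
  {ρ : WeilGroup F Ω →* Matrix.GeneralLinearGroup (Fin n) E} (hρ : Continuous ρ)

include hρ in
lemma exists_forall_mem_congruenceSubgroup (hℓ : (ℓ : E) ≠ 0) (m : ℕ) :
    ∃ K : FiniteGaloisIntermediateField F Ω, ∀ w ∈ inertia F Ω, restrictTo K w = 1 →
      ρ w ∈ congruenceSubgroup E n ℓ m := by
  refine exists_forall_mem_of_mem_nhds_one (U := ρ ⁻¹' (congruenceSubgroup E n ℓ m)) ?_
  refine hρ.continuousAt.preimage_mem_nhds ?_
  rw [map_one]
  exact congruenceSubgroup_mem_nhds_one hℓ m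

/-- A homomorphism from inertia to `ℚ_ℓ` is trivial on wild inertia. -/
lemma hom_eq_zero_of_mem_upperSet [Fact ℓ.Prime] {t : inertia F Ω →* Multiplicative ℚ_[ℓ]}
    (ht : Continuous t) (hℓ : (ringChar 𝓀[F]).Coprime ℓ) {s : ℝ} (hs : 0 < s)
    {w : inertia F Ω} (hw : (w : WeilGroup F Ω) ∈ upperSet F Ω s) : (t w).toAdd = 0 := by
  rw [← norm_le_zero_iff]
  refine le_of_forall_pos_le_add fun ε hε => ?_
  rw [zero_add]
  have h1 : {x : inertia F Ω | ‖(t x).toAdd‖ < ε} ∈ nhds 1 := by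
    have hc : Continuous fun x : inertia F Ω => ‖(t x).toAdd‖ :=
      continuous_norm.comp (continuous_toAdd.comp ht)
    refine (hc.tendsto 1).eventually_lt_const ?_
    simpa using hε
  obtain ⟨U, hU, hUt⟩ := mem_nhds_subtype _ _ _ |>.1 h1
  obtain ⟨K, hK⟩ := exists_forall_mem_of_mem_nhds_one (U := U) hU
  obtain ⟨N, hN⟩ := exists_restrictTo_pow_eq_one hs hw K
  have h2 := hUt (a := w ^ ringChar 𝓀[F] ^ N) (hK _ (pow_mem w.2 _) hN)
  have h3 : ‖(t (w ^ ringChar 𝓀[F] ^ N)).toAdd‖ < ε := h2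
  rw [map_pow, toAdd_pow, nsmul_eq_mul, norm_mul,
    Padic.norm_natCast_eq_one_iff.2 (hℓ.pow_left N).symm, one_mul] at h3
  exact h3.le

end Wild

/-! ### The tame character -/

section Kummer

open IsLocalRing

/-- A compatible system of `ℓ`-power roots of an element `base` of `F`, and a compatible system of
primitive `ℓ`-power roots of unity. -/
structure KummerSystem (F Ω : Type*) [Field F] [Field Ω] [Algebra F Ω] (ℓ : ℕ) where
  /-- The element whose roots are taken. -/
  base : F
  base_ne_zero : base ≠ 0
  /-- An `ℓ ^ n`-th root of the base. -/
  root : ℕ → Ω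
  root_zero : root 0 = algebraMap F Ω base
  root_succ : ∀ n, root (n + 1) ^ ℓ = root n
  /-- A primitive `ℓ ^ n`-th root of unity. -/
  zeta : ℕ → Ω
  zeta_succ : ∀ n, zeta (n + 1) ^ ℓ = zeta n
  zeta_prim : ∀ n, IsPrimitiveRoot (zeta n) (ℓ ^ n)

namespace KummerSystem

lemma exists_pow_eq_isPrimitiveRoot {Ω : Type*} [Field Ω] [IsSepClosed Ω] {ℓ : ℕ} [hℓ : Fact ℓ.Prime]
    (h0 : (ℓ : Ω) ≠ 0) (n : ℕ) {ζ : Ω} (hζ : IsPrimitiveRoot ζ (ℓ ^ n)) :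
    ∃ ξ, ξ ^ ℓ = ζ ∧ IsPrimitiveRoot ξ (ℓ ^ (n + 1)) := by
  have : NeZero ((ℓ ^ (n + 1) : ℕ) : Ω) := ⟨by push_cast; exact pow_ne_zero _ h0⟩
  have : NeZero (ℓ ^ n) := ⟨pow_ne_zero _ hℓ.out.ne_zero⟩
  have hpos : 0 < ℓ ^ (n + 1) := pow_pos hℓ.out.pos _
  obtain ⟨η, hη⟩ := HasEnoughRootsOfUnity.exists_primitiveRoot Ω (ℓ ^ (n + 1))
  rcases Nat.eq_zero_or_pos n with rfl | hn
  · refine ⟨η, ?_, hη⟩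
    rw [pow_zero, IsPrimitiveRoot.one_right_iff] at hζ
    rw [hζ]
    simpa using hη.pow_eq_one
  · have h1 : IsPrimitiveRoot (η ^ ℓ) (ℓ ^ n) := hη.pow hpos (pow_succ' ℓ n)
    obtain ⟨i, -, hi, h2⟩ := h1.isPrimitiveRoot_iff.1 hζ
    refine ⟨η ^ i, by rw [← h2, ← pow_mul, ← pow_mul, mul_comm], hη.pow_of_coprime i ?_⟩
    exact Nat.Coprime.pow_right _ (Nat.Coprime.coprime_dvd_right (dvd_pow_self ℓ hn.ne') hi)

/-- Kummer systems exist. -/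
lemma exists_base_eq {F Ω : Type*} [Field F] [Field Ω] [Algebra F Ω] [IsSepClosed Ω] {ℓ : ℕ}
    [hℓ : Fact ℓ.Prime] (h0 : (ℓ : Ω) ≠ 0) {a : F} (ha : a ≠ 0) :
    ∃ S : KummerSystem F Ω ℓ, S.base = a := by
  have hne : NeZero (ℓ : Ω) := ⟨h0⟩
  choose r hr using fun x : Ω => IsSepClosed.exists_pow_nat_eq x ℓ
  choose z hz1 hz2 using fun (n : ℕ) (ζ : {ζ : Ω // IsPrimitiveRoot ζ (ℓ ^ n)}) =>
    exists_pow_eq_isPrimitiveRoot h0 n ζ.2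
  let zs : ∀ n, {ζ : Ω // IsPrimitiveRoot ζ (ℓ ^ n)} := fun n =>
    Nat.rec (motive := fun n => {ζ : Ω // IsPrimitiveRoot ζ (ℓ ^ n)})
      ⟨1, by simp⟩ (fun n ζ => ⟨z n ζ, hz2 n ζ⟩) n
  exact ⟨{  base := a
            base_ne_zero := ha
            root := fun n => Nat.rec (algebraMap F Ω a) (fun _ x => r x) n
            root_zero := rfl
            root_succ := fun n => hr _
            zeta := fun n => (zs n).1
            zeta_succ := fun n => hz1 n (zs n)
            zeta_prim := fun n => (zs n).2 }, rfl⟩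

variable {F Ω : Type*} [Field F] [Field Ω] [Algebra F Ω] {ℓ : ℕ} [hℓ : Fact ℓ.Prime]
  (S : KummerSystem F Ω ℓ)

lemma root_pow (n : ℕ) : S.root n ^ ℓ ^ n = algebraMap F Ω S.base := by
  induction n with
  | zero => simpa using S.root_zero
  | succ n ih => rw [pow_succ', pow_mul, S.root_succ, ih]

lemma root_ne_zero (n : ℕ) : S.root n ≠ 0 := by
  intro h
  have h1 := S.root_pow n
  rw [h, zero_pow (pow_ne_zero _ hℓ.out.ne_zero)] at h1
  exact S.base_ne_zero ((map_eq_zero _).1 h1.symm)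

lemma zeta_pow_eq_iff (n : ℕ) (a b : ℕ) : S.zeta n ^ a = S.zeta n ^ b ↔
    (ℓ : ℤ_[ℓ]) ^ n ∣ (a : ℤ_[ℓ]) - b := by
  have hpos : ℓ ^ n ≠ 0 := pow_ne_zero _ hℓ.out.ne_zero
  have h := PadicInt.pow_p_dvd_int_iff (p := ℓ) n ((a : ℤ) - b)
  rw [Int.cast_sub, Int.cast_natCast, Int.cast_natCast] at h
  rw [h, ((S.zeta_prim n).isOfFinOrder hpos).pow_eq_pow_iff_modEq, ← (S.zeta_prim n).eq_orderOf,
    Nat.ModEq.comm, Nat.modEq_iff_dvd, Nat.cast_pow]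

/-- The relation `σ (π_n) / π_n = ζ_n ^ z` for all `n`, for a system `π_n` of roots. -/
def Describes (σ : Ω ≃ₐ[F] Ω) (z : ℤ_[ℓ]) : Prop :=
  ∀ n, ∃ a : ℕ, (ℓ : ℤ_[ℓ]) ^ n ∣ z - a ∧ σ (S.root n) = S.zeta n ^ a * S.root n

variable {S}

lemma Describes.apply {σ : Ω ≃ₐ[F] Ω} {z : ℤ_[ℓ]} (h : S.Describes σ z) {n a : ℕ}
    (ha : (ℓ : ℤ_[ℓ]) ^ n ∣ z - a) : σ (S.root n) = S.zeta n ^ a * S.root n := by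
  obtain ⟨b, hb, hσ⟩ := h n
  rw [hσ]
  congr 1
  rw [zeta_pow_eq_iff]
  have := dvd_sub ha hb
  rwa [sub_sub_sub_cancel_left] at this

lemma dvd_sub_appr (z : ℤ_[ℓ]) (n : ℕ) : (ℓ : ℤ_[ℓ]) ^ n ∣ z - z.appr n :=
  Ideal.mem_span_singleton.1 (PadicInt.appr_spec n z)

lemma eq_zero_of_forall_pow_dvd {z : ℤ_[ℓ]} (h : ∀ n, (ℓ : ℤ_[ℓ]) ^ n ∣ z) : z = 0 := by
  rw [← norm_le_zero_iff]
  refine ge_of_tendsto' (f := fun n : ℕ => ((ℓ : ℝ)⁻¹) ^ n)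
    (tendsto_pow_atTop_nhds_zero_of_lt_one (by positivity)
      (inv_lt_one_of_one_lt₀ (by exact_mod_cast hℓ.out.one_lt))) fun n => ?_
  have := (PadicInt.norm_le_pow_iff_mem_span_pow z n).2 (Ideal.mem_span_singleton.2 (h n))
  simpa using this

lemma Describes.unique {σ : Ω ≃ₐ[F] Ω} {z z' : ℤ_[ℓ]} (h : S.Describes σ z)
    (h' : S.Describes σ z') : z = z' := by
  rw [← sub_eq_zero]
  refine eq_zero_of_forall_pow_dvd fun n => ?_
  obtain ⟨a, ha, h1⟩ := h n
  obtain ⟨b, hb, h2⟩ := h' n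
  have h3 := mul_right_cancel₀ (S.root_ne_zero n) (h1.symm.trans h2)
  rw [zeta_pow_eq_iff] at h3
  have := dvd_sub (dvd_add ha h3) hb
  convert this using 1
  ring

lemma Describes.mul {σ τ : Ω ≃ₐ[F] Ω} {z z' : ℤ_[ℓ]} (h : S.Describes σ z)
    (h' : S.Describes τ z') (hσ : ∀ n, σ (S.zeta n) = S.zeta n) : S.Describes (σ * τ) (z + z') := by
  intro n
  obtain ⟨a, ha, h1⟩ := h n
  obtain ⟨b, hb, h2⟩ := h' n
  refine ⟨a + b, ?_, ?_⟩
  · have := dvd_add ha hb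
    convert this using 1
    push_cast
    ring
  · rw [AlgEquiv.mul_apply, h2, map_mul, map_pow, hσ, h1, pow_add]
    ring

lemma Describes.dvd_of_apply_eq {σ : Ω ≃ₐ[F] Ω} {z : ℤ_[ℓ]} (h : S.Describes σ z) {n : ℕ}
    (hn : σ (S.root n) = S.root n) : (ℓ : ℤ_[ℓ]) ^ n ∣ z := by
  obtain ⟨a, ha, h1⟩ := h n
  have h3 : S.zeta n ^ a = S.zeta n ^ 0 := by
    rw [pow_zero]
    apply mul_right_cancel₀ (S.root_ne_zero n)
    rw [← h1, hn, one_mul]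
  rw [zeta_pow_eq_iff, Nat.cast_zero, sub_zero] at h3
  have := dvd_add ha h3
  rwa [sub_add_cancel] at this

variable (S)

lemma exists_apply_root_eq (σ : Ω ≃ₐ[F] Ω) (n : ℕ) {x : Ω} (hx : x ^ ℓ ^ n = algebraMap F Ω S.base) :
    ∃ a : ℕ, σ x = S.zeta n ^ a * S.root n := by
  have : NeZero (ℓ ^ n) := ⟨pow_ne_zero _ hℓ.out.ne_zero⟩
  obtain ⟨a, -, ha⟩ := (S.zeta_prim n).eq_pow_of_pow_eq_one (ξ := σ x / S.root n) (by
    rw [div_pow, ← map_pow, hx, AlgEquiv.commutes, S.root_pow, div_self]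
    rw [← S.root_pow n]
    exact pow_ne_zero _ (S.root_ne_zero n))
  exact ⟨a, by rw [ha, div_mul_cancel₀ _ (S.root_ne_zero n)]⟩

/-- The exponents `a n` with `σ (π_n) = ζ_n ^ (a n) π_n` form a Cauchy sequence in `ℤ_ℓ`. -/
lemma exists_describes (σ : Ω ≃ₐ[F] Ω) : ∃ z : ℤ_[ℓ], S.Describes σ z := by
  choose a ha using fun n => S.exists_apply_root_eq σ n (S.root_pow n)
  have hstep : ∀ n, (ℓ : ℤ_[ℓ]) ^ n ∣ (a (n + 1) : ℤ_[ℓ]) - a n := by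
    intro n
    rw [← S.zeta_pow_eq_iff]
    apply mul_right_cancel₀ (S.root_ne_zero n)
    rw [← ha n]
    have h1 := congrArg (· ^ ℓ) (ha (n + 1))
    simp only [mul_pow, ← map_pow, S.root_succ] at h1
    rw [h1, ← S.zeta_succ, ← pow_mul, ← pow_mul, mul_comm ℓ]
  have hle : ∀ m n, m ≤ n → (ℓ : ℤ_[ℓ]) ^ m ∣ (a m : ℤ_[ℓ]) - a n := by
    intro m n h
    induction n, h using Nat.le_induction with
    | base => simp
    | succ k hk ih =>
      have := dvd_sub ih ((pow_dvd_pow _ hk).trans (hstep k))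
      convert this using 1
      ring
  have hI : ∀ n, (maximalIdeal ℤ_[ℓ]) ^ n • (⊤ : Submodule ℤ_[ℓ] ℤ_[ℓ]) =
      Ideal.span {(ℓ : ℤ_[ℓ]) ^ n} := fun n => by
    rw [PadicInt.maximalIdeal_eq_span_p, Ideal.span_singleton_pow, smul_eq_mul, Ideal.mul_top]
  have hcompl : IsAdicComplete (maximalIdeal ℤ_[ℓ]) ℤ_[ℓ] := inferInstance
  obtain ⟨z, hz⟩ := hcompl.toIsPrecomplete.prec' (fun n => (a n : ℤ_[ℓ])) (fun {m n} h => by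
    rw [SModEq.sub_mem, hI, Ideal.mem_span_singleton]
    exact hle m n h)
  refine ⟨z, fun n => ⟨a n, ?_, ha n⟩⟩
  have := hz n
  rw [SModEq.sub_mem, hI, Ideal.mem_span_singleton] at this
  rwa [← dvd_neg, neg_sub]

end KummerSystem

variable {F : Type*} [Field F] [ValuativeRel F] [TopologicalSpace F] [IsNonarchimedeanLocalField F]
  {Ω : Type*} [Field Ω] [Algebra F Ω] [IsGalois F Ω] {ℓ : ℕ} [hℓ : Fact ℓ.Prime]

lemma KummerSystem.inertia_zeta (S : KummerSystem F Ω ℓ) (hp : ℓ.Coprime (ringChar 𝓀[F]))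
    {σ : WeilGroup F Ω} (hσ : σ ∈ inertia F Ω) (n : ℕ) :
    WeilGroup.incl F Ω σ (S.zeta n) = S.zeta n := by
  have h : ActsAsFrobenius (WeilGroup.incl F Ω σ) 0 0 := fun x => by simpa using hσ x
  simpa using h.apply_rootOfUnity (hp.pow_left n) (S.zeta_prim n).pow_eq_one

/-- The homomorphism `t : I_F → ℤ_ℓ` given by the action on the `ℓ`-power roots of `base`. -/
def KummerSystem.char (S : KummerSystem F Ω ℓ) (hp : ℓ.Coprime (ringChar 𝓀[F])) :
    inertia F Ω →* Multiplicative ℤ_[ℓ] :=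
  MonoidHom.mk' (fun σ => Multiplicative.ofAdd
    (S.exists_describes (WeilGroup.incl F Ω σ)).choose) fun σ τ => by
      rw [← ofAdd_add]
      congr 1
      refine (S.exists_describes (WeilGroup.incl F Ω (σ * τ : inertia F Ω))).choose_spec.unique ?_
      rw [Subgroup.coe_mul, map_mul]
      exact (S.exists_describes _).choose_spec.mul (S.exists_describes _).choose_spec
        (S.inertia_zeta hp σ.2)

lemma KummerSystem.describes_char (S : KummerSystem F Ω ℓ) (hp : ℓ.Coprime (ringChar 𝓀[F]))
    (σ : inertia F Ω) : S.Describes (WeilGroup.incl F Ω σ) (S.char hp σ).toAdd :=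
  (S.exists_describes (WeilGroup.incl F Ω σ)).choose_spec

lemma continuous_of_forall_dist_lt {X : Type*} [PseudoMetricSpace X] {f : inertia F Ω → X}
    (h : ∀ ε > 0, ∃ K : FiniteGaloisIntermediateField F Ω, ∀ σ τ : inertia F Ω,
      restrictTo K (τ : WeilGroup F Ω) = 1 → dist (f (σ * τ)) (f σ) < ε) : Continuous f := by
  rw [continuous_iff_continuousAt]
  intro σ
  rw [ContinuousAt, Metric.tendsto_nhds]
  intro ε hε
  obtain ⟨K, hK⟩ := h ε hε
  have hopen : IsOpen {w : WeilGroup F Ω | σ.1⁻¹ * w ∈ inertia F Ω ∧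
      restrictTo K (σ.1⁻¹ * w) = 1} := by
    refine isOpen_of_forall_mul_mem K fun g hg w hw hw' => ?_
    refine ⟨?_, ?_⟩
    · rw [← mul_assoc]; exact mul_mem hg.1 hw
    · rw [← mul_assoc, map_mul, hg.2, hw', one_mul]
  have hmem := (hopen.preimage continuous_subtype_val).mem_nhds (x := σ) (by simp [one_mem])
  filter_upwards [hmem] with τ hτ
  have := hK σ (σ⁻¹ * τ) hτ.2
  rwa [mul_inv_cancel_left] at this

lemma norm_lt_of_pow_dvd {ε : ℝ} (hε : 0 < ε) : ∃ n : ℕ, ∀ z : ℤ_[ℓ], (ℓ : ℤ_[ℓ]) ^ n ∣ z → ‖z‖ < ε := by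
  obtain ⟨n, hn⟩ := exists_pow_lt_of_lt_one hε
    (inv_lt_one_of_one_lt₀ (by exact_mod_cast hℓ.out.one_lt : (1 : ℝ) < ℓ))
  refine ⟨n, fun z hz => lt_of_le_of_lt ?_ hn⟩
  have := (PadicInt.norm_le_pow_iff_mem_span_pow z n).2 (Ideal.mem_span_singleton.2 hz)
  simpa using this

lemma KummerSystem.continuous_char (S : KummerSystem F Ω ℓ) (hp : ℓ.Coprime (ringChar 𝓀[F])) :
    Continuous fun σ => (S.char hp σ).toAdd := by
  refine continuous_of_forall_dist_lt fun ε hε => ?_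
  obtain ⟨n, hn⟩ := norm_lt_of_pow_dvd (ℓ := ℓ) hε
  refine ⟨FiniteGaloisIntermediateField.adjoin F {S.root n}, fun σ τ hτ => ?_⟩
  rw [map_mul, toAdd_mul, dist_eq_norm, add_sub_cancel_left]
  refine hn _ ((S.describes_char hp τ).dvd_of_apply_eq ?_)
  exact (restrictNormalHom_eq_one_iff _ _).1 hτ _
    (FiniteGaloisIntermediateField.subset_adjoin F {S.root n} rfl)

/-- The Weil group acts on the tame character through the norm: `w` raises the roots of unity `ζ_n`
to the power `‖w‖`, and `w⁻¹ π_n` is another root of `base`, on which `σ` acts by the same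
`ζ_n`-power as on `π_n`. -/
lemma KummerSystem.char_conj [IsSepClosed Ω] (S : KummerSystem F Ω ℓ)
    (hp : ℓ.Coprime (ringChar 𝓀[F])) (w : WeilGroup F Ω) (σ τ : inertia F Ω)
    (hτ : (τ : WeilGroup F Ω) = w * σ * w⁻¹) :
    ((S.char hp τ).toAdd : ℚ_[ℓ]) = (weilNorm w : ℚ_[ℓ]) * (S.char hp σ).toAdd := by
  obtain ⟨a, b, hab⟩ := w.2
  have hab' : ActsAsFrobenius (WeilGroup.incl F Ω w) a b := hab
  set z := (S.char hp σ).toAdd with hz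
  set z' := (S.char hp τ).toAdd with hz'
  have key : (residueCard F : ℤ_[ℓ]) ^ a * z' = (residueCard F : ℤ_[ℓ]) ^ b * z := by
    rw [← sub_eq_zero]
    refine KummerSystem.eq_zero_of_forall_pow_dvd fun n => ?_
    obtain ⟨c, hc, h1⟩ := S.describes_char hp σ n
    obtain ⟨d, hd, h2⟩ := S.describes_char hp τ n
    rw [← hz] at hc
    rw [← hz'] at hd
    have hroot : ((WeilGroup.incl F Ω w)⁻¹ (S.root n)) ^ ℓ ^ n = algebraMap F Ω S.base := by
      rw [← map_pow, S.root_pow, AlgEquiv.commutes]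
    obtain ⟨e, he⟩ := S.exists_apply_root_eq 1 n hroot
    rw [AlgEquiv.one_apply] at he
    have h3 : WeilGroup.incl F Ω τ (S.root n) =
        WeilGroup.incl F Ω w (S.zeta n) ^ c * S.root n := by
      have h4 : WeilGroup.incl F Ω σ ((WeilGroup.incl F Ω w)⁻¹ (S.root n)) =
          S.zeta n ^ c * (WeilGroup.incl F Ω w)⁻¹ (S.root n) := by
        rw [he, map_mul, map_pow, S.inertia_zeta hp σ.2, h1]
        ring
      rw [hτ, map_mul, map_mul, map_inv, AlgEquiv.mul_apply, AlgEquiv.mul_apply, h4, map_mul,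
        map_pow]
      congr 1
      exact (WeilGroup.incl F Ω w).apply_symm_apply _
    have h5 := mul_right_cancel₀ (S.root_ne_zero n) (h2.symm.trans h3)
    have h6 := hab'.apply_rootOfUnity (hp.pow_left n) (S.zeta_prim n).pow_eq_one
    have h7 : S.zeta n ^ (residueCard F ^ a * d) = S.zeta n ^ (residueCard F ^ b * c) := by
      rw [mul_comm, pow_mul, h5, ← pow_mul, mul_comm c, pow_mul, h6, pow_mul]
    rw [KummerSystem.zeta_pow_eq_iff] at h7
    have h8 := dvd_add (dvd_sub (dvd_mul_of_dvd_right hd ((residueCard F : ℤ_[ℓ]) ^ a))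
      (dvd_mul_of_dvd_right hc ((residueCard F : ℤ_[ℓ]) ^ b))) h7
    convert h8 using 1
    push_cast
    ring
  have hq : (residueCard F : ℚ_[ℓ]) ≠ 0 := by
    exact_mod_cast (zero_lt_one.trans (one_lt_residueCard F)).ne'
  rw [weilNorm_eq hab']
  push_cast
  rw [zpow_sub₀ hq, zpow_natCast, zpow_natCast, div_mul_eq_mul_div, eq_div_iff (pow_ne_zero _ hq),
    mul_comm]
  exact_mod_cast congrArg (Subtype.val : ℤ_[ℓ] → ℚ_[ℓ]) key

/-- Inertia acts nontrivially on an `ℓ`-th root of a uniformizer: otherwise its valuation in a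
finite Galois extension would be a multiple of the ramification index. -/
lemma exists_inertia_apply_ne {ϖ : 𝒪[F]} (hϖ : Irreducible ϖ) {x : Ω} {m : ℕ} (hm : 1 < m)
    (hx : x ^ m = algebraMap F Ω ϖ) : ∃ σ ∈ inertia F Ω, WeilGroup.incl F Ω σ x ≠ x := by
  by_contra! hcon
  let K := FiniteGaloisIntermediateField.adjoin F {x}
  have hxK : x ∈ K.toIntermediateField := FiniteGaloisIntermediateField.subset_adjoin F {x} rfl
  have hxi : IsIntegral 𝒪[F] x := by
    refine IsIntegral.of_pow (n := m) (by omega) ?_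
    rw [hx]
    exact isIntegral_algebraMap (R := 𝒪[F]) (A := Ω) (x := ϖ)
  obtain ⟨d, hd⟩ := exists_integersIncl_eq_of_mem (K := K) (x := ⟨x, hxi⟩) hxK
  have hd' : (d : Ω) = x := congrArg Subtype.val hd
  have hdm : d ^ m = algebraMap 𝒪[F] (integers F K) ϖ := by
    apply integersIncl_injective K
    rw [map_pow, hd]
    exact Subtype.ext hx
  set Γ := (maximalIdeal (integers F K)).inertia (K ≃ₐ[F] K)
  have hfix : ∀ γ ∈ Γ, γ • d = d := by
    intro γ hγ
    have hγ' : γ ∈ lowerGroup F K 0 := by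
      rw [lowerGroup_zero]
      exact hγ
    obtain ⟨σ, hσ, rfl⟩ := exists_mem_absInertia K hγ'
    obtain ⟨w, hw, rfl⟩ := exists_weil_eq hσ
    apply integersIncl_injective K
    rw [integersIncl_smul, hd]
    exact Subtype.ext (hcon w hw)
  have : Finite (ResidueField 𝒪[F]) := inferInstanceAs (Finite 𝓀[F])
  have : IsGaloisGroup (K ≃ₐ[F] K) 𝒪[F] (integers F K) :=
    ⟨inferInstance, inferInstance, isInvariant_integers⟩
  have hmap := map_maximalIdeal_eq_pow_card (A := 𝒪[F]) (B := integers F K) (H := K ≃ₐ[F] K)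
  rw [hϖ.maximalIdeal_eq, Ideal.map_span, Set.image_singleton, ← hdm] at hmap
  have hcard : Nat.card Γ ≠ 0 := Nat.card_pos.ne'
  have hdmem : d ∈ maximalIdeal (integers F K) := by
    have h1 : d ^ m ∈ maximalIdeal (integers F K) :=
      Ideal.pow_le_self hcard (hmap ▸ Ideal.mem_span_singleton_self _)
    exact Ideal.IsPrime.mem_of_pow_mem inferInstance m h1
  have h2 := mem_pow_card_of_fixed (A := 𝒪[F]) exists_integers_algebraMap_ne_zero (Γ := Γ) le_rfl
    hfix hdmem
  rw [← hmap, Ideal.mem_span_singleton] at h2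
  obtain ⟨c, hc⟩ := h2
  have hd0 : d ≠ 0 := by
    rintro rfl
    rw [zero_pow (by omega)] at hdm
    exact hϖ.ne_zero ((map_eq_zero_iff _ (FaithfulSMul.algebraMap_injective _ _)).1 hdm.symm)
  have h3 : d * (d ^ (m - 1) * c - 1) = 0 := by
    have : d ^ m = d * d ^ (m - 1) := by rw [← pow_succ', Nat.sub_add_cancel hm.le]
    rw [mul_sub, mul_one, ← mul_assoc, ← this, ← hc, sub_self]
  have h4 : d ^ (m - 1) * c = 1 := sub_eq_zero.1 ((mul_eq_zero.1 h3).resolve_left hd0)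
  have h5 : d ^ (m - 1) * c ∈ maximalIdeal (integers F K) :=
    Ideal.mul_mem_right _ _ (Ideal.pow_mem_of_mem _ hdmem _ (by omega))
  rw [h4] at h5
  exact (Ideal.ne_top_iff_one _).1 (IsLocalRing.maximalIdeal.isMaximal _).ne_top h5

variable (F Ω) in
/-- There is a nonzero continuous homomorphism `t : I_F → ℤ_ℓ` on which the Weil group acts through
the norm. -/
lemma exists_tame_char [IsSepClosed Ω] (hp : ℓ.Coprime (ringChar 𝓀[F])) :
    ∃ t : inertia F Ω →* Multiplicative ℤ_[ℓ], Continuous (fun σ => (t σ).toAdd) ∧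
      (∃ σ, (t σ).toAdd ≠ 0) ∧
      ∀ (w : WeilGroup F Ω) (σ τ : inertia F Ω), (τ : WeilGroup F Ω) = w * σ * w⁻¹ →
        ((t τ).toAdd : ℚ_[ℓ]) = (weilNorm w : ℚ_[ℓ]) * (t σ).toAdd := by
  obtain ⟨ϖ, hϖ⟩ := IsDiscreteValuationRing.exists_irreducible 𝒪[F]
  have hne : (ϖ : F) ≠ 0 := fun h => hϖ.ne_zero (Subtype.ext h)
  obtain ⟨S, hS⟩ := KummerSystem.exists_base_eq (Ω := Ω) (natCast_ne_zero_of_coprime (F := F) hp) hne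
  refine ⟨S.char hp, S.continuous_char hp, ?_, S.char_conj hp⟩
  obtain ⟨σ, hσ, h⟩ := exists_inertia_apply_ne hϖ (x := S.root 1) hℓ.out.one_lt (by
    have := S.root_pow 1
    rw [pow_one, hS] at this
    exact this)
  refine ⟨⟨σ, hσ⟩, fun h0 => h ?_⟩
  have := (S.describes_char hp ⟨σ, hσ⟩).apply (n := 1) (a := 0) (by
    rw [h0, Nat.cast_zero, sub_zero]
    exact dvd_zero _)
  rwa [pow_zero, one_mul] at this

end Kummer

/-! ### Exponentials of nilpotent matrices -/

section NilpotentExp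

open IsNilpotent (exp)

/-- Surjectivity of the exponential in the commutative case, by successive approximation. -/
lemma exists_exp_eq_of_comm {R : Type*} [CommRing R] [Algebra ℚ R] {x : R} (hx : IsNilpotent x) :
    ∃ a : R, IsNilpotent a ∧ exp a = 1 + x := by
  have key : ∀ k : ℕ, ∃ a : R, x ∣ a ∧ x ^ (k + 1) ∣ exp a - (1 + x) := by
    intro k
    induction k with
    | zero => exact ⟨0, dvd_zero _, by simp [IsNilpotent.exp_zero]⟩
    | succ k ih =>
      obtain ⟨a, ha, y, hy⟩ := ih
      have hnil : ∀ {b : R}, x ∣ b → IsNilpotent b := by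
        rintro b ⟨c, rfl⟩
        exact (Commute.all x c).isNilpotent_mul_right hx
      set b := -(x ^ (k + 1) * y) with hb
      have hxb : x ∣ b := (dvd_mul_of_dvd_left (dvd_pow_self x k.succ_ne_zero) y).neg_right
      obtain ⟨N, hN⟩ := hnil hxb
      have h1 : ∃ c, exp b = 1 + b + b ^ 2 * c := by
        rw [IsNilpotent.exp_eq_sum (k := N + 2) (by rw [pow_add, hN, zero_mul]),
          Finset.sum_range_succ', Finset.sum_range_succ']
        refine ⟨∑ i ∈ Finset.range N, ((i + 1 + 1).factorial : ℚ)⁻¹ • b ^ i, ?_⟩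
        rw [Finset.mul_sum]
        simp only [mul_smul_comm, ← pow_add, zero_add, Nat.factorial_one, Nat.cast_one, inv_one,
          pow_one, one_smul, Nat.factorial_zero, pow_zero]
        have : ∀ i, b ^ (i + 1 + 1) = b ^ (2 + i) := fun i => by congr 1; omega
        simp only [this]
        ring
      obtain ⟨c, hc⟩ := h1
      refine ⟨a + b, dvd_add ha hxb, ?_⟩
      rw [IsNilpotent.exp_add_of_commute (Commute.all _ _) (hnil ha) (hnil hxb), hc,
        sub_eq_iff_eq_add.1 hy]
      have hxx : x ^ (k + 1 + 1) ∣ x * b := by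
        rw [pow_succ', hb, mul_neg, ← mul_assoc]
        exact (dvd_mul_right _ _).neg_right
      have hbb : x ^ (k + 1 + 1) ∣ b * b := hxx.trans (mul_dvd_mul_right hxb b)
      have h2 : (x ^ (k + 1) * y + (1 + x)) * (1 + b + b ^ 2 * c) - (1 + x) =
          x * b - b * b + (b * b) * ((x ^ (k + 1) * y + (1 + x)) * c) := by
        have : x ^ (k + 1) * y = -b := by rw [hb, neg_neg]
        rw [this]
        ring
      rw [h2]
      exact dvd_add (dvd_sub hxx hbb) (dvd_mul_of_dvd_left hbb _)
  obtain ⟨N, hN⟩ := hx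
  obtain ⟨a, ⟨c, rfl⟩, ha⟩ := key N
  rw [pow_succ, hN, zero_mul, zero_dvd_iff, sub_eq_zero] at ha
  exact ⟨x * c, (Commute.all x c).isNilpotent_mul_right ⟨N, hN⟩, ha⟩

/-- Every unipotent element is the exponential of a nilpotent one, in the commutative algebra that
it generates. -/
lemma exists_exp_eq {R : Type*} [Ring R] [Algebra ℚ R] {g : R} (hg : IsNilpotent (g - 1)) :
    ∃ a : R, IsNilpotent a ∧ exp a = g := by
  have : IsMulCommutative (Algebra.adjoin ℚ {g - 1}) :=
    Algebra.isMulCommutative_adjoin ℚ (by rintro a rfl b rfl; rfl)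
  let x : Algebra.adjoin ℚ {g - 1} := ⟨g - 1, Algebra.self_mem_adjoin_singleton ℚ _⟩
  have hx : IsNilpotent x := by
    obtain ⟨k, hk⟩ := hg
    exact ⟨k, Subtype.ext hk⟩
  obtain ⟨a, ha, hax⟩ := exists_exp_eq_of_comm hx
  refine ⟨a, ha.map (Algebra.adjoin ℚ {g - 1}).val, ?_⟩
  have h := IsNilpotent.map_exp ha (Algebra.adjoin ℚ {g - 1}).val
  rw [hax] at h
  refine (h.symm.trans ?_)
  change (1 : R) + (g - 1) = g
  abel

variable {E : Type*} [Field E] [CharZero E]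

lemma exp_smul_eq_sum {R : Type*} [Ring R] [Algebra E R] [Module ℚ R] {a : R} {k : ℕ}
    (h : a ^ k = 0) (c : E) :
    exp (c • a) = ∑ i ∈ Finset.range k, (c ^ i * (i.factorial : E)⁻¹) • a ^ i := by
  rw [IsNilpotent.exp_eq_sum (k := k) (by rw [smul_pow, h, smul_zero])]
  refine Finset.sum_congr rfl fun i _ => ?_
  rw [smul_pow, mul_comm, mul_smul, inv_natCast_smul_eq ℚ E]

lemma nilpotentExp_eq_exp {V : Type*} [AddCommGroup V] [Module E V]
    [Module ℚ (Module.End E V)] (X : Module.End E V) : nilpotentExp X = exp X := by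
  rw [nilpotentExp, exp]
  refine Finset.sum_congr rfl fun i _ => ?_
  rw [inv_natCast_smul_eq E ℚ]

variable {n : ℕ}

/-- A nilpotent matrix is determined by the exponentials of its multiples: the entries of
`exp (k A) - exp (k B)` are polynomials in `k`, with linear coefficients the entries of `A - B`. -/
lemma eq_of_forall_exp_smul_eq {A B : Matrix (Fin n) (Fin n) E} (hA : IsNilpotent A)
    (hB : IsNilpotent B) [Module ℚ (Matrix (Fin n) (Fin n) E)]
    (h : ∀ k : ℕ, exp ((k : E) • A) = exp ((k : E) • B)) : A = B := by
  obtain ⟨N₁, hN₁⟩ := hA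
  obtain ⟨N₂, hN₂⟩ := hB
  set N := N₁ + N₂ + 2 with hN
  have hA' : A ^ N = 0 := by rw [hN, add_assoc, pow_add, hN₁, zero_mul]
  have hB' : B ^ N = 0 := by rw [hN, add_comm N₁, add_assoc, pow_add, hN₂, zero_mul]
  ext i j
  let P : Polynomial E := ∑ m ∈ Finset.range N,
    Polynomial.monomial m ((m.factorial : E)⁻¹ * ((A ^ m) i j - (B ^ m) i j))
  have hP : P = 0 := by
    refine Polynomial.eq_zero_of_infinite_isRoot P
      ((Set.infinite_range_of_injective (Nat.cast_injective (R := E))).mono ?_)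
    rintro _ ⟨k, rfl⟩
    have h1 := congrFun (congrFun (h k) i) j
    rw [exp_smul_eq_sum hA', exp_smul_eq_sum hB', Matrix.sum_apply, Matrix.sum_apply,
      ← sub_eq_zero, ← Finset.sum_sub_distrib] at h1
    change Polynomial.eval _ P = 0
    rw [Polynomial.eval_finsetSum, ← h1]
    refine Finset.sum_congr rfl fun m _ => ?_
    rw [Polynomial.eval_monomial, Matrix.smul_apply, Matrix.smul_apply, smul_eq_mul, smul_eq_mul]
    ring
  have h1 := congrArg (fun p => Polynomial.coeff p 1) hP
  simp only [P, Polynomial.finsetSum_coeff, Polynomial.coeff_monomial, Polynomial.coeff_zero] at h1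
  rw [Finset.sum_ite_eq' (Finset.range N) 1, if_pos (Finset.mem_range.2 (by omega))] at h1
  simpa [sub_eq_zero] using h1

/-! ### Eigenvalues under the relation with Frobenius -/

lemma isNilpotent_of_spectrum_subset {K : Type*} [Field K] [IsAlgClosed K]
    {M : Matrix (Fin n) (Fin n) K} (h : ∀ μ ∈ spectrum K M, μ = 0) : IsNilpotent M := by
  have h1 := (IsAlgClosed.splits M.charpoly).eq_prod_roots_of_monic M.charpoly_monic
  have h2 : M.charpoly.roots = Multiset.replicate (Multiset.card M.charpoly.roots) 0 :=
    Multiset.eq_replicate_of_mem fun μ hμ =>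
      h μ (Matrix.mem_spectrum_of_isRoot_charpoly (Polynomial.isRoot_of_mem_roots hμ))
  rw [h2] at h1
  simp only [Multiset.map_replicate, map_zero, sub_zero, Multiset.prod_replicate] at h1
  have h3 := M.aeval_self_charpoly
  rw [h1, map_pow, Polynomial.aeval_X] at h3
  exact ⟨_, h3⟩

/-- If `u` is conjugate to `u ^ q`, its eigenvalues are roots of unity: `x ↦ x ^ q` permutes the
finite set of eigenvalues in an algebraic closure. So a power of `u` is unipotent. -/
lemma exists_isNilpotent_pow_sub_one {K : Type*} [Field K] {q : ℕ} (hq : 1 < q)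
    {u h : Matrix.GeneralLinearGroup (Fin n) K} (hu : h * u * h⁻¹ = u ^ q) :
    ∃ M : ℕ, M ≠ 0 ∧ IsNilpotent ((u ^ M).1 - 1) := by
  classical
  let L := AlgebraicClosure K
  let f : Matrix (Fin n) (Fin n) K →+* Matrix (Fin n) (Fin n) L := (algebraMap K L).mapMatrix
  have hf : Function.Injective f := fun a b hab => by
    ext i j
    exact (algebraMap K L).injective (congrFun (congrFun hab i) j)
  let u' : (Matrix (Fin n) (Fin n) L)ˣ := Units.map (f : _ →* _) u
  let h' : (Matrix (Fin n) (Fin n) L)ˣ := Units.map (f : _ →* _) h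
  have hu' : h' * u' * h'⁻¹ = u' ^ q := by
    simp only [u', h', ← map_mul, ← map_inv, ← map_pow, hu]
  set S := spectrum L u'.1
  have hSfin : S.Finite := by
    have : S ⊆ {μ | μ ∈ u'.1.charpoly.roots.toFinset} := fun μ hμ => by
      rw [Set.mem_ofPred_eq, Multiset.mem_toFinset,
        Polynomial.mem_roots u'.1.charpoly_monic.ne_zero]
      exact Matrix.mem_spectrum_iff_isRoot_charpoly.1 hμ
    exact (Finset.finite_toSet _).subset this
  have hpow : ∀ m : ℕ, 0 < m → spectrum L ((u' ^ m).1) = (· ^ m) '' S := fun m hm => by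
    rw [Units.val_pow_eq_pow_val]
    exact spectrum.map_pow_of_pos _ hm
  have himage : (· ^ q) '' S = S := by
    rw [← hpow q (by omega), ← hu']
    exact spectrum.units_conjugate
  have := hSfin.to_subtype
  have hmaps : ∀ x : S, x.1 ^ q ∈ S := fun x => by
    have : x.1 ^ q ∈ (· ^ q) '' S := ⟨x, x.2, rfl⟩
    rwa [himage] at this
  have hsurj : Function.Surjective (fun x : S => (⟨x.1 ^ q, hmaps x⟩ : S)) := by
    rintro ⟨y, hy⟩
    rw [← himage] at hy
    obtain ⟨x, hx, rfl⟩ := hy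
    exact ⟨⟨x, hx⟩, rfl⟩
  let e : Equiv.Perm S := Equiv.ofBijective _ ⟨Finite.injective_iff_surjective.2 hsurj, hsurj⟩
  have he : ∀ (k : ℕ) (x : S), ((e ^ k) x : L) = x.1 ^ q ^ k := by
    intro k
    induction k with
    | zero => intro x; simp
    | succ k ih =>
      intro x
      rw [pow_succ', Equiv.Perm.mul_apply]
      change ((e ^ k) x : L) ^ q = _
      rw [ih, ← pow_mul, pow_succ]
  obtain ⟨k, hk, hek⟩ := (isOfFinOrder_of_finite e).exists_pow_eq_one
  have hqk : 1 < q ^ k := Nat.one_lt_pow hk.ne' hq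
  refine ⟨q ^ k - 1, by omega, ?_⟩
  have hone : ∀ μ ∈ S, μ ^ (q ^ k - 1) = 1 := by
    intro μ hμ
    have h1 := he k ⟨μ, hμ⟩
    rw [hek, Equiv.Perm.one_apply] at h1
    have h0 : μ ≠ 0 := spectrum.ne_zero_of_mem_of_unit hμ
    have h2 : μ * μ ^ (q ^ k - 1) = μ * 1 := by
      rw [← pow_succ', Nat.sub_add_cancel hqk.le, mul_one]
      exact h1.symm
    exact mul_left_cancel₀ h0 h2
  rw [← IsNilpotent.map_iff hf]
  refine isNilpotent_of_spectrum_subset fun μ hμ => ?_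
  have h3 : f ((u ^ (q ^ k - 1)).1 - 1) = (u' ^ (q ^ k - 1)).1 - algebraMap L _ 1 := by
    rw [map_sub, map_one, map_one, ← map_pow]
    rfl
  rw [h3, ← spectrum.add_mem_add_iff (s := (1 : L)), add_sub_cancel, hpow _ (by omega)] at hμ
  obtain ⟨ν, hν, hνμ⟩ := hμ
  have h4 : ν ^ (q ^ k - 1) = μ + 1 := hνμ
  rw [hone ν hν] at h4
  simpa using h4

end NilpotentExp

/-! ### The monodromy theorem -/

section Monodromy

open IsLocalRing
open IsNilpotent (exp)

variable {F : Type*} [Field F] [ValuativeRel F] [TopologicalSpace F] [IsNonarchimedeanLocalField F]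
  {Ω : Type*} [Field Ω] [Algebra F Ω] [IsGalois F Ω] {ℓ : ℕ} [hℓ : Fact ℓ.Prime]

lemma restrictTo_eq_one_of_le {K L : FiniteGaloisIntermediateField F Ω} (h : K ≤ L)
    {w : WeilGroup F Ω} (hw : restrictTo L w = 1) : restrictTo K w = 1 :=
  (restrictNormalHom_eq_one_iff K _).2 fun x hx =>
    (restrictNormalHom_eq_one_iff L _).1 hw x (h hx)

lemma padicInt_dvd_of_norm_le {c z : ℤ_[ℓ]} (hc : c ≠ 0) (h : ‖z‖ ≤ ‖c‖) : c ∣ z := by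
  have hc' : (c : ℚ_[ℓ]) ≠ 0 := fun h => hc (Subtype.ext h)
  have h1 : ‖(z : ℚ_[ℓ]) / c‖ ≤ 1 := by
    rw [norm_div]
    exact div_le_one_of_le₀ h (norm_nonneg _)
  refine ⟨⟨_, h1⟩, Subtype.ext ?_⟩
  change (z : ℚ_[ℓ]) = (c : ℚ_[ℓ]) * (z / c)
  exact (mul_div_cancel₀ _ hc').symm

variable {T : inertia F Ω →* Multiplicative ℤ_[ℓ]} (hT : Continuous fun σ => (T σ).toAdd)

include hT in
lemma exists_forall_dvd {c : ℤ_[ℓ]} (hc : c ≠ 0) : ∃ K : FiniteGaloisIntermediateField F Ω,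
    ∀ σ : inertia F Ω, restrictTo K σ.1 = 1 → c ∣ (T σ).toAdd := by
  have h1 : {x : inertia F Ω | ‖(T x).toAdd‖ < ‖c‖} ∈ nhds 1 := by
    refine ((continuous_norm.comp hT).tendsto 1).eventually_lt_const ?_
    simpa using hc
  obtain ⟨U, hU, hUt⟩ := mem_nhds_subtype _ _ _ |>.1 h1
  obtain ⟨K, hK⟩ := exists_forall_mem_of_mem_nhds_one (U := U) hU
  exact ⟨K, fun σ hσ => padicInt_dvd_of_norm_le hc (le_of_lt (hUt (a := σ) (hK _ σ.2 hσ)))⟩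

variable {E : Type*} [NormedField E] [IsUltrametricDist E] {n : ℕ}
  {ρ : WeilGroup F Ω →* Matrix.GeneralLinearGroup (Fin n) E} (hρ : Continuous ρ)

include hT hρ in
/-- On a subgroup of inertia with pro-`ℓ` image, `ρ` is controlled by the tame character: all finite
quotients of this image are generated by one element, up to wild inertia. -/
lemma mem_congruenceSubgroup_of_dvd (hℓ0 : (ℓ : E) ≠ 0) (hp : (ringChar 𝓀[F]).Coprime ℓ)
    {L : FiniteGaloisIntermediateField F Ω}
    (hL : ∀ w ∈ inertia F Ω, restrictTo L w = 1 → ρ w ∈ congruenceSubgroup E n ℓ 1)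
    {σ₁ : inertia F Ω} (hσ₁ : restrictTo L σ₁.1 = 1) (hne : (T σ₁).toAdd ≠ 0)
    (hmin : ∀ σ : inertia F Ω, restrictTo L σ.1 = 1 → (T σ₁).toAdd ∣ (T σ).toAdd)
    {m : ℕ} {τ : inertia F Ω} (hτ : restrictTo L τ.1 = 1)
    (hdvd : (ℓ : ℤ_[ℓ]) ^ m * (T σ₁).toAdd ∣ (T τ).toAdd) :
    ρ τ ∈ congruenceSubgroup E n ℓ m := by
  set c : ℤ_[ℓ] := (T σ₁).toAdd with hc
  have hℓne : (ℓ : ℤ_[ℓ]) ≠ 0 := Nat.cast_ne_zero.2 hℓ.out.ne_zero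
  obtain ⟨K₁, hK₁⟩ := exists_forall_mem_congruenceSubgroup hρ hℓ0 m
  obtain ⟨K₂, hK₂⟩ := exists_forall_dvd hT (c := (ℓ : ℤ_[ℓ]) ^ (m + 1) * c)
    (mul_ne_zero (pow_ne_zero _ hℓne) hne)
  let K := K₁ ⊔ K₂
  let J : Subgroup (WeilGroup F Ω) := inertia F Ω ⊓ (restrictTo L).ker
  -- an element `τ₀` of `J` generating its image in `Gal(K/F)` up to `p`-power torsion
  have hΓ : J.map (restrictTo K) ≤ (maximalIdeal (integers F K)).inertia (K ≃ₐ[F] K) := by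
    rintro _ ⟨w, hw, rfl⟩
    rw [← lowerGroup_zero]
    exact mem_absInertia_iff.1 hw.1 K
  obtain ⟨γ₀, ⟨τ₀, hτ₀, rfl⟩, hgen⟩ := exists_generator_mod_wild (B := integers F K)
    residueChar_mem hΓ
  have hτI : τ₀ ∈ inertia F Ω := hτ₀.1
  set s₀ : inertia F Ω := ⟨τ₀, hτI⟩
  -- every `σ ∈ J` is close to a power of `τ₀`, with respect to both `ρ` and the tame character
  have happrox : ∀ σ : inertia F Ω, restrictTo L σ.1 = 1 → ∃ a : ℤ,
      ρ (τ₀ ^ a * σ.1⁻¹) ∈ congruenceSubgroup E n ℓ m ∧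
        (ℓ : ℤ_[ℓ]) ^ (m + 1) * c ∣ a * (T s₀).toAdd - (T σ).toAdd := by
    intro σ hσ
    obtain ⟨a, N, haN⟩ := hgen (restrictTo K σ.1) ⟨σ.1, ⟨σ.2, hσ⟩, rfl⟩
    rw [← map_zpow, ← map_inv, ← map_mul, ← map_pow] at haN
    have hxI : τ₀ ^ a * σ.1⁻¹ ∈ inertia F Ω := mul_mem (zpow_mem hτI _) (inv_mem σ.2)
    refine ⟨a, mem_congruenceSubgroup_of_pow_mem (hL _ hxI ?_) (hp.pow_left N) ?_, ?_⟩
    · rw [map_mul, map_inv, hσ, inv_one, mul_one, map_zpow, show restrictTo L τ₀ = 1 from hτ₀.2,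
        one_zpow]
    · rw [← map_pow]
      exact hK₁ _ (pow_mem hxI _) (restrictTo_eq_one_of_le le_sup_left haN)
    · have h1 := hK₂ ((s₀ ^ a * σ⁻¹) ^ ringChar 𝓀[F] ^ N)
        (restrictTo_eq_one_of_le le_sup_right haN)
      rw [map_pow, toAdd_pow, nsmul_eq_mul, map_mul, toAdd_mul, map_inv, toAdd_inv, map_zpow,
        toAdd_zpow, zsmul_eq_mul, ← sub_eq_add_neg] at h1
      have hunit : IsUnit ((ringChar 𝓀[F] ^ N : ℕ) : ℤ_[ℓ]) := by
        rw [PadicInt.isUnit_iff, PadicInt.norm_natCast_eq_one_iff]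
        exact (hp.pow_left N).symm
      exact hunit.dvd_mul_left.1 h1
  -- the tame character of `τ₀` has minimal valuation
  obtain ⟨a₁, -, ha₁⟩ := happrox σ₁ hσ₁
  have hgen_dvd : (T s₀).toAdd ∣ c := by
    obtain ⟨d, hd⟩ := ha₁
    have h1 : (a₁ : ℤ_[ℓ]) * (T s₀).toAdd = c * (1 + ℓ * (ℓ ^ m * d)) := by
      rw [← hc] at hd
      linear_combination hd
    have hunit : IsUnit (1 + (ℓ : ℤ_[ℓ]) * (ℓ ^ m * d)) := by
      have hmem : (ℓ : ℤ_[ℓ]) * (ℓ ^ m * d) ∈ maximalIdeal ℤ_[ℓ] := by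
        rw [PadicInt.maximalIdeal_eq_span_p]
        exact Ideal.mul_mem_right _ _ (Ideal.mem_span_singleton_self _)
      by_contra h
      have h2 := (IsLocalRing.mem_maximalIdeal _).2 h
      rw [Submodule.add_mem_iff_left _ hmem] at h2
      exact (Ideal.ne_top_iff_one _).1 (IsLocalRing.maximalIdeal.isMaximal _).ne_top h2
    rw [← hunit.dvd_mul_right, ← h1]
    exact dvd_mul_left _ _
  obtain ⟨a, ha1, ha2⟩ := happrox τ hτ
  have h1 : (ℓ : ℤ_[ℓ]) ^ m * (T s₀).toAdd ∣ a * (T s₀).toAdd := by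
    have h2 : (ℓ : ℤ_[ℓ]) ^ m * c ∣ a * (T s₀).toAdd := by
      have h3 := dvd_add ((mul_dvd_mul_right (pow_dvd_pow (ℓ : ℤ_[ℓ]) (Nat.le_succ m)) c).trans ha2)
        hdvd
      rwa [sub_add_cancel] at h3
    exact (mul_dvd_mul_left _ hgen_dvd).trans h2
  have hs₀ : (T s₀).toAdd ≠ 0 := fun h => hne (by
    have := hmin s₀ hτ₀.2
    rw [h] at hgen_dvd
    exact zero_dvd_iff.1 hgen_dvd)
  have h2 : (ℓ : ℤ_[ℓ]) ^ m ∣ a := (mul_dvd_mul_iff_right hs₀).1 h1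
  rw [PadicInt.pow_p_dvd_int_iff, ← Nat.cast_pow] at h2
  have h3 := zpow_mem_congruenceSubgroup (hL τ₀ hτ₀.1 hτ₀.2) h2
  have h4 : ρ τ = (ρ (τ₀ ^ a * τ.1⁻¹))⁻¹ * ρ τ₀ ^ a := by
    rw [map_mul, map_inv, map_zpow]
    group
  rw [h4]
  exact mul_mem (inv_mem ha1) h3

/-- The image of an open subgroup of inertia under the tame character is generated by one value, an
element of minimal valuation. -/
lemma exists_minimal_char (L : FiniteGaloisIntermediateField F Ω)
    (hTne : ∃ σ, (T σ).toAdd ≠ 0) : ∃ σ₁ : inertia F Ω, restrictTo L σ₁.1 = 1 ∧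
      (T σ₁).toAdd ≠ 0 ∧
        ∀ σ : inertia F Ω, restrictTo L σ.1 = 1 → (T σ₁).toAdd ∣ (T σ).toAdd := by
  let A : Set (inertia F Ω) := {σ | restrictTo L σ.1 = 1 ∧ (T σ).toAdd ≠ 0}
  have hA : A.Nonempty := by
    obtain ⟨σ, hσ⟩ := hTne
    refine ⟨σ ^ Nat.card (L ≃ₐ[F] L), ?_, ?_⟩
    · rw [Subgroup.coe_pow, map_pow, pow_card_eq_one']
    · rw [map_pow, toAdd_pow, nsmul_eq_mul]
      exact mul_ne_zero (Nat.cast_ne_zero.2 Nat.card_pos.ne') hσ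
  obtain ⟨σ₁, hσ₁, hmin⟩ := (measure fun σ : inertia F Ω => (T σ).toAdd.valuation).wf.has_min A hA
  refine ⟨σ₁, hσ₁.1, hσ₁.2, fun σ hσ => ?_⟩
  by_cases h0 : (T σ).toAdd = 0
  · rw [h0]; exact dvd_zero _
  · have h1 : (T σ₁).toAdd.valuation ≤ (T σ).toAdd.valuation := not_lt.1 (hmin σ ⟨hσ, h0⟩)
    refine padicInt_dvd_of_norm_le hσ₁.2 ?_
    rw [PadicInt.norm_eq_zpow_neg_valuation h0, PadicInt.norm_eq_zpow_neg_valuation hσ₁.2]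
    exact zpow_le_zpow_right₀ (by exact_mod_cast hℓ.out.one_lt.le) (by omega)

end Monodromy

section Monodromy

open IsNilpotent (exp)

lemma exp_natCast_smul {E : Type*} [Field E] [CharZero E] {R : Type*} [Ring R] [Algebra E R]
    [Module ℚ R] {a : R} (ha : IsNilpotent a) (k : ℕ) : exp ((k : E) • a) = exp a ^ k := by
  induction k with
  | zero => simp [IsNilpotent.exp_zero]
  | succ k ih =>
    rw [Nat.cast_succ, add_smul, one_smul, IsNilpotent.exp_add_of_commute
      ((Commute.refl a).smul_left _) (ha.smul _) ha, ih, pow_succ]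

variable {ℓ : ℕ} [hℓ : Fact ℓ.Prime] {E : Type*} [NormedField E] [NormedAlgebra ℚ_[ℓ] E]
  [IsUltrametricDist E] [CharZero E] {n : ℕ}

variable (E) in
/-- The inclusion of `ℤ_ℓ` in an `ℓ`-adic field. -/
def padicIntHom : ℤ_[ℓ] →+* E := (algebraMap ℚ_[ℓ] E).comp PadicInt.Coe.ringHom

lemma norm_padicIntHom (z : ℤ_[ℓ]) : ‖padicIntHom E z‖ = ‖z‖ := by
  rw [padicIntHom, RingHom.comp_apply, norm_algebraMap']
  rfl

lemma tendsto_appr (a : ℤ_[ℓ]) :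
    Filter.Tendsto (fun k : ℕ => ((a.appr k : ℕ) : E)) Filter.atTop (nhds (padicIntHom E a)) := by
  rw [tendsto_iff_norm_sub_tendsto_zero]
  refine squeeze_zero (fun _ => norm_nonneg _) (fun k => ?_)
    (tendsto_pow_atTop_nhds_zero_of_lt_one (r := (ℓ : ℝ)⁻¹) (by positivity)
      (inv_lt_one_of_one_lt₀ (by exact_mod_cast hℓ.out.one_lt)))
  have h1 := (PadicInt.norm_le_pow_iff_mem_span_pow _ k).2 (PadicInt.appr_spec k a)
  rw [← map_natCast (padicIntHom E (ℓ := ℓ)), ← map_sub, norm_padicIntHom, norm_sub_rev]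
  simpa using h1

/-- The one-parameter group `a ↦ exp (a A)` is continuous on `ℤ_ℓ`, so its values are determined by
those at natural numbers. -/
lemma eq_exp_of_forall_entriesLE (hℓ1 : ‖(ℓ : E)‖ < 1) {A X : Matrix (Fin n) (Fin n) E}
    (hA : IsNilpotent A) (a : ℤ_[ℓ])
    (h : ∀ k, EntriesLE (‖(ℓ : E)‖ ^ k) (X - exp (((a.appr k : ℕ) : E) • A))) :
    X = exp (padicIntHom E a • A) := by
  obtain ⟨N, hN⟩ := hA
  ext i j
  have hcont : Continuous fun c : E => (exp (c • A)) i j := by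
    simp_rw [exp_smul_eq_sum hN, Matrix.sum_apply, Matrix.smul_apply, smul_eq_mul]
    fun_prop
  have h1 := ((hcont.tendsto _).comp (tendsto_appr (E := E) a))
  have h2 : Filter.Tendsto (fun k : ℕ => (exp (((a.appr k : ℕ) : E) • A)) i j) Filter.atTop
      (nhds (X i j)) := by
    rw [tendsto_iff_norm_sub_tendsto_zero]
    refine squeeze_zero (fun _ => norm_nonneg _) (fun k => ?_)
      (tendsto_pow_atTop_nhds_zero_of_lt_one (norm_nonneg _) hℓ1)
    rw [norm_sub_rev]
    exact h k i j
  exact tendsto_nhds_unique h2 h1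

variable {F : Type*} [Field F] [ValuativeRel F] [TopologicalSpace F] [IsNonarchimedeanLocalField F]
  {Ω : Type*} [Field Ω] [Algebra F Ω] [IsGalois F Ω] [IsSepClosed Ω]
  {T : inertia F Ω →* Multiplicative ℤ_[ℓ]} {ρ : WeilGroup F Ω →* Matrix.GeneralLinearGroup (Fin n) E}

omit [IsUltrametricDist E] in
lemma natCast_prime_facts : (ℓ : E) ≠ 0 ∧ ‖(ℓ : E)‖ < 1 := by
  refine ⟨Nat.cast_ne_zero.2 hℓ.out.ne_zero, ?_⟩
  have : (ℓ : E) = algebraMap ℚ_[ℓ] E ℓ := (map_natCast _ _).symm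
  rw [this, norm_algebraMap']
  exact Padic.norm_p_lt_one

/-- The monodromy theorem: on an open subgroup of inertia, `ρ` is the exponential of a multiple of
the tame character, by a nilpotent matrix on which the Weil group acts through the norm. Here `N` is
the logarithm of a unipotent power of `ρ(σ₁)`, divided by the tame character of that power, where
`σ₁` topologically generates the image. -/
lemma exists_monodromy (hp : (ringChar 𝓀[F]).Coprime ℓ) (hρ : Continuous ρ)
    (hT : Continuous fun σ => (T σ).toAdd) (hTne : ∃ σ, (T σ).toAdd ≠ 0)
    (hTconj : ∀ (w : WeilGroup F Ω) (σ τ : inertia F Ω), (τ : WeilGroup F Ω) = w * σ * w⁻¹ →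
        ((T τ).toAdd : ℚ_[ℓ]) = (weilNorm w : ℚ_[ℓ]) * (T σ).toAdd) :
    ∃ N : Matrix (Fin n) (Fin n) E, IsNilpotent N ∧
      (∃ K : FiniteGaloisIntermediateField F Ω, ∀ σ : inertia F Ω, restrictTo K σ.1 = 1 →
        (ρ σ).1 = exp (padicIntHom E (T σ).toAdd • N)) ∧
      ∀ w, (ρ w).1 * N * (ρ w)⁻¹.1 = (weilNorm w : E) • N := by
  obtain ⟨hℓ0, hℓ1⟩ := natCast_prime_facts (ℓ := ℓ) (E := E)
  obtain ⟨L, hL⟩ := exists_forall_mem_congruenceSubgroup hρ hℓ0 1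
  obtain ⟨σ₁, hσ₁, hne, hmin⟩ := exists_minimal_char L hTne
  have hcong := fun (m : ℕ) (τ : inertia F Ω) => mem_congruenceSubgroup_of_dvd (m := m) (τ := τ)
    hT hρ hℓ0 hp hL hσ₁ hne hmin
  have hinj : ∀ {x y : ℤ_[ℓ]}, (x : ℚ_[ℓ]) = y → x = y := fun h => Subtype.ext h
  have hconj : ∀ (w : WeilGroup F Ω) (σ : inertia F Ω), restrictTo L σ.1 = 1 →
      restrictTo L (w * σ.1 * w⁻¹) = 1 := fun w σ h => by
    rw [map_mul, map_mul, h, mul_one, map_inv, mul_inv_cancel]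
  let cj : WeilGroup F Ω → inertia F Ω → inertia F Ω := fun w σ =>
    ⟨w * σ.1 * w⁻¹, inertia_normal.conj_mem _ σ.2 w⟩
  -- the relation with Frobenius shows that the eigenvalues are roots of unity
  obtain ⟨Φ, hΦ⟩ := exists_isGeomFrobenius F Ω
  have hΦq : weilNorm Φ⁻¹ = residueCard F := by rw [weilNorm_inv, hΦ.weilNorm_eq, inv_inv]
  have hrel : ρ Φ⁻¹ * ρ σ₁ * (ρ Φ⁻¹)⁻¹ = ρ σ₁ ^ residueCard F := by
    let τ : inertia F Ω := cj Φ⁻¹ σ₁ * (σ₁ ^ residueCard F)⁻¹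
    have hτL : restrictTo L τ.1 = 1 := by
      change restrictTo L (Φ⁻¹ * σ₁.1 * Φ⁻¹⁻¹ * (σ₁.1 ^ residueCard F)⁻¹) = 1
      rw [map_mul, hconj _ _ hσ₁, map_inv, map_pow, hσ₁, one_pow, inv_one, mul_one]
    have hτ0 : (T τ).toAdd = 0 := by
      have h1 := hTconj Φ⁻¹ σ₁ (cj Φ⁻¹ σ₁) rfl
      rw [hΦq] at h1
      have h2 : (T (cj Φ⁻¹ σ₁)).toAdd = residueCard F * (T σ₁).toAdd := hinj (by
        push_cast at h1 ⊢
        exact h1)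
      rw [map_mul, toAdd_mul, map_inv, toAdd_inv, map_pow, toAdd_pow, h2, nsmul_eq_mul,
        add_neg_cancel]
    have hone : ρ τ = 1 := eq_one_of_forall_mem_congruenceSubgroup hℓ1 fun m =>
      hcong m τ hτL (by rw [hτ0]; exact dvd_zero _)
    have h3 : ρ τ = ρ Φ⁻¹ * ρ σ₁ * (ρ Φ⁻¹)⁻¹ * (ρ σ₁ ^ residueCard F)⁻¹ := by
      change ρ (Φ⁻¹ * σ₁.1 * Φ⁻¹⁻¹ * (σ₁.1 ^ residueCard F)⁻¹) = _
      simp only [map_mul, map_inv, map_pow]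
    rw [h3, mul_inv_eq_one] at hone
    exact hone
  obtain ⟨M, hM0, hMnil⟩ := exists_isNilpotent_pow_sub_one (one_lt_residueCard F) hrel
  obtain ⟨A, hA, hAexp⟩ := exists_exp_eq hMnil
  set c : ℤ_[ℓ] := M * (T σ₁).toAdd with hc
  have hM0' : (M : ℤ_[ℓ]) ≠ 0 := Nat.cast_ne_zero.2 hM0
  have hc0 : c ≠ 0 := mul_ne_zero hM0' hne
  have hιc : padicIntHom E c ≠ 0 := by
    rw [← norm_ne_zero_iff, norm_padicIntHom, norm_ne_zero_iff]
    exact hc0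
  have hAk : ∀ k : ℕ, exp ((k : E) • A) = (ρ (σ₁.1 ^ (M * k))).1 := fun k => by
    rw [exp_natCast_smul hA, hAexp, map_pow, pow_mul, Units.val_pow_eq_pow_val _ k]
  -- if `t(σ) = a c`, then `σ` is approximated by the powers `σ₁ ^ (M k)` with `k → a` in `ℤ_ℓ`
  have hformula : ∀ (σ : inertia F Ω) (a : ℤ_[ℓ]), restrictTo L σ.1 = 1 →
      (T σ).toAdd = a * c → (ρ σ).1 = exp (padicIntHom E a • A) := by
    intro σ a hσ ha
    refine eq_exp_of_forall_entriesLE hℓ1 hA a fun k => ?_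
    let τ : inertia F Ω := σ * (σ₁ ^ (M * a.appr k))⁻¹
    have hpowL : restrictTo L (σ₁.1 ^ (M * a.appr k)) = 1 := by rw [map_pow, hσ₁, one_pow]
    have hτL : restrictTo L τ.1 = 1 := by
      change restrictTo L (σ.1 * (σ₁.1 ^ (M * a.appr k))⁻¹) = 1
      rw [map_mul, map_inv, hσ, hpowL, inv_one, mul_one]
    have hτ : (ℓ : ℤ_[ℓ]) ^ k * (T σ₁).toAdd ∣ (T τ).toAdd := by
      obtain ⟨d, hd⟩ := Ideal.mem_span_singleton.1 (PadicInt.appr_spec k a)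
      refine ⟨d * M, ?_⟩
      rw [map_mul, toAdd_mul, map_inv, toAdd_inv, map_pow, toAdd_pow, ha, nsmul_eq_mul,
        hc]
      push_cast
      linear_combination (M * (T σ₁).toAdd) * hd
    have h1 := (hcong k τ hτL hτ).1
    have h2 := (hL _ (pow_mem σ₁.2 (M * a.appr k)) hpowL).1.of_sub_one
      (norm_natCast_pow_mem (E := E) ℓ 1).2
    have h3 := h1.mul (norm_natCast_pow_mem (E := E) ℓ k).1 zero_le_one h2
    rw [mul_one] at h3
    rw [hAk]
    convert h3 using 1
    have h4 : ρ σ = ρ τ * ρ (σ₁.1 ^ (M * a.appr k)) := by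
      rw [← map_mul]
      congr 1
      change σ.1 = σ.1 * (σ₁.1 ^ (M * a.appr k))⁻¹ * _
      rw [inv_mul_cancel_right]
    rw [h4, Units.val_mul, sub_mul, one_mul]
  refine ⟨(padicIntHom E c)⁻¹ • A, hA.smul _, ?_, ?_⟩
  · obtain ⟨K, hK⟩ := exists_forall_dvd hT hc0
    refine ⟨K ⊔ L, fun σ hσ => ?_⟩
    obtain ⟨a, ha⟩ := hK σ (restrictTo_eq_one_of_le le_sup_left hσ)
    rw [hformula σ a (restrictTo_eq_one_of_le le_sup_right hσ) (by rw [ha, mul_comm]), smul_smul,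
      ha, map_mul, mul_comm (padicIntHom E c), mul_assoc, mul_inv_cancel₀ hιc, mul_one]
  · intro w
    have hinv1 : (ρ w)⁻¹.1 * (ρ w).1 = 1 := by rw [← Units.val_mul, inv_mul_cancel, Units.val_one]
    have hinv2 : (ρ w).1 * (ρ w)⁻¹.1 = 1 := by rw [← Units.val_mul, mul_inv_cancel, Units.val_one]
    let f : Matrix (Fin n) (Fin n) E ≃+* Matrix (Fin n) (Fin n) E :=
      { toFun := fun X => (ρ w).1 * X * (ρ w)⁻¹.1
        invFun := fun X => (ρ w)⁻¹.1 * X * (ρ w).1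
        left_inv := fun X => by
          simp only [mul_assoc]; rw [hinv1, mul_one, ← mul_assoc, hinv1, one_mul]
        right_inv := fun X => by
          simp only [mul_assoc]; rw [hinv2, mul_one, ← mul_assoc, hinv2, one_mul]
        map_mul' := fun X Y => by
          simp only [mul_assoc]; rw [← mul_assoc _ (ρ w).1, hinv1, one_mul]
        map_add' := fun X Y => by rw [mul_add, add_mul] }
    have hfsmul : ∀ (e : E) X, f (e • X) = e • f X := fun e X => by
      change (ρ w).1 * (e • X) * (ρ w)⁻¹.1 = e • ((ρ w).1 * X * (ρ w)⁻¹.1)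
      rw [mul_smul_comm, smul_mul_assoc]
    suffices hfA : f A = (weilNorm w : E) • A by
      change f ((padicIntHom E c)⁻¹ • A) = _
      rw [hfsmul, hfA, smul_comm]
    refine eq_of_forall_exp_smul_eq (hA.map f) (hA.smul _) fun k => ?_
    rw [← hfsmul, ← IsNilpotent.map_exp (hA.smul _) f, hAk]
    let σ : inertia F Ω := σ₁ ^ (M * k)
    have hσL : restrictTo L σ.1 = 1 := by
      change restrictTo L (σ₁.1 ^ (M * k)) = 1
      rw [map_pow, hσ₁, one_pow]
    -- the conjugate of `σ` has a tame character divisible by `c`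
    obtain ⟨d, hd⟩ := hmin (cj w σ₁) (hconj w σ₁ hσ₁)
    have hcjpow : cj w σ = cj w σ₁ ^ (M * k) := Subtype.ext (by
      change w * σ₁.1 ^ (M * k) * w⁻¹ = (w * σ₁.1 * w⁻¹) ^ (M * k)
      rw [conj_pow])
    have hTcj : (T (cj w σ)).toAdd = (k * d) * c := by
      rw [hcjpow, map_pow, toAdd_pow, hd, nsmul_eq_mul, hc]
      push_cast
      ring
    have h1 := hformula (cj w σ) (k * d) (hconj w σ hσL) hTcj
    have h2 : (ρ (cj w σ)).1 = f (ρ (σ₁.1 ^ (M * k))).1 := by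
      change (ρ (w * σ₁.1 ^ (M * k) * w⁻¹)).1 = _
      rw [map_mul, map_mul, map_inv, Units.val_mul, Units.val_mul]
      rfl
    have h3 : padicIntHom E d = (weilNorm w : E) := by
      have h4 := hTconj w σ₁ (cj w σ₁) rfl
      rw [hd, PadicInt.coe_mul, mul_comm] at h4
      have h5 := mul_right_cancel₀ (b := ((T σ₁).toAdd : ℚ_[ℓ])) (fun h => hne (hinj h)) h4
      rw [padicIntHom, RingHom.comp_apply]
      change algebraMap ℚ_[ℓ] E (d : ℚ_[ℓ]) = _
      rw [h5, map_ratCast]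
    rw [← h2, h1, map_mul, map_natCast, h3, smul_smul]

end Monodromy

/-! ### The Weil–Deligne representation of an `ℓ`-adic representation -/

section WeilDeligneExists

open IsNilpotent (exp)

variable {ℓ : ℕ} [hℓ : Fact ℓ.Prime] {E : Type*} [NormedField E] [NormedAlgebra ℚ_[ℓ] E]
  [IsUltrametricDist E] [CharZero E] {n : ℕ}

/-- The exponential of a nilpotent matrix as an invertible matrix. -/
def expUnit {A : Matrix (Fin n) (Fin n) E} (hA : IsNilpotent A) :
    Matrix.GeneralLinearGroup (Fin n) E :=
  ⟨exp A, exp (-A), IsNilpotent.exp_mul_exp_neg_self hA, IsNilpotent.exp_neg_mul_exp_self hA⟩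

lemma conj_exp {A : Matrix (Fin n) (Fin n) E} (hA : IsNilpotent A)
    (g : Matrix.GeneralLinearGroup (Fin n) E) :
    exp (g.1 * A * g⁻¹.1) = g.1 * exp A * g⁻¹.1 := by
  have hinv : g⁻¹.1 * g.1 = 1 := by rw [← Units.val_mul, inv_mul_cancel, Units.val_one]
  have hinv' : g.1 * g⁻¹.1 = 1 := by rw [← Units.val_mul, mul_inv_cancel, Units.val_one]
  let f : Matrix (Fin n) (Fin n) E →+* Matrix (Fin n) (Fin n) E :=
    { toFun := fun X => g.1 * X * g⁻¹.1
      map_one' := by rw [mul_one, hinv']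
      map_zero' := by rw [mul_zero, zero_mul]
      map_mul' := fun X Y => by
        simp only [mul_assoc]; rw [← mul_assoc _ g.1, hinv, one_mul]
      map_add' := fun X Y => by rw [mul_add, add_mul] }
  exact (IsNilpotent.map_exp hA f).symm

lemma toLin_nilpotentExp (X : Matrix (Fin n) (Fin n) E) (hX : IsNilpotent X) :
    nilpotentExp (Matrix.toLin' X) = Matrix.toLin' (exp X) := by
  rw [nilpotentExp_eq_exp]
  exact (IsNilpotent.map_exp hX (Matrix.toLinAlgEquiv' (R := E) (n := Fin n))).symm

variable {F : Type*} [Field F] [ValuativeRel F] [TopologicalSpace F] [IsNonarchimedeanLocalField F]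
  {Ω : Type*} [Field Ω] [Algebra F Ω] [IsGalois F Ω] [IsSepClosed Ω]
  {ρ : WeilGroup F Ω →* Matrix.GeneralLinearGroup (Fin n) E}

/-- Grothendieck: every continuous `ℓ`-adic representation has a Weil–Deligne representation, with
`ρ' (Φ ^ m σ) = ρ (Φ ^ m σ) exp (- t(σ) N)`. -/
theorem exists_corresponds (hp : (ringChar 𝓀[F]).Coprime ℓ) (hρ : Continuous ρ) :
    ∃ (Φ : WeilGroup F Ω) (t : inertia F Ω →* Multiplicative ℚ_[ℓ])
      (ρ' : Representation E (WeilGroup F Ω) (Fin n → E)) (N : Module.End E (Fin n → E)),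
      Corresponds (toRep ρ) Φ t ρ' N := by
  obtain ⟨T, hT, hTne, hTconj⟩ := exists_tame_char F Ω hp.symm
  obtain ⟨N, hN, ⟨K, hK⟩, hconj⟩ := exists_monodromy hp hρ hT hTne hTconj
  obtain ⟨Φ, hΦ⟩ := exists_isGeomFrobenius F Ω
  choose m s hms using hΦ.exists_eq_mul
  let ι := padicIntHom E (ℓ := ℓ)
  let a : WeilGroup F Ω → E := fun w => ι (T (s w)).toAdd
  have hq1 : (1 : ℚ) < residueCard F := by exact_mod_cast one_lt_residueCard F
  -- the decomposition `w = Φ ^ m σ` is unique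
  have huniq : ∀ (k : ℤ) (σ : inertia F Ω), s (Φ ^ k * σ.1) = σ := by
    intro k σ
    have h1 := hms (Φ ^ k * σ.1)
    have h2 := congrArg weilNorm h1
    rw [weilNorm_mul, weilNorm_mul, mem_inertia_iff.1 σ.2,
      mem_inertia_iff.1 (s (Φ ^ k * σ.1)).2, mul_one, mul_one, weilNorm_zpow, weilNorm_zpow,
      hΦ.weilNorm_eq] at h2
    have h3 := zpow_right_injective₀ (inv_pos.2 (by linarith)) (inv_lt_one_of_one_lt₀ hq1).ne h2
    rw [← h3] at h1
    exact Subtype.ext (mul_left_cancel h1).symm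
  -- `a` is a cocycle with respect to the norm, which makes `ρ'` multiplicative
  have ha_mul : ∀ v w, a (v * w) = (weilNorm w⁻¹ : E) * a v + a w := by
    intro v w
    let τ : inertia F Ω := ⟨(Φ ^ m w)⁻¹ * (s v).1 * (Φ ^ m w)⁻¹⁻¹,
      inertia_normal.conj_mem _ (s v).2 _⟩
    have h1 : v * w = Φ ^ (m v + m w) * (τ * s w : inertia F Ω).1 := by
      conv_lhs => rw [hms v, hms w]
      change _ = Φ ^ (m v + m w) * ((Φ ^ m w)⁻¹ * (s v).1 * (Φ ^ m w)⁻¹⁻¹ * (s w).1)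
      rw [zpow_add]
      group
    have h2 := hTconj _ _ τ rfl
    have h3 : weilNorm (Φ ^ m w)⁻¹ = weilNorm w⁻¹ := by
      conv_rhs => rw [hms w]
      rw [weilNorm_inv, weilNorm_inv, weilNorm_mul, mem_inertia_iff.1 (s w).2, mul_one]
    rw [h3] at h2
    simp only [a]
    rw [h1, huniq, map_mul, toAdd_mul, map_add]
    congr 1
    change algebraMap ℚ_[ℓ] E ((T τ).toAdd : ℚ_[ℓ]) = _ * algebraMap ℚ_[ℓ] E _
    rw [h2, map_mul, map_ratCast]
    rfl
  have hnil : ∀ e : E, IsNilpotent (e • N) := fun e => hN.smul e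
  have hconj' : ∀ w (e : E), (ρ w)⁻¹.1 * exp (e • N) * (ρ w).1 =
      exp (((weilNorm w⁻¹ : E) * e) • N) := by
    intro w e
    have h1 := conj_exp (hnil e) (ρ w)⁻¹
    have h2 := hconj w⁻¹
    rw [map_inv] at h2
    rw [inv_inv] at h1 h2
    rw [← h1, mul_smul_comm, smul_mul_assoc, h2, smul_smul, mul_comm]
  let ρ' : WeilGroup F Ω →* Matrix.GeneralLinearGroup (Fin n) E :=
    MonoidHom.mk' (fun w => ρ w * expUnit (hnil (-a w))) fun v w => by
      apply Units.ext
      change (ρ (v * w)).1 * exp (-a (v * w) • N) =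
        ((ρ v).1 * exp (-a v • N)) * ((ρ w).1 * exp (-a w • N))
      have h1 : exp (-a v • N) * (ρ w).1 =
          (ρ w).1 * exp (((weilNorm w⁻¹ : E) * -a v) • N) := by
        rw [← hconj' w (-a v), ← mul_assoc, ← mul_assoc, ← Units.val_mul, mul_inv_cancel,
          Units.val_one, one_mul]
      rw [map_mul, Units.val_mul, ha_mul, mul_assoc (ρ v).1 (exp _), ← mul_assoc (exp _), h1,
        mul_assoc (ρ v).1, mul_assoc (ρ w).1, ← IsNilpotent.exp_add_of_commute
          (((Commute.refl N).smul_left _).smul_right _) (hnil _) (hnil _), ← add_smul]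
      congr 4
      ring
  have hρ'val : ∀ w, (ρ' w).1 = (ρ w).1 * exp (-a w • N) := fun w => rfl
  let t : inertia F Ω →* Multiplicative ℚ_[ℓ] :=
    (AddMonoidHom.toMultiplicative (PadicInt.Coe.ringHom (p := ℓ)).toAddMonoidHom).comp T
  have ht : ∀ σ : inertia F Ω, (t σ).toAdd = ((T σ).toAdd : ℚ_[ℓ]) := fun σ => rfl
  have ha_inertia : ∀ σ : inertia F Ω, a σ = ι (T σ).toAdd := fun σ => by
    have := huniq 0 σ
    rw [zpow_zero, one_mul] at this
    simp only [a, this]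
  have hker : ∀ σ : inertia F Ω, restrictTo K σ.1 = 1 → ρ' σ.1 = 1 := fun σ hσ => by
    apply Units.ext
    rw [hρ'val, hK σ hσ, ha_inertia, neg_smul]
    exact IsNilpotent.exp_mul_exp_neg_self (hnil _)
  refine ⟨Φ, t, toRep ρ', Matrix.toLin' N, ⟨hΦ, ?_, ?_, ⟨?_, ?_⟩, ?_⟩⟩
  · have hc : Continuous fun z : ℤ_[ℓ] => (z : ℚ_[ℓ]) :=
      (Isometry.of_dist_eq (f := fun z : ℤ_[ℓ] => (z : ℚ_[ℓ])) fun _ _ => rfl).continuous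
    exact continuous_ofAdd.comp (hc.comp hT)
  · intro h
    obtain ⟨σ, hσ⟩ := hTne
    refine hσ (Subtype.ext ?_)
    have h1 := ht σ
    rw [h] at h1
    exact h1.symm
  · refine isOpen_of_forall_mul_mem K fun g hg w hw hwK => ?_
    have h1 : toRep ρ' w = 1 := by
      change Matrix.toLin' (ρ' w).1 = 1
      rw [hker ⟨w, hw⟩ hwK, Units.val_one]
      exact Matrix.toLin'_one
    have h2 : toRep ρ' g = 1 := hg
    change toRep ρ' (g * w) = 1
    rw [map_mul, h1, h2, one_mul]
  · intro w
    have h1 : (ρ' w).1 * N * (ρ' w)⁻¹.1 = (weilNorm w : E) • N := by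
      have hcomm : exp (-a w • N) * N = N * exp (-a w • N) := by
        obtain ⟨k, hk⟩ := hN
        rw [exp_smul_eq_sum hk, Finset.sum_mul, Finset.mul_sum]
        refine Finset.sum_congr rfl fun i _ => ?_
        rw [smul_mul_assoc, mul_smul_comm, pow_mul_comm']
      have h2 : (ρ' w)⁻¹.1 = exp (a w • N) * (ρ w)⁻¹.1 := by
        change ((ρ w * expUnit (hnil (-a w)))⁻¹).1 = _
        rw [mul_inv_rev, Units.val_mul]
        congr 1
        change exp (-(-a w • N)) = _
        rw [neg_smul, neg_neg]
      have h3 : exp (-a w • N) * exp (a w • N) = 1 := by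
        rw [neg_smul]
        exact IsNilpotent.exp_neg_mul_exp_self (hnil _)
      rw [← hconj w, h2, hρ'val]
      calc (ρ w).1 * exp (-a w • N) * N * (exp (a w • N) * (ρ w)⁻¹.1)
          = (ρ w).1 * (exp (-a w • N) * N) * exp (a w • N) * (ρ w)⁻¹.1 := by
            simp only [mul_assoc]
        _ = (ρ w).1 * N * (exp (-a w • N) * exp (a w • N)) * (ρ w)⁻¹.1 := by
            rw [hcomm]; simp only [mul_assoc]
        _ = _ := by rw [h3, mul_one]
    change Matrix.toLin' (ρ' w).1 * Matrix.toLin' N * Matrix.toLin' (ρ' w⁻¹).1 = _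
    rw [map_inv, Module.End.mul_eq_comp, Module.End.mul_eq_comp, ← Matrix.toLin'_mul,
      ← Matrix.toLin'_mul, h1, map_smul]
  · intro k σ
    rw [ht, ← map_smul, toLin_nilpotentExp _ (hnil _)]
    change Matrix.toLin' (ρ _).1 = Matrix.toLin' (ρ' _).1 * Matrix.toLin' _
    rw [Module.End.mul_eq_comp, ← Matrix.toLin'_mul, hρ'val]
    have h1 : a (Φ ^ k * σ.1) = algebraMap ℚ_[ℓ] E ((T σ).toAdd : ℚ_[ℓ]) := by
      simp only [a, huniq]
      rfl
    rw [h1, mul_assoc, neg_smul, IsNilpotent.exp_neg_mul_exp_self (hnil _), mul_one]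

end WeilDeligneExists

/-! ### Deligne's conductor -/

section Deligne

section NilpotentExp

variable {E : Type*} [Field E] {V : Type*} [AddCommGroup V] [Module E V]

/-- The two-dimensional case decides: if `X v ≠ 0` and `k` is minimal with `X ^ k v = 0`, the vector
`w = X ^ (k - 2) v` has `X w ≠ 0 = X ^ 2 w`, hence `exp(X) w = w + X w ≠ w`. -/
lemma nilpotentExp_apply_eq_self_iff {X : Module.End E V} (hX : IsNilpotent X) (v : V) :
    nilpotentExp X v = v ↔ X v = 0 := by
  have hc : X ^ nilpotencyClass X = 0 := pow_nilpotencyClass hX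
  have happ : ∀ w, nilpotentExp X w =
      ∑ k ∈ Finset.range (nilpotencyClass X), ((k.factorial : E)⁻¹) • (X ^ k) w := fun w => by
    simp [nilpotentExp, LinearMap.sum_apply]
  constructor
  · intro h
    by_contra hv
    have hex : ∃ k, (X ^ k) v = 0 := ⟨_, by rw [hc]; rfl⟩
    classical
    obtain ⟨k, hk, hmin⟩ : ∃ k, (X ^ k) v = 0 ∧ ∀ m < k, (X ^ m) v ≠ 0 :=
      ⟨Nat.find hex, Nat.find_spec hex, fun m hm => Nat.find_min hex hm⟩
    obtain ⟨j, rfl⟩ : ∃ j, k = j + 2 := by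
      rcases k with _ | _ | j
      · exact absurd (by simpa using congrArg X hk) hv
      · exact absurd (by simpa using hk) hv
      · exact ⟨j, rfl⟩
    set w := (X ^ j) v with hw
    have hXw : X w ≠ 0 := by
      have := hmin (j + 1) (by omega)
      rwa [pow_succ', Module.End.mul_apply] at this
    have hge : ∀ m, 2 ≤ m → (X ^ m) w = 0 := fun m hm => by
      obtain ⟨i, rfl⟩ := Nat.exists_eq_add_of_le' hm
      rw [hw, ← Module.End.mul_apply, ← pow_add, show i + 2 + j = i + (j + 2) by ring, pow_add,
        Module.End.mul_apply, hk, map_zero]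
    have hcomm : nilpotentExp X * X ^ j = X ^ j * nilpotentExp X := by
      simp only [nilpotentExp, Finset.sum_mul, Finset.mul_sum, smul_mul_assoc, mul_smul_comm,
        ← pow_add, add_comm]
    have hfix : nilpotentExp X w = w := by
      rw [hw, ← Module.End.mul_apply, hcomm, Module.End.mul_apply, h]
    have h2 : 2 ≤ nilpotencyClass X := by
      by_contra hlt
      have : X ^ 1 = 0 := by
        rw [show 1 = nilpotencyClass X + (1 - nilpotencyClass X) by omega, pow_add, hc, zero_mul]
      exact hXw (by rw [← pow_one X, this]; rfl)
    rw [happ, ← Finset.sum_subset (Finset.range_mono h2) (fun m _ hm => by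
      rw [hge m (not_lt.1 fun hlt => hm (Finset.mem_range.2 hlt)), smul_zero])] at hfix
    simp [Finset.sum_range_succ] at hfix
    exact hXw hfix
  · intro h
    rw [happ]
    rcases hn : nilpotencyClass X with _ | c
    · rw [hn, pow_zero] at hc
      rw [show v = (1 : Module.End E V) v from rfl, hc]
      simp
    · rw [Finset.sum_range_succ', Finset.sum_eq_zero]
      · simp
      · intro m _
        rw [pow_succ, Module.End.mul_apply, h, map_zero, smul_zero]

lemma nilpotentExp_zero : nilpotentExp (0 : Module.End E V) = 1 := by
  ext v
  exact (nilpotentExp_apply_eq_self_iff IsNilpotent.zero v).2 rfl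

/-- Since `nilpotencyClass` is `0` off the nilpotent elements, `nilpotentExp` vanishes there. -/
lemma nilpotentExp_eq_zero {X : Module.End E V} (hX : ¬ IsNilpotent X) : nilpotentExp X = 0 := by
  have : nilpotencyClass X = 0 := by
    rw [nilpotencyClass, Nat.sInf_eq_zero]
    right
    by_contra h
    obtain ⟨k, hk⟩ := Set.nonempty_iff_ne_empty.2 h
    exact hX ⟨k, hk⟩
  simp [nilpotentExp, this]

end NilpotentExp

section

variable {F : Type*} [Field F] [ValuativeRel F] [TopologicalSpace F] [IsNonarchimedeanLocalField F]
  {Ω : Type*} [Field Ω] [Algebra F Ω] [IsGalois F Ω]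
  {E : Type*} [Field E] {V : Type*} [AddCommGroup V] [Module E V]

lemma exists_factorsThrough_of_isOpen {ρ : Representation E (WeilGroup F Ω) V}
    (h : IsOpen {w | ρ w = 1}) : ∃ K, FactorsThrough ρ K :=
  exists_forall_mem_of_mem_nhds_one (h.mem_nhds (map_one ρ))

lemma finrank_fixedBy_add_codimFixed [FiniteDimensional E V] {G : Type*} [Group G]
    (ρ : Representation E G V) (S : Set G) :
    codimFixed ρ S + Module.finrank E (fixedBy ρ S) = Module.finrank E V :=
  Submodule.finrank_quotient_add_finrank _

variable [IsSepClosed Ω] {ℓ : ℕ} [Fact ℓ.Prime] [Algebra ℚ_[ℓ] E]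
  {ρℓ ρ : Representation E (WeilGroup F Ω) V} {Φ : WeilGroup F Ω}
  {t : inertia F Ω →* Multiplicative ℚ_[ℓ]} {N : Module.End E V}

namespace Corresponds

lemma apply_inertia (h : Corresponds ρℓ Φ t ρ N) (σ : inertia F Ω) :
    ρℓ σ = ρ σ * nilpotentExp (algebraMap ℚ_[ℓ] E (t σ).toAdd • N) := by
  simpa using h.formula 0 σ

/-- No nilpotency of `N` is assumed: otherwise `nilpotentExp` would be `0` and `ρℓ σ` would not be
invertible. -/
lemma isNilpotent_smul (h : Corresponds ρℓ Φ t ρ N) (σ : inertia F Ω) :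
    IsNilpotent (algebraMap ℚ_[ℓ] E (t σ).toAdd • N) := by
  by_contra hX
  have h0 : ρℓ σ = 0 := by rw [h.apply_inertia, nilpotentExp_eq_zero hX, mul_zero]
  have h1 : (1 : Module.End E V) = 0 := by
    rw [← map_one ρℓ, ← mul_inv_cancel (σ : WeilGroup F Ω), map_mul, h0, zero_mul]
  exact hX ⟨0, by rw [pow_zero, h1]⟩

lemma apply_eq (h : Corresponds ρℓ Φ t ρ N) {σ : inertia F Ω} (hσ : (t σ).toAdd = 0) :
    ρℓ σ = ρ σ := by
  rw [h.apply_inertia, hσ, map_zero, zero_smul, nilpotentExp_zero, mul_one]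

/-- The `ℓ`-adic representation and its Weil–Deligne representation agree on wild inertia, where `t`
vanishes. -/
lemma apply_eq_of_mem_upperSet (h : Corresponds ρℓ Φ t ρ N) (hℓ : (ringChar 𝓀[F]).Coprime ℓ)
    {s : ℝ} (hs : 0 < s) {w : WeilGroup F Ω} (hw : w ∈ upperSet F Ω s) : ρℓ w = ρ w :=
  h.apply_eq (σ := ⟨w, upperSet_subset_inertia (by linarith) hw⟩)
    (hom_eq_zero_of_mem_upperSet h.t_continuous hℓ hs hw)

/-- A vector fixed by the whole of inertia under `ρℓ` is killed by `N`, because some `σ` with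
`t σ ≠ 0` lies in the kernel of `ρ`: its image in `Gal(K/F)` has finite order. -/
lemma fixedBy_inertia (h : Corresponds ρℓ Φ t ρ N) :
    fixedBy ρℓ (inertia F Ω) = fixedBy ρ (inertia F Ω) ⊓ LinearMap.ker N := by
  have hexp : ∀ {v : V}, N v = 0 → ∀ σ : inertia F Ω,
      nilpotentExp (algebraMap ℚ_[ℓ] E (t σ).toAdd • N) v = v := fun hv σ =>
    (nilpotentExp_apply_eq_self_iff (h.isNilpotent_smul σ) _).2 (by simp [hv])
  ext v
  simp only [Submodule.mem_inf, LinearMap.mem_ker]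
  constructor
  · intro hv
    have hN : N v = 0 := by
      obtain ⟨K, hK⟩ := exists_factorsThrough_of_isOpen h.weilDeligne.isOpen_ker
      obtain ⟨σ, hσ⟩ : ∃ σ, t σ ≠ 1 := by
        by_contra hcon
        exact h.t_ne_one (MonoidHom.ext fun σ => by_contra fun hne => hcon ⟨σ, hne⟩)
      -- `ρ` is trivial on `τ`, while `t τ ≠ 0`
      let τ : inertia F Ω := σ ^ Nat.card (K ≃ₐ[F] K)
      have hτ : ρ τ = 1 := hK _ τ.2 (by
        rw [show (τ : WeilGroup F Ω) = (σ : WeilGroup F Ω) ^ Nat.card (K ≃ₐ[F] K) from rfl,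
          map_pow, pow_card_eq_one'])
      have htτ : algebraMap ℚ_[ℓ] E (t τ).toAdd ≠ 0 := by
        rw [map_ne_zero, map_pow, toAdd_pow, nsmul_eq_mul]
        exact mul_ne_zero (Nat.cast_ne_zero.2 Nat.card_pos.ne') (fun h0 => hσ h0)
      have h1 := hv τ τ.2
      rw [h.apply_inertia, hτ, one_mul, nilpotentExp_apply_eq_self_iff (h.isNilpotent_smul τ),
        LinearMap.smul_apply] at h1
      exact (smul_eq_zero.1 h1).resolve_left htτ
    refine ⟨fun w hw => ?_, hN⟩
    have h1 := hv w hw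
    have h2 := h.apply_inertia ⟨w, hw⟩
    dsimp only at h2
    rw [h2, Module.End.mul_apply, hexp hN] at h1
    exact h1
  · rintro ⟨hv, hN⟩ w hw
    have h2 := h.apply_inertia ⟨w, hw⟩
    dsimp only at h2
    rw [h2, Module.End.mul_apply, hexp hN, hv w hw]

lemma codimFixed_upperSet (h : Corresponds ρℓ Φ t ρ N) (hℓ : (ringChar 𝓀[F]).Coprime ℓ)
    {s : ℝ} (hs : 0 < s) :
    codimFixed ρℓ (upperSet F Ω s) = codimFixed ρ (upperSet F Ω s) := by
  refine codimFixed_congr ?_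
  ext v
  exact forall₂_congr fun w hw => by rw [h.apply_eq_of_mem_upperSet hℓ hs hw]

lemma integrableOn (h : Corresponds ρℓ Φ t ρ N) (hℓ : (ringChar 𝓀[F]).Coprime ℓ) :
    IntegrableOn (fun s => (codimFixed ρℓ (upperSet F Ω s) : ℝ)) (Set.Ioi 0) := by
  obtain ⟨K, hK⟩ := exists_factorsThrough_of_isOpen h.weilDeligne.isOpen_ker
  refine (integral_codimFixed hK).1.congr_fun (fun s hs => ?_) measurableSet_Ioi
  simp only [h.codimFixed_upperSet hℓ hs]

/-- Passing from `ρ` to `ρℓ` trades `codim V^{I_F}` for `codim V_N^{I_F} = codim V_ℓ^{I_F}`, and it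
does not change the integral over `s > 0`. -/
lemma hasWeilDeligneConductor [FiniteDimensional E V] (h : Corresponds ρℓ Φ t ρ N)
    (hℓ : (ringChar 𝓀[F]).Coprime ℓ) :
    HasWeilDeligneConductor ρ N (codimFixed ρℓ (inertia F Ω) +
      ∫ s in Set.Ioi 0, (codimFixed ρℓ (upperSet F Ω s) : ℝ)) := by
  have hint : ∫ s in Set.Ioi 0, (codimFixed ρℓ (upperSet F Ω s) : ℝ) =
      ∫ s in Set.Ioi 0, (codimFixed ρ (upperSet F Ω s) : ℝ) :=
    setIntegral_congr_fun measurableSet_Ioi fun s hs => by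
      simp only [h.codimFixed_upperSet hℓ hs]
  refine ⟨codimFixed ρ (inertia F Ω) + ∫ s in Set.Ioi 0, (codimFixed ρ (upperSet F Ω s) : ℝ),
    ⟨exists_factorsThrough_of_isOpen h.weilDeligne.isOpen_ker, fun K hK => ?_⟩, ?_⟩
  · obtain ⟨_, h1, h2⟩ := integral_codimFixed hK
    rw [h2, h1]
  · have e1 : (codimFixed ρℓ (inertia F Ω) : ℝ) + Module.finrank E (fixedBy ρℓ (inertia F Ω)) =
        Module.finrank E V := mod_cast finrank_fixedBy_add_codimFixed ρℓ _
    have e2 : (codimFixed ρ (inertia F Ω) : ℝ) + Module.finrank E (fixedBy ρ (inertia F Ω)) =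
        Module.finrank E V := mod_cast finrank_fixedBy_add_codimFixed ρ _
    rw [← h.fixedBy_inertia, hint]
    linarith

end Corresponds

end

end Deligne

/-! ### Composition series and fixed vectors -/

section CompositionSeries

variable {E : Type*} [Field E] {V : Type*} [AddCommGroup V] [Module E V] {G : Type*} [Group G]
  {ρ : Representation E G V}

lemma nonempty_compSeries [FiniteDimensional E V] (ρ : Representation E G V) :
    Nonempty (CompSeries ρ) := by
  have hmono : StrictMono (Subrepresentation.toSubmodule : Subrepresentation ρ → Submodule E V) :=
    fun _ _ h => h
  have h1 : WellFoundedLT (Subrepresentation ρ) := hmono.wellFoundedLT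
  have h2 : WellFoundedGT (Subrepresentation ρ) := hmono.wellFoundedGT
  obtain ⟨a, h0, n, hn, h⟩ := exists_covBy_seq_of_wellFoundedLT_wellFoundedGT_of_le
    (bot_le : (⊥ : Subrepresentation ρ) ≤ ⊤)
  exact ⟨⟨⟨n, fun i => a i, fun i => h i i.2⟩, h0, hn⟩⟩

lemma finrank_fixedBy_directSum [FiniteDimensional E V] {ι : Type*} [Fintype ι] {M : ι → Type*}
    [∀ i, AddCommGroup (M i)] [∀ i, Module E (M i)] [∀ i, FiniteDimensional E (M i)]
    (τ : ∀ i, Representation E G (M i)) (H : Set G) :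
    Module.finrank E (fixedBy (Representation.directSum τ) H) =
      ∑ i, Module.finrank E (fixedBy (τ i) H) := by
  classical
  have key : ∀ v : ⨁ i, M i, v ∈ fixedBy (Representation.directSum τ) H ↔
      ∀ i, v i ∈ fixedBy (τ i) H := fun v =>
    ⟨fun h i g hg => DFunLike.congr_fun (h g hg) i, fun h g hg => DFinsupp.ext fun i => h i g hg⟩
  let e : fixedBy (Representation.directSum τ) H ≃ₗ[E] ∀ i, fixedBy (τ i) H :=
    { toFun := fun v i => ⟨v.1 i, (key v.1).1 v.2 i⟩
      map_add' := fun _ _ => rfl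
      map_smul' := fun _ _ => rfl
      invFun := fun f => ⟨DirectSum.linearEquivFunOnFintype E ι M |>.symm fun i => (f i).1,
        (key _).2 fun i => (f i).2⟩
      left_inv := fun v => Subtype.ext (DFinsupp.ext fun i => rfl)
      right_inv := fun f => rfl }
  rw [e.finrank_eq, Module.finrank_pi_fintype]

/-- Averaging over the finite group `ρ(H)`: a vector of `U` that is fixed by `H` modulo `W` differs
by an element of `W` from a vector fixed by `H`. -/
lemma exists_fixed_sub_mem [CharZero E] {H : Subgroup G} (hH : (ρ '' (H : Set G)).Finite)
    (U W : Subrepresentation ρ) {u : V} (hu : u ∈ U.toSubmodule)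
    (h : ∀ g ∈ H, ρ g u - u ∈ W.toSubmodule) :
    ∃ v ∈ U.toSubmodule ⊓ fixedBy ρ (H : Set G), v - u ∈ W.toSubmodule := by
  classical
  set A := hH.toFinset with hA
  have hmem : ∀ {a}, a ∈ A ↔ ∃ g ∈ H, ρ g = a := fun {a} => by simp [hA]
  have hc : (A.card : E) ≠ 0 := Nat.cast_ne_zero.2
    (Finset.card_ne_zero_of_mem (hmem.2 ⟨1, H.one_mem, rfl⟩))
  refine ⟨(A.card : E)⁻¹ • ∑ a ∈ A, a u, ⟨Submodule.smul_mem _ _ (Submodule.sum_mem _ ?_), ?_⟩, ?_⟩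
  · rintro a ha
    obtain ⟨g, -, rfl⟩ := hmem.1 ha
    exact U.apply_mem_toSubmodule g hu
  · intro g hg
    rw [map_smul, map_sum]
    congr 1
    refine Finset.sum_bij' (fun a _ => ρ g * a) (fun a _ => ρ g⁻¹ * a) ?_ ?_ ?_ ?_ ?_
    · rintro a ha
      obtain ⟨g', hg', rfl⟩ := hmem.1 ha
      exact hmem.2 ⟨g * g', H.mul_mem hg hg', map_mul ρ g g'⟩
    · rintro a ha
      obtain ⟨g', hg', rfl⟩ := hmem.1 ha
      exact hmem.2 ⟨g⁻¹ * g', H.mul_mem (H.inv_mem hg) hg', map_mul ρ g⁻¹ g'⟩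
    · intro a _
      simp only [← mul_assoc, ← map_mul, inv_mul_cancel, map_one, one_mul]
    · intro a _
      simp only [← mul_assoc, ← map_mul, mul_inv_cancel, map_one, one_mul]
    · intro a _
      rfl
  · have : (A.card : E)⁻¹ • ∑ a ∈ A, a u - u = (A.card : E)⁻¹ • ∑ a ∈ A, (a u - u) := by
      rw [Finset.sum_sub_distrib, Finset.sum_const, smul_sub, ← Nat.cast_smul_eq_nsmul E,
        inv_smul_smul₀ hc]
    rw [this]
    refine Submodule.smul_mem _ _ (Submodule.sum_mem _ fun a ha => ?_)
    obtain ⟨g, hg, rfl⟩ := hmem.1 ha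
    exact h g hg

namespace CompSeries

variable (S : CompSeries ρ)

lemma chain_le (i : Fin S.chain.length) :
    (S.chain i.castSucc).toSubmodule ≤ (S.chain i.succ).toSubmodule :=
  (S.chain.step i).le

/-- The class in `V_{i+1} / V_i` of an element of `V_{i+1}` is fixed by `g` if and only if the
element is fixed modulo `V_i`. -/
lemma factorRep_mk_eq_iff (i : Fin S.chain.length) (g : G) (u : (S.chain i.succ).toSubmodule) :
    S.factorRep i g (Submodule.Quotient.mk u) = Submodule.Quotient.mk u ↔
      ρ g u - u ∈ (S.chain i.castSucc).toSubmodule :=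
  Submodule.Quotient.eq _

/-- Additivity of the dimension of the `H`-fixed vectors along
`0 → V_i → V_{i+1} → V_{i+1} / V_i → 0`. Here surjectivity on fixed vectors is by averaging. -/
lemma finrank_fixedBy_factorRep [FiniteDimensional E V] [CharZero E] {H : Subgroup G}
    (hH : (ρ '' (H : Set G)).Finite) (i : Fin S.chain.length) :
    Module.finrank E (fixedBy (S.factorRep i) (H : Set G)) +
      Module.finrank E
        ((S.chain i.castSucc).toSubmodule ⊓ fixedBy ρ (H : Set G) : Submodule E V) =
      Module.finrank E
        ((S.chain i.succ).toSubmodule ⊓ fixedBy ρ (H : Set G) : Submodule E V) := by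
  set U := S.chain i.succ with hU
  set W := S.chain i.castSucc with hW
  have hle : W.toSubmodule ≤ U.toSubmodule := S.chain_le i
  let X := U.toSubmodule ⊓ fixedBy ρ (H : Set G)
  let f : X →ₗ[E] S.Factor i := (W.toSubmodule.submoduleOf U.toSubmodule).mkQ ∘ₗ
    Submodule.inclusion (inf_le_left : X ≤ U.toSubmodule)
  have hrange : LinearMap.range f = fixedBy (S.factorRep i) (H : Set G) := by
    ext y
    constructor
    · rintro ⟨x, rfl⟩ g hg
      refine (S.factorRep_mk_eq_iff i g _).2 ?_
      change ρ g x.1 - x.1 ∈ _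
      rw [x.2.2 g hg, sub_self]
      exact Submodule.zero_mem _
    · intro hy
      obtain ⟨u, rfl⟩ := Submodule.Quotient.mk_surjective _ y
      obtain ⟨v, hv, hvu⟩ := exists_fixed_sub_mem hH U W u.2
        fun g hg => (S.factorRep_mk_eq_iff i g u).1 (hy g hg)
      exact ⟨⟨v, hv⟩, (Submodule.Quotient.eq _).2 hvu⟩
  have hker : LinearMap.ker f = (W.toSubmodule ⊓ fixedBy ρ (H : Set G)).submoduleOf X := by
    ext x
    rw [LinearMap.mem_ker]
    refine (Submodule.Quotient.mk_eq_zero _).trans ?_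
    exact ⟨fun h => ⟨h, x.2.2⟩, fun h => h.1⟩
  have h1 := f.finrank_range_add_finrank_ker
  rwa [hrange, hker, (Submodule.submoduleOfEquivOfLe (inf_le_inf_right _ hle)).finrank_eq] at h1

lemma sum_add_eq_last : ∀ {n : ℕ} (a : Fin (n + 1) → ℕ) (b : Fin n → ℕ),
    (∀ i, b i + a i.castSucc = a i.succ) → ∑ i, b i + a 0 = a (Fin.last n)
  | 0, _, _, _ => by simp
  | n + 1, a, b, h => by
    have ih := sum_add_eq_last (fun i => a i.castSucc) (fun i => b i.castSucc)
      fun i => h i.castSucc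
    rw [Fin.sum_univ_castSucc, ← Fin.succ_last, ← h, ← ih, Fin.castSucc_zero]
    omega

/-- Taking vectors fixed by `H` is exact if `H` acts through a finite group. -/
lemma finrank_fixedBy_semisimplification [FiniteDimensional E V] [CharZero E] {H : Subgroup G}
    (hH : (ρ '' (H : Set G)).Finite) :
    Module.finrank E (fixedBy (V := ⨁ i, S.Factor i) S.semisimplification (H : Set G)) =
      Module.finrank E (fixedBy ρ (H : Set G)) := by
  have h := sum_add_eq_last (fun j => Module.finrank E
    ((S.chain j).toSubmodule ⊓ fixedBy ρ (H : Set G) : Submodule E V)) _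
    (S.finrank_fixedBy_factorRep hH)
  have h0 : (S.chain 0).toSubmodule = ⊥ := congrArg Subrepresentation.toSubmodule S.head_eq
  have hl : (S.chain (Fin.last _)).toSubmodule = ⊤ :=
    congrArg Subrepresentation.toSubmodule S.last_eq
  rw [h0, hl, bot_inf_eq, top_inf_eq, finrank_bot, add_zero] at h
  rw [← h]
  exact finrank_fixedBy_directSum (V := V) _ _

lemma finrank_semisimplification [FiniteDimensional E V] [CharZero E] :
    Module.finrank E (⨁ i, S.Factor i) = Module.finrank E V := by
  have h := S.finrank_fixedBy_semisimplification (H := ⊥) (by simp)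
  have key : ∀ {M : Type _} [AddCommGroup M] [Module E M] (τ : Representation E G M),
      fixedBy τ ((⊥ : Subgroup G) : Set G) = ⊤ := fun τ => by
    ext v
    simp [fixedBy]
  have key' : fixedBy ρ ((⊥ : Subgroup G) : Set G) = ⊤ := by
    ext v
    simp [fixedBy]
  rwa [key, key', finrank_top, finrank_top] at h

lemma codimFixed_semisimplification [FiniteDimensional E V] [CharZero E] {H : Subgroup G}
    (hH : (ρ '' (H : Set G)).Finite) :
    codimFixed (V := ⨁ i, S.Factor i) S.semisimplification (H : Set G) = codimFixed ρ (H : Set G) := by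
  have h1 := finrank_fixedBy_add_codimFixed ρ (H : Set G)
  have hfd : FiniteDimensional E (⨁ i, S.Factor i) :=
    Module.Finite.equiv (DirectSum.linearEquivFunOnFintype E _ _).symm
  have h2 := finrank_fixedBy_add_codimFixed (V := ⨁ i, S.Factor i) S.semisimplification (H : Set G)
  rw [S.finrank_semisimplification, S.finrank_fixedBy_semisimplification hH] at h2
  omega

end CompSeries

end CompositionSeries

/-! ### Serre's conductor -/

section Serre

section Unipotent

variable {E : Type*} [Field E] {V : Type*} [AddCommGroup V] [Module E V] {G : Type*} [Group G]
  {ρ : Representation E G V}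

lemma exists_nilpotentExp_eq_one_add (X : Module.End E V) (hX : IsNilpotent X) :
    ∃ Y, Commute X Y ∧ nilpotentExp X = 1 + X * Y := by
  rcases hn : nilpotencyClass X with _ | c
  · have h0 : (1 : Module.End E V) = 0 := by
      rw [← pow_zero X, ← hn, pow_nilpotencyClass hX]
    exact ⟨0, Commute.zero_right X, by rw [← mul_one (nilpotentExp X), h0]; simp⟩
  · refine ⟨∑ k ∈ Finset.range c, (((k + 1).factorial : E)⁻¹) • X ^ k,
      Commute.sum_right _ _ _ fun k _ => ((Commute.refl X).pow_right k).smul_right _, ?_⟩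
    rw [nilpotentExp, hn, Finset.sum_range_succ', Finset.mul_sum, add_comm]
    congr 1
    · simp
    · exact Finset.sum_congr rfl fun k _ => by rw [mul_smul_comm, pow_succ']

/-- A normal subgroup `J` acts trivially on the Jordan–Hölder factors if all `ρ(σ) - 1`, `σ ∈ J`,
are multiples of one nilpotent endomorphism `N` that commutes with the cofactors. Indeed the
vectors of `V_{i+1}` fixed by `J` modulo `V_i` form a subrepresentation between `V_i` and
`V_{i+1}`. If it were `V_i`, then a vector outside `V_i` could be moved by some `ρ(σ) - 1` to
another such vector, and so there would be vectors in `range (N ^ j)` outside `V_i` for all `j`. -/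
lemma CompSeries.factorRep_eq_one (S : CompSeries ρ) {J : Subgroup G} (hJ : J.Normal)
    {N : Module.End E V} (hN : IsNilpotent N)
    (h : ∀ σ ∈ J, ∃ Y, Commute N Y ∧ ρ σ = 1 + N * Y) (i : Fin S.chain.length) {σ : G}
    (hσ : σ ∈ J) : S.factorRep i σ = 1 := by
  set U := S.chain i.succ with hU
  set W := S.chain i.castSucc with hW
  have hcov : W ⋖ U := S.chain.step i
  let X : Subrepresentation ρ :=
    { toSubmodule :=
      { carrier := {v | v ∈ U.toSubmodule ∧ ∀ σ ∈ J, ρ σ v - v ∈ W.toSubmodule}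
        zero_mem' := ⟨U.toSubmodule.zero_mem, fun σ _ => by simp⟩
        add_mem' := fun {a b} ha hb => ⟨U.toSubmodule.add_mem ha.1 hb.1, fun σ hσ => by
          rw [map_add, add_sub_add_comm]
          exact W.toSubmodule.add_mem (ha.2 σ hσ) (hb.2 σ hσ)⟩
        smul_mem' := fun c a ha => ⟨U.toSubmodule.smul_mem c ha.1, fun σ hσ => by
          rw [map_smul, ← smul_sub]
          exact W.toSubmodule.smul_mem c (ha.2 σ hσ)⟩ }
      apply_mem_toSubmodule := fun g v hv => ⟨U.apply_mem_toSubmodule g hv.1, fun σ hσ => by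
        have h1 := W.apply_mem_toSubmodule g (hv.2 _ (hJ.conj_mem σ hσ g⁻¹))
        rwa [map_sub, ← Module.End.mul_apply, ← map_mul, inv_inv, mul_assoc,
          mul_inv_cancel_left, map_mul, Module.End.mul_apply] at h1⟩ }
  have hWX : W ≤ X := fun v hv => ⟨hcov.le hv, fun σ _ =>
    W.toSubmodule.sub_mem (W.apply_mem_toSubmodule σ hv) hv⟩
  have hXU : X ≤ U := fun v hv => hv.1
  rcases hcov.eq_or_eq hWX hXU with hXW | hXU'
  · exfalso
    obtain ⟨u, hu, huW⟩ := SetLike.exists_of_lt hcov.lt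
    have key : ∀ j, ∃ v, (N ^ j) v ∈ U.toSubmodule ∧ (N ^ j) v ∉ W.toSubmodule := fun j => by
      induction j with
      | zero => exact ⟨u, hu, huW⟩
      | succ j ih =>
        obtain ⟨v, hv, hvW⟩ := ih
        have hvX : (N ^ j) v ∉ X := by rwa [hXW]
        obtain ⟨τ, hτ, hτW⟩ : ∃ τ ∈ J, ρ τ ((N ^ j) v) - (N ^ j) v ∉ W.toSubmodule := by
          by_contra hcon
          push Not at hcon
          exact hvX ⟨hv, hcon⟩
        obtain ⟨Y, hY, hρ⟩ := h τ hτ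
        have heq : ρ τ ((N ^ j) v) - (N ^ j) v = (N ^ (j + 1)) (Y v) := by
          rw [hρ, LinearMap.add_apply, Module.End.one_apply, add_sub_cancel_left,
            ← Module.End.mul_apply, ← Module.End.mul_apply, mul_assoc, ← (hY.pow_left j).eq,
            ← mul_assoc, ← pow_succ']
        rw [heq] at hτW
        refine ⟨Y v, heq ▸ ?_, hτW⟩
        exact U.toSubmodule.sub_mem (U.apply_mem_toSubmodule τ hv) hv
    obtain ⟨m, hm⟩ := hN
    obtain ⟨v, -, hv⟩ := key m
    rw [hm] at hv
    exact hv W.toSubmodule.zero_mem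
  · refine LinearMap.ext fun y => ?_
    obtain ⟨u, rfl⟩ := Submodule.Quotient.mk_surjective _ y
    have hu : (u : V) ∈ X := by
      rw [hXU']
      exact u.2
    exact (S.factorRep_mk_eq_iff i σ u).2 (hu.2 σ hσ)

end Unipotent

variable {F : Type*} [Field F] [ValuativeRel F] [TopologicalSpace F] [IsNonarchimedeanLocalField F]
  {Ω : Type*} [Field Ω] [Algebra F Ω] [IsGalois F Ω] [IsSepClosed Ω]
  {E : Type*} [Field E] {V : Type*} [AddCommGroup V] [Module E V]
  {ℓ : ℕ} [Fact ℓ.Prime] [Algebra ℚ_[ℓ] E]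
  {ρℓ ρ : Representation E (WeilGroup F Ω) V} {Φ : WeilGroup F Ω}
  {t : inertia F Ω →* Multiplicative ℚ_[ℓ]} {N : Module.End E V}

/-- Inertia has finite image, as `ρ w` depends only on the restriction of `w` to `K`. -/
lemma finite_image_inertia {ρ : Representation E (WeilGroup F Ω) V}
    {K : FiniteGaloisIntermediateField F Ω} (hρ : FactorsThrough ρ K) :
    (ρ '' (inertia F Ω)).Finite := by
  refine (Set.finite_range fun g : K ≃ₐ[F] K =>
    ρ (Function.invFunOn (restrictTo K) (inertia F Ω) g)).subset ?_
  rintro _ ⟨w, hw, rfl⟩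
  have hex : ∃ v ∈ (inertia F Ω : Set (WeilGroup F Ω)), restrictTo K v = restrictTo K w :=
    ⟨w, hw, rfl⟩
  refine ⟨restrictTo K w, ?_⟩
  set v := Function.invFunOn (restrictTo K) (inertia F Ω) (restrictTo K w) with hv
  have hvI : v ∈ inertia F Ω := Function.invFunOn_mem hex
  have hvw : restrictTo K v = restrictTo K w := Function.invFunOn_eq hex
  have h1 : ρ (v⁻¹ * w) = 1 := hρ _ (mul_mem (inv_mem hvI) hw)
    (by rw [map_mul, map_inv, hvw, inv_mul_cancel])
  change ρ v = ρ w
  rw [show w = v * (v⁻¹ * w) by group, map_mul, h1, mul_one]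

namespace Corresponds

lemma isNilpotent (h : Corresponds ρℓ Φ t ρ N) : IsNilpotent N := by
  obtain ⟨σ, hσ⟩ : ∃ σ, t σ ≠ 1 := by
    by_contra hcon
    exact h.t_ne_one (MonoidHom.ext fun σ => by_contra fun hne => hcon ⟨σ, hne⟩)
  have hc : algebraMap ℚ_[ℓ] E (t σ).toAdd ≠ 0 := (map_ne_zero _).2 fun h0 => hσ h0
  have := (h.isNilpotent_smul σ).smul (algebraMap ℚ_[ℓ] E (t σ).toAdd)⁻¹
  rwa [inv_smul_smul₀ hc] at this

/-- Where `ρ` is trivial, `ρℓ` is the exponential of multiples of the nilpotent `N`. -/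
lemma factorsThrough_semisimplification (h : Corresponds ρℓ Φ t ρ N)
    {K : FiniteGaloisIntermediateField F Ω} (hK : FactorsThrough ρ K) (S : CompSeries ρℓ) :
    FactorsThrough (V := ⨁ i, S.Factor i) S.semisimplification K := by
  intro w hw hwK
  have key := S.factorRep_eq_one (J := inertia F Ω ⊓ (restrictTo K).ker) inferInstance
    h.isNilpotent (fun σ hσ => by
      have hσI : σ ∈ inertia F Ω := hσ.1
      obtain ⟨Y, hY, he⟩ := exists_nilpotentExp_eq_one_add _ (h.isNilpotent_smul ⟨σ, hσI⟩)
      have h1 := h.apply_inertia ⟨σ, hσI⟩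
      dsimp only at h1
      by_cases hc : algebraMap ℚ_[ℓ] E (t ⟨σ, hσI⟩).toAdd = 0
      · exact ⟨0, Commute.zero_right _, by
          rw [h1, hK σ hσI hσ.2, one_mul, hc, zero_smul, nilpotentExp_zero, mul_zero, add_zero]⟩
      · refine ⟨algebraMap ℚ_[ℓ] E (t ⟨σ, hσI⟩).toAdd • Y, ?_, ?_⟩
        · have h2 := hY.smul_left (algebraMap ℚ_[ℓ] E (t ⟨σ, hσI⟩).toAdd)⁻¹
          rw [inv_smul_smul₀ hc] at h2
          exact h2.smul_right _
        · rw [h1, hK σ hσI hσ.2, one_mul, he, smul_mul_assoc, mul_smul_comm])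
  refine LinearMap.ext fun v => DFinsupp.ext fun i => ?_
  exact LinearMap.congr_fun (key i ⟨hw, hwK⟩) (v i)

/-- The groups `G_F^s` with `s > 0` act on `V_ℓ` through finite groups, so that the codimensions of
the fixed vectors are those for the semisimplification. -/
lemma codimFixed_semisimplification [FiniteDimensional E V] [CharZero E]
    (h : Corresponds ρℓ Φ t ρ N) (hℓ : (ringChar 𝓀[F]).Coprime ℓ) (S : CompSeries ρℓ) {s : ℝ}
    (hs : 0 < s) : codimFixed (V := ⨁ i, S.Factor i) S.semisimplification (upperSet F Ω s) =
      codimFixed ρℓ (upperSet F Ω s) := by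
  obtain ⟨K, hK⟩ := exists_factorsThrough_of_isOpen h.weilDeligne.isOpen_ker
  refine S.codimFixed_semisimplification
    (H := (absUpperGroup F Ω s).comap (WeilGroup.incl F Ω)) ?_
  refine (finite_image_inertia hK).subset ?_
  rintro _ ⟨w, hw, rfl⟩
  exact ⟨w, upperSet_subset_inertia (by linarith) hw, (h.apply_eq_of_mem_upperSet hℓ hs hw).symm⟩

lemma hasSerreConductor [FiniteDimensional E V] [CharZero E] (h : Corresponds ρℓ Φ t ρ N)
    (hℓ : (ringChar 𝓀[F]).Coprime ℓ) :
    HasSerreConductor ρℓ (codimFixed ρℓ (inertia F Ω) +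
      ∫ s in Set.Ioi 0, (codimFixed ρℓ (upperSet F Ω s) : ℝ)) := by
  refine ⟨nonempty_compSeries ρℓ, fun S => ⟨_, ⟨?_, fun K hK => ?_⟩, rfl⟩⟩
  · obtain ⟨K, hK⟩ := exists_factorsThrough_of_isOpen h.weilDeligne.isOpen_ker
    exact ⟨K, h.factorsThrough_semisimplification hK S⟩
  · obtain ⟨_, h1, -⟩ := integral_codimFixed hK
    rw [← h1]
    exact setIntegral_congr_fun measurableSet_Ioi fun s hs =>
      congrArg Nat.cast (h.codimFixed_semisimplification hℓ S hs)

end Corresponds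

end Serre

/-! ### The integral over `(-1, ∞)` -/

section Integral

variable {F : Type*} [Field F] [ValuativeRel F] [TopologicalSpace F] [IsNonarchimedeanLocalField F]
  {Ω : Type*} [Field Ω] [Algebra F Ω] [IsGalois F Ω]
  {E : Type*} [Field E] {V : Type*} [AddCommGroup V] [Module E V]

/-- On `(-1, 0]` the integrand is the constant `codim V^{I_F}`. -/
lemma integral_Ioi_neg_one {ρ : Representation E (WeilGroup F Ω) V}
    (h : IntegrableOn (fun s => (codimFixed ρ (upperSet F Ω s) : ℝ)) (Set.Ioi 0)) :
    IntegrableOn (fun s => (codimFixed ρ (upperSet F Ω s) : ℝ)) (Set.Ioi (-1)) ∧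
      ∫ s in Set.Ioi (-1), (codimFixed ρ (upperSet F Ω s) : ℝ) =
        codimFixed ρ (inertia F Ω) + ∫ s in Set.Ioi 0, (codimFixed ρ (upperSet F Ω s) : ℝ) := by
  have heq : Set.EqOn (fun s => (codimFixed ρ (upperSet F Ω s) : ℝ))
      (fun _ => (codimFixed ρ (inertia F Ω) : ℝ)) (Set.Ioc (-1) 0) := fun s hs => by
    simp only [upperSet_of_nonpos hs.1 hs.2]
  have h1 : IntegrableOn (fun s => (codimFixed ρ (upperSet F Ω s) : ℝ)) (Set.Ioc (-1) 0) :=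
    (integrableOn_const (by simp)).congr_fun heq.symm measurableSet_Ioc
  rw [← Set.Ioc_union_Ioi_eq_Ioi (show (-1 : ℝ) ≤ 0 by norm_num)]
  refine ⟨h1.union h, ?_⟩
  rw [setIntegral_union (Set.Ioc_disjoint_Ioi le_rfl) measurableSet_Ioi h1 h,
    setIntegral_congr_fun measurableSet_Ioc heq]
  simp

end Integral

end LocalConductor

end

open LocalConductor in
theorem theorem1
    {F : Type*} [Field F] [ValuativeRel F] [TopologicalSpace F] [IsNonarchimedeanLocalField F]
    {Ω : Type*} [Field Ω] [Algebra F Ω] [IsSepClosure F Ω]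
    {ℓ : ℕ} [Fact ℓ.Prime] (hℓ : ℓ ≠ ringChar 𝓀[F])
    {E : Type*} [NormedField E] [NormedAlgebra ℚ_[ℓ] E] [FiniteDimensional ℚ_[ℓ] E]
    {n : ℕ} (ρℓ : WeilGroup F Ω →* Matrix.GeneralLinearGroup (Fin n) E) (hρℓ : Continuous ρℓ) :
    IntegrableOn (fun s : ℝ => (codimFixed (toRep ρℓ) (upperSet F Ω s) : ℝ)) (Set.Ioi (-1)) ∧
    ∃ a aD : ℝ,
      HasSerreConductor (toRep ρℓ) a ∧
      HasDeligneConductor ℓ (toRep ρℓ) aD ∧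
      ∫ s in Set.Ioi (-1 : ℝ), (codimFixed (toRep ρℓ) (upperSet F Ω s) : ℝ) = a ∧
      a = aD := by
  have hsep : IsSepClosed Ω := IsSepClosure.sep_closed F
  have hchar : CharZero E := charZero_of_injective_algebraMap (algebraMap ℚ_[ℓ] E).injective
  have hultra : IsUltrametricDist E :=
    IsUltrametricDist.isUltrametricDist_of_forall_norm_natCast_le_one fun m => by
      rw [← map_natCast (algebraMap ℚ_[ℓ] E), norm_algebraMap']
      exact mod_cast Padic.norm_int_le_one (p := ℓ) m
  have hp : (ringChar 𝓀[F]).Coprime ℓ := by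
    have : Fact (ringChar 𝓀[F]).Prime := ⟨CharP.char_is_prime 𝓀[F] _⟩
    exact (Nat.coprime_primes this.out Fact.out).2 hℓ.symm
  obtain ⟨Φ, t, ρ, N, h⟩ := exists_corresponds hp hρℓ
  obtain ⟨h1, h2⟩ := integral_Ioi_neg_one (h.integrableOn hp)
  exact ⟨h1, _, _, h.hasSerreConductor hp, ⟨⟨Φ, t, ρ, N, h⟩, fun Φ' t' ρ' N' h' =>
    h'.hasWeilDeligneConductor hp⟩, h2, rfl⟩
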